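/- **Theorem 1.1 (Existence of a Lyapunov functional in similarity variables).** Let $N\ge 1$ be an integer and let $p,q,M$ be real numbers with $1<p$, $(N-1)(p-1)<4$ (that is, $1<p<1+\frac4{N-1}$, with no upper bound on $p$ if $N=1$), $0\le q<p$ and $M>0$. Let $B$ be the open unit ball of $\mathbb R^N$ and put $$\alpha=\frac2{p-1}-\frac{N-1}2>0,\qquad \rho(y)=(1-|y|^2)^\alpha,\qquad \gamma=\min\Big(\frac12,\frac{p-q}{p-1}\Big)>0 .$$ Let $$\mathcal H=\Big\{(w_1,w_2):\ \|(w_1,w_2)\|_{\mathcal H}^2=\int_B\big(w_2^2+|\nabla w_1|^2(1-|y|^2)+w_1^2\big)\rho\,dy<\infty\Big\},$$ where $\nabla w_1$ is the weak gradient on $B$. For $f,g:\mathbb R\to\mathbb R$ consider the equation $$w_{ss}=\frac1\rho\operatorname{div}\big(\rho\nabla w-\rho(y\cdot\nabla w)y\big)-\frac{2p+2}{(p-1)^2}w-\frac{p+3}{p-1}w_s-2y\cdot\nabla w_s+\mathcal N(w),\tag{1.8}$$ $$\mathcal N(w)=|w|^{p-1}w+e^{-\frac{2ps}{p-1}}f\big(e^{\frac{2s}{p-1}}w\big)+e^{-\frac{2ps}{p-1}}g\Big(e^{\frac{(p+1)s}{p-1}}\big(w_s+y\cdot\nabla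 w+\tfrac2{p-1}w\big)\Big).$$ A solution of (1.8) on $[s_0,\infty)$ is a function $w$ with $(w,w_s)\in C([s_0,\infty),\mathcal H)$ and $\mathcal N(w)\in L^1_{loc}([s_0,\infty),L^2_{loc}(B))$ that satisfies (1.8) in the sense of distributions on $B\times(s_0,\infty)$. With $F(u)=\int_0^uf(v)\,dv$ define $$E_0(w)=\int_B\Big(\tfrac12w_s^2+\tfrac12|\nabla w|^2-\tfrac12(y\cdot\nabla w)^2+\tfrac{p+1}{(p-1)^2}w^2-\tfrac1{p+1}|w|^{p+1}\Big)\rho\,dy,$$ $$I(w)=-e^{-\frac{2(p+1)s}{p-1}}\int_BF\big(e^{\frac{2s}{p-1}}w\big)\rho\,dy,\qquad J(w)=-e^{-\gamma s}\int_Bw\,w_s\,\rho\,dy,$$ $$E=E_0+I+J,\qquad H(w(s))=E(w(s))\,\exp\Big(\frac{p+3}{2\gamma}e^{-\gamma s}\Big)+\theta e^{-2\gamma s}.$$ There exist real numbers $S_0$ and $\theta_0$, depending only on $N,p,q,M$, such that the following holds for every $\theta\ge\theta_0$, all locally Lipschitz $f,g:\mathbb R\to\mathbb R$ with $|f(x)|\le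 M(1+|x|^q)$ and $|g(x)|\le M(1+|x|)$ for all $x\in\mathbb R$, every $s_0\in\mathbb R$ and every solution $w$ of (1.8) on $[s_0,\infty)$. For all $s_2>s_1\ge\max(s_0,S_0)$ such that $H(w(s_1))$ and $H(w(s_2))$ are well defined (the integrals in $E_0(w)$ and $I(w)$ converge absolutely at the times $s_1$ and $s_2$), the integral $\int_{s_1}^{s_2}\int_Bw_s^2\frac{\rho}{1-|y|^2}\,dy\,ds$ is finite and $$H(w(s_2))-H(w(s_1))\le-\alpha\int_{s_1}^{s_2}\int_Bw_s^2(y,s)\frac{\rho}{1-|y|^2}\,dy\,ds .$$ -/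

import Mathlib

open MeasureTheory Filter Topology Set
open scoped ContDiff RealInnerProductSpace

noncomputable section

namespace PerturbedWave

/-- The space `ℝ^N` with its Euclidean norm. -/
abbrev Space (N : ℕ) : Type := EuclideanSpace ℝ (Fin N)

/-- The open unit ball of `ℝ^N`. -/
def unitBall (N : ℕ) : Set (Space N) := Metric.ball 0 1

/-- `α = 2/(p-1) - (N-1)/2`. -/
def alpha (N : ℕ) (p : ℝ) : ℝ := 2 / (p - 1) - ((N : ℝ) - 1) / 2

/-- `ρ(y) = (1-|y|²)^α`. -/
def rho (N : ℕ) (p : ℝ) (y : Space N) : ℝ := (1 - ‖y‖ ^ 2) ^ alpha N p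

/-- `γ = min(1/2, (p-q)/(p-1))`. -/
def gam (p q : ℝ) : ℝ := min (1 / 2) ((p - q) / (p - 1))

/-- Test functions on the unit ball: `φ ∈ C_c^∞(B)`. -/
structure IsTest {N : ℕ} (φ : Space N → ℝ) : Prop where
  smooth : ContDiff ℝ ∞ φ
  compact : HasCompactSupport φ
  supp : tsupport φ ⊆ unitBall N

/-- `G` is the weak (distributional) gradient of `w` on the unit ball. -/
structure HasWeakGradient {N : ℕ} (w : Space N → ℝ) (G : Space N → Space N) : Prop where
  locInt : LocallyIntegrableOn w (unitBall N)
  locInt_grad : LocallyIntegrableOn G (unitBall N)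
  byParts : ∀ φ : Space N → ℝ, IsTest φ → ∀ e : Space N,
    ∫ y in unitBall N, w y * ⟪gradient φ y, e⟫ = -∫ y in unitBall N, ⟪G y, e⟫ * φ y

/-- The density `(w₂² + |∇w₁|² (1-|y|²) + w₁²) ρ` of the squared norm of `ℋ`,
for the pair `(w₁, w₂)` with `G = ∇w₁`. -/
def normDensity (N : ℕ) (p : ℝ) (w₁ : Space N → ℝ) (G : Space N → Space N)
    (w₂ : Space N → ℝ) (y : Space N) : ℝ :=
  (w₂ y ^ 2 + ‖G y‖ ^ 2 * (1 - ‖y‖ ^ 2) + w₁ y ^ 2) * rho N p y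

/-- `(w₁, w₂) ∈ ℋ`, and `G` is the weak gradient of `w₁`. -/
structure MemH (N : ℕ) (p : ℝ) (w₁ : Space N → ℝ) (G : Space N → Space N)
    (w₂ : Space N → ℝ) : Prop where
  weakGradient : HasWeakGradient w₁ G
  measurable_snd : AEStronglyMeasurable w₂ (volume.restrict (unitBall N))
  finite : IntegrableOn (normDensity N p w₁ G w₂) (unitBall N)

/-- `(w, w_s) ∈ C([s₀,∞), ℋ)`, where `G s` is the weak gradient of `w s`. -/
structure ContinuousInH (N : ℕ) (p s₀ : ℝ) (w : ℝ → Space N → ℝ)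
    (G : ℝ → Space N → Space N) (ws : ℝ → Space N → ℝ) : Prop where
  mem : ∀ s, s₀ ≤ s → MemH N p (w s) (G s) (ws s)
  cont : ∀ s, s₀ ≤ s →
    Tendsto (fun t => ∫ y in unitBall N,
        normDensity N p (w t - w s) (G t - G s) (ws t - ws s) y)
      (𝓝[Ici s₀] s) (𝓝 0)

/-- The nonlinear source of the equation,
`|w|^{p-1}w + e^{-2ps/(p-1)} f(e^{2s/(p-1)} w)
  + e^{-2ps/(p-1)} g(e^{(p+1)s/(p-1)} (w_s + y·∇w + 2w/(p-1)))`. -/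
def source {N : ℕ} (p : ℝ) (f g : ℝ → ℝ) (w : ℝ → Space N → ℝ)
    (G : ℝ → Space N → Space N) (ws : ℝ → Space N → ℝ) (s : ℝ) (y : Space N) : ℝ :=
  |w s y| ^ (p - 1) * w s y
    + Real.exp (-(2 * p * s / (p - 1))) * f (Real.exp (2 * s / (p - 1)) * w s y)
    + Real.exp (-(2 * p * s / (p - 1))) *
        g (Real.exp ((p + 1) * s / (p - 1)) *
          (ws s y + ⟪y, G s y⟫ + 2 / (p - 1) * w s y))

/-- The right-hand side of the equation, tested at time `s` against `φ ρ`.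
The divergence term and the term `-2 y·∇w_s` are integrated by parts; for the latter,
`div (φ ρ y) = (y·∇φ + (N - 2α|y|²/(1-|y|²)) φ) ρ`. -/
def weakRHS (N : ℕ) (p : ℝ) (f g : ℝ → ℝ) (w : ℝ → Space N → ℝ)
    (G : ℝ → Space N → Space N) (ws : ℝ → Space N → ℝ) (φ : Space N → ℝ) (s : ℝ) : ℝ :=
  ∫ y in unitBall N,
    (-(⟪G s y, gradient φ y⟫ - ⟪y, G s y⟫ * ⟪y, gradient φ y⟫)
      - (2 * p + 2) / (p - 1) ^ 2 * w s y * φ y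
      - (p + 3) / (p - 1) * ws s y * φ y
      + 2 * ws s y * (⟪y, gradient φ y⟫
          + ((N : ℝ) - 2 * alpha N p * ‖y‖ ^ 2 / (1 - ‖y‖ ^ 2)) * φ y)
      + source p f g w G ws s y * φ y) * rho N p y

/-- `w` is a finite-energy solution on `B × [s₀,∞)` of

`w_ss = (1/ρ) div(ρ∇w - ρ(y·∇w)y) - (2p+2)/(p-1)² w - (p+3)/(p-1) w_s - 2y·∇w_s + source`

with time derivative `ws` and spatial gradient `G`: the pair `(w, w_s)` belongs to
`C([s₀,∞), ℋ)`, the source belongs to `L¹_loc([s₀,∞), L²_loc(B))`, as is required for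
the Duhamel formula to make sense in the energy space, and the equation holds in the
sense of distributions (in the form integrated in time). -/
structure IsSolution (N : ℕ) (p : ℝ) (f g : ℝ → ℝ) (s₀ : ℝ) (w : ℝ → Space N → ℝ)
    (G : ℝ → Space N → Space N) (ws : ℝ → Space N → ℝ) : Prop where
  continuousInH : ContinuousInH N p s₀ w G ws
  source_loc : ∀ r : ℝ, r < 1 → ∀ T : ℝ,
    ∫⁻ s in Icc s₀ T, eLpNorm (source p f g w G ws s) 2
      (volume.restrict (Metric.closedBall 0 r)) < ⊤
  timeDeriv : ∀ φ : Space N → ℝ, IsTest φ → ∀ a b : ℝ, s₀ ≤ a → a ≤ b →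
    ∫ y in unitBall N, (w b y - w a y) * φ y
      = ∫ s in a..b, ∫ y in unitBall N, ws s y * φ y
  equation : ∀ φ : Space N → ℝ, IsTest φ → ∀ a b : ℝ, s₀ ≤ a → a ≤ b →
    ∫ y in unitBall N, (ws b y - ws a y) * φ y * rho N p y
      = ∫ s in a..b, weakRHS N p f g w G ws φ s

/-- The integrand of `E₀`, including the weight `ρ`. -/
def energyDensity (N : ℕ) (p : ℝ) (w : ℝ → Space N → ℝ)
    (G : ℝ → Space N → Space N) (ws : ℝ → Space N → ℝ) (s : ℝ) (y : Space N) : ℝ :=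
  (1 / 2 * ws s y ^ 2 + 1 / 2 * ‖G s y‖ ^ 2 - 1 / 2 * ⟪y, G s y⟫ ^ 2
    + (p + 1) / (p - 1) ^ 2 * w s y ^ 2
    - 1 / (p + 1) * |w s y| ^ (p + 1)) * rho N p y

/-- `E₀(w(s))`. -/
def E₀ (N : ℕ) (p : ℝ) (w : ℝ → Space N → ℝ)
    (G : ℝ → Space N → Space N) (ws : ℝ → Space N → ℝ) (s : ℝ) : ℝ :=
  ∫ y in unitBall N, energyDensity N p w G ws s y

/-- `F(u) = ∫₀^u f(v) dv`. -/
def primitive (f : ℝ → ℝ) (u : ℝ) : ℝ := ∫ v in (0 : ℝ)..u, f v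

/-- The integrand `F(e^{2s/(p-1)} w) ρ` of the term `I`. -/
def potentialDensity (N : ℕ) (p : ℝ) (f : ℝ → ℝ) (w : ℝ → Space N → ℝ) (s : ℝ)
    (y : Space N) : ℝ :=
  primitive f (Real.exp (2 / (p - 1) * s) * w s y) * rho N p y

/-- `I(w(s)) = -e^{-2(p+1)s/(p-1)} ∫_B F(e^{2s/(p-1)} w) ρ dy`. -/
def I (N : ℕ) (p : ℝ) (f : ℝ → ℝ) (w : ℝ → Space N → ℝ) (s : ℝ) : ℝ :=
  -Real.exp (-(2 * (p + 1) * s / (p - 1))) *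
    ∫ y in unitBall N, potentialDensity N p f w s y

/-- `J(w(s)) = -e^{-γs} ∫_B w w_s ρ dy`. -/
def J (N : ℕ) (p q : ℝ) (w ws : ℝ → Space N → ℝ) (s : ℝ) : ℝ :=
  -Real.exp (-(gam p q * s)) * ∫ y in unitBall N, w s y * ws s y * rho N p y

/-- `E = E₀ + I + J`. -/
def E (N : ℕ) (p q : ℝ) (f : ℝ → ℝ) (w : ℝ → Space N → ℝ)
    (G : ℝ → Space N → Space N) (ws : ℝ → Space N → ℝ) (s : ℝ) : ℝ :=
  E₀ N p w G ws s + I N p f w s + J N p q w ws s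

/-- `H(w(s)) = E(w(s)) exp((p+3)/(2γ) e^{-γs}) + θ e^{-2γs}`. -/
def H (N : ℕ) (p q θ : ℝ) (f : ℝ → ℝ) (w : ℝ → Space N → ℝ)
    (G : ℝ → Space N → Space N) (ws : ℝ → Space N → ℝ) (s : ℝ) : ℝ :=
  E N p q f w G ws s *
      Real.exp ((p + 3) / (2 * gam p q) * Real.exp (-(gam p q * s)))
    + θ * Real.exp (-(2 * gam p q * s))

/-- `H(w(s))` is well defined: the integrals in `E₀` and `I` converge absolutely (the one
in `J` always does for `(w, w_s)(s) ∈ ℋ`). -/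
def WellDefinedAt (N : ℕ) (p : ℝ) (f : ℝ → ℝ) (w : ℝ → Space N → ℝ)
    (G : ℝ → Space N → Space N) (ws : ℝ → Space N → ℝ) (s : ℝ) : Prop :=
  IntegrableOn (energyDensity N p w G ws s) (unitBall N) ∧
    IntegrableOn (potentialDensity N p f w s) (unitBall N)

/-- `w_s² ρ / (1-|y|²)`. -/
def dissipation (N : ℕ) (p : ℝ) (ws : ℝ → Space N → ℝ) (s : ℝ) (y : Space N) : ℝ :=
  ws s y ^ 2 * (rho N p y / (1 - ‖y‖ ^ 2))

end PerturbedWave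

end

/-! Formally, multiply the equation by `w_s ρ` and integrate. Since `N + 2α = (p+3)/(p-1)`, the
damping term and the term `-2 y·∇w_s` combine through `div(ρ y)` into `-2α w_s² ρ/(1-|y|²)`, so the
quadratic energy has a dissipation `2αD`, where `D = ∫ w_s² ρ/(1-|y|²)`. The potential part of the
source is the time derivative of `-∫ potential`, up to an explicit time derivative of size
`ε²(1+|w|^{p+1})`, where `ε = e^{-γs}`. The value of `γ` is chosen so that every perturbative term
decays at least like `ε²`.

The errors `ε²(|w|^{p+1} + w² + (1-|y|²)|∇w|²)` are absorbed with the help of `J`, that is, of the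
equation tested with `-ε w ρ`. The quantity `E' - ((p+3)/2) ε E` then contains `|w|^{p+1}`, `w²` and
`(1-|y|²)|∇w|²` with negative coefficients of order `ε`, because `(p+3)/2` lies strictly between `2`
and `p+1`. The dangerous cross term is `4α ε w w_s/(1-|y|²)`: Cauchy-Schwarz against the dissipation
leaves `ε² w²/(1-|y|²)`, and this is removed by adding a multiple of the Hardy identity `∫ div(ρ w²
y) = 0`. The pointwise outcome is `interior_density_le`. Half of the dissipation survives, with a
remainder `Cε²`. The exponential factor in `H` is the integrating factor for `-((p+3)/2) ε E`, and
`θ e^{-2γs}` pays for the remainder.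

A solution is only a continuous path in `ℋ`, so nothing may be multiplied directly. Everything is
first localized in space by a radial cutoff `χ` supported in a ball of radius `r < 1`, where the
weights are harmless and the state lies in flat `L²`. In time, the equation is integrated over `[s,
s+h]`. This integrated equation has the weak form `P = -div Q` with `P` and `Q` in `L²`, so it may
be tested with a localized Sobolev function (`integral_mul_eq_integral_inner_of_hasGradOn`, by
mollification). The increment of `w` and the time integral of `w` are such functions, and
`energy_identity_of_increments` lets `h` tend to zero by Steklov averaging.

The nonlinear potential is handled apart from the quadratic forms. The source is in `L¹` in time
with values in local `L²`, and it controls `|w|^p`; hence `|w|^p (|w| + |w_s|)` is integrable in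
space-time. Along a jointly measurable representative that is absolutely continuous in time, the
chain rule holds at almost every point `y` (`isPrimitiveOn_potential`).

Finally the cutoff is removed. Its gradient produces a layer error, in which the outward flux of
`w_s²` has a good sign and absorbs every term with `w_s` (`boundary_density_le`). What is left is
dominated by `(1-|y|²)|∇w|² ρ + 3 w² ρ/(1-|y|²)`, which is integrable by the Hardy inequality, so
the error tends to zero. The localized functionals converge at the two end times by absolute
convergence, and Fatou's lemma gives the dissipation integral. -/

noncomputable section

namespace PerturbedWave

/-! ### The local phase space and its bounded forms. -/

section

/-- The phase space of `(w, w_s, ∇w)` at a point. -/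
abbrev State (N : ℕ) : Type := ℝ × ℝ × Space N

/-- Lebesgue measure on the ball of radius `r`. -/
abbrev mu (N : ℕ) (r : ℝ) : Measure (Space N) := volume.restrict (Metric.ball 0 r)

/-- Square integrable fields `(w, w_s, ∇w)` on the ball of radius `r`. -/
abbrev Phase (N : ℕ) (r : ℝ) : Type := Lp (State N) 2 (mu N r)

/-- Coefficients of a bilinear form in `(w, v, G)`; the letter `R` stands for the
contraction `⟪y, G⟫`. -/
structure Coeff (N : ℕ) where
  (ww wv vv GG RR wR vR : Space N → ℝ)

namespace Coeff

variable {N : ℕ}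

/-- The value of the bilinear form at the point `y`. -/
def eval (c : Coeff N) (y : Space N) (x z : State N) : ℝ :=
  c.ww y * (x.1 * z.1) + c.wv y * (x.1 * z.2.1) + c.vv y * (x.2.1 * z.2.1)
    + c.GG y * ⟪x.2.2, z.2.2⟫ + c.RR y * (⟪y, x.2.2⟫ * ⟪y, z.2.2⟫)
    + c.wR y * (x.1 * ⟪y, z.2.2⟫) + c.vR y * (x.2.1 * ⟪y, z.2.2⟫)

/-- Continuity of all coefficients up to the boundary of the ball of radius `r`. -/
structure Admissible (c : Coeff N) (r : ℝ) : Prop where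
  ww : ContinuousOn c.ww (Metric.closedBall 0 r)
  wv : ContinuousOn c.wv (Metric.closedBall 0 r)
  vv : ContinuousOn c.vv (Metric.closedBall 0 r)
  GG : ContinuousOn c.GG (Metric.closedBall 0 r)
  RR : ContinuousOn c.RR (Metric.closedBall 0 r)
  wR : ContinuousOn c.wR (Metric.closedBall 0 r)
  vR : ContinuousOn c.vR (Metric.closedBall 0 r)

lemma eval_add_left (c : Coeff N) (y : Space N) (x x' z : State N) :
    c.eval y (x + x') z = c.eval y x z + c.eval y x' z := by
  simp only [eval, Prod.fst_add, Prod.snd_add, inner_add_left, inner_add_right]; ring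

lemma eval_add_right (c : Coeff N) (y : Space N) (x z z' : State N) :
    c.eval y x (z + z') = c.eval y x z + c.eval y x z' := by
  simp only [eval, Prod.fst_add, Prod.snd_add, inner_add_right]; ring

lemma eval_smul_left (c : Coeff N) (y : Space N) (a : ℝ) (x z : State N) :
    c.eval y (a • x) z = a * c.eval y x z := by
  simp only [eval, Prod.smul_fst, Prod.smul_snd, inner_smul_left, inner_smul_right, smul_eq_mul,
    conj_trivial]; ring

lemma eval_smul_right (c : Coeff N) (y : Space N) (a : ℝ) (x z : State N) :
    c.eval y x (a • z) = a * c.eval y x z := by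
  simp only [eval, Prod.smul_fst, Prod.smul_snd, inner_smul_right, smul_eq_mul]; ring

/-- Each of the seven terms is at most `A * (‖x‖ * ‖z‖)`; the radial contraction costs nothing
because `‖y‖ ≤ 1`. -/
lemma abs_eval_le {c : Coeff N} {y : Space N} {A : ℝ} (hA : 0 ≤ A) (hy : ‖y‖ ≤ 1)
    (h1 : |c.ww y| ≤ A) (h2 : |c.wv y| ≤ A) (h3 : |c.vv y| ≤ A) (h4 : |c.GG y| ≤ A)
    (h5 : |c.RR y| ≤ A) (h6 : |c.wR y| ≤ A) (h7 : |c.vR y| ≤ A) (x z : State N) :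
    |c.eval y x z| ≤ 7 * A * (‖x‖ * ‖z‖) := by
  have x1 : |x.1| ≤ ‖x‖ := norm_fst_le x
  have z1 : |z.1| ≤ ‖z‖ := norm_fst_le z
  have x2 : |x.2.1| ≤ ‖x‖ := (norm_fst_le x.2).trans (norm_snd_le x)
  have z2 : |z.2.1| ≤ ‖z‖ := (norm_fst_le z.2).trans (norm_snd_le z)
  have x3 : ‖x.2.2‖ ≤ ‖x‖ := (norm_snd_le x.2).trans (norm_snd_le x)
  have z3 : ‖z.2.2‖ ≤ ‖z‖ := (norm_snd_le z.2).trans (norm_snd_le z)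
  have xR : |⟪y, x.2.2⟫| ≤ ‖x‖ := (abs_real_inner_le_norm _ _).trans
    ((mul_le_of_le_one_left (norm_nonneg _) hy).trans x3)
  have zR : |⟪y, z.2.2⟫| ≤ ‖z‖ := (abs_real_inner_le_norm _ _).trans
    ((mul_le_of_le_one_left (norm_nonneg _) hy).trans z3)
  have xz : |⟪x.2.2, z.2.2⟫| ≤ ‖x‖ * ‖z‖ := (abs_real_inner_le_norm _ _).trans (by gcongr)
  have key : ∀ a b b' : ℝ, |a| ≤ A → |b| ≤ ‖x‖ → |b'| ≤ ‖z‖ →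
      |a * (b * b')| ≤ A * (‖x‖ * ‖z‖) := fun a b b' ha hb hb' => by
    rw [abs_mul, abs_mul]; gcongr
  have e4 : |c.GG y * ⟪x.2.2, z.2.2⟫| ≤ A * (‖x‖ * ‖z‖) := by rw [abs_mul]; gcongr
  have e1 := key _ _ _ h1 x1 z1
  have e2 := key _ _ _ h2 x1 z2
  have e3 := key _ _ _ h3 x2 z2
  have e5 := key _ _ _ h5 xR zR
  have e6 := key _ _ _ h6 x1 zR
  have e7 := key _ _ _ h7 x2 zR
  rw [abs_le] at *
  simp only [eval]
  constructor <;> linarith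

lemma Admissible.exists_bound {c : Coeff N} {r : ℝ} (hc : c.Admissible r) (hr : r ≤ 1) :
    ∃ A, 0 ≤ A ∧ ∀ y ∈ Metric.ball (0 : Space N) r, ∀ x z : State N,
      |c.eval y x z| ≤ A * (‖x‖ * ‖z‖) := by
  have hK : IsCompact (Metric.closedBall (0 : Space N) r) := isCompact_closedBall 0 r
  obtain ⟨A1, h1⟩ := hK.exists_bound_of_continuousOn hc.ww
  obtain ⟨A2, h2⟩ := hK.exists_bound_of_continuousOn hc.wv
  obtain ⟨A3, h3⟩ := hK.exists_bound_of_continuousOn hc.vv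
  obtain ⟨A4, h4⟩ := hK.exists_bound_of_continuousOn hc.GG
  obtain ⟨A5, h5⟩ := hK.exists_bound_of_continuousOn hc.RR
  obtain ⟨A6, h6⟩ := hK.exists_bound_of_continuousOn hc.wR
  obtain ⟨A7, h7⟩ := hK.exists_bound_of_continuousOn hc.vR
  set A := |A1| + |A2| + |A3| + |A4| + |A5| + |A6| + |A7| with hA
  have hA0 : 0 ≤ A := by positivity
  refine ⟨7 * A, by positivity, fun y hy x z => ?_⟩
  have hy' := Metric.ball_subset_closedBall hy
  have hy1 : ‖y‖ ≤ 1 := by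
    have := mem_closedBall_zero_iff.1 hy'; linarith
  have a1 := abs_nonneg A1
  have a2 := abs_nonneg A2
  have a3 := abs_nonneg A3
  have a4 := abs_nonneg A4
  have a5 := abs_nonneg A5
  have a6 := abs_nonneg A6
  have a7 := abs_nonneg A7
  apply abs_eval_le hA0 hy1
  · linarith [(h1 y hy').trans (le_abs_self A1), Real.norm_eq_abs (c.ww y)]
  · linarith [(h2 y hy').trans (le_abs_self A2), Real.norm_eq_abs (c.wv y)]
  · linarith [(h3 y hy').trans (le_abs_self A3), Real.norm_eq_abs (c.vv y)]
  · linarith [(h4 y hy').trans (le_abs_self A4), Real.norm_eq_abs (c.GG y)]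
  · linarith [(h5 y hy').trans (le_abs_self A5), Real.norm_eq_abs (c.RR y)]
  · linarith [(h6 y hy').trans (le_abs_self A6), Real.norm_eq_abs (c.wR y)]
  · linarith [(h7 y hy').trans (le_abs_self A7), Real.norm_eq_abs (c.vR y)]

end Coeff

variable {N : ℕ} {r : ℝ}

lemma aestronglyMeasurable_of_continuousOn_closedBall {F : Type*} [NormedAddCommGroup F]
    [SecondCountableTopology F] {c : Space N → F}
    (hc : ContinuousOn c (Metric.closedBall 0 r)) : AEStronglyMeasurable c (mu N r) :=
  (hc.mono Metric.ball_subset_closedBall).aestronglyMeasurable_of_isSeparable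
    Metric.isOpen_ball.measurableSet (TopologicalSpace.IsSeparable.of_separableSpace _)

lemma Coeff.Admissible.aestronglyMeasurable {c : Coeff N} (hc : c.Admissible r)
    {u z : Space N → State N} (hu : AEStronglyMeasurable u (mu N r))
    (hz : AEStronglyMeasurable z (mu N r)) :
    AEStronglyMeasurable (fun y => c.eval y (u y) (z y)) (mu N r) := by
  have hid : AEStronglyMeasurable (fun y : Space N => y) (mu N r) :=
    continuous_id.aestronglyMeasurable
  have c1 := aestronglyMeasurable_of_continuousOn_closedBall hc.ww
  have c2 := aestronglyMeasurable_of_continuousOn_closedBall hc.wv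
  have c3 := aestronglyMeasurable_of_continuousOn_closedBall hc.vv
  have c4 := aestronglyMeasurable_of_continuousOn_closedBall hc.GG
  have c5 := aestronglyMeasurable_of_continuousOn_closedBall hc.RR
  have c6 := aestronglyMeasurable_of_continuousOn_closedBall hc.wR
  have c7 := aestronglyMeasurable_of_continuousOn_closedBall hc.vR
  have u1 := hu.fst
  have u2 := hu.snd.fst
  have u3 := hu.snd.snd
  have z1 := hz.fst
  have z2 := hz.snd.fst
  have z3 := hz.snd.snd
  have uR := hid.inner (𝕜 := ℝ) u3
  have zR := hid.inner (𝕜 := ℝ) z3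
  exact ((((((c1.mul (u1.mul z1)).add (c2.mul (u1.mul z2))).add (c3.mul (u2.mul z2))).add
    (c4.mul (u3.inner (𝕜 := ℝ) z3))).add (c5.mul (uR.mul zR))).add
    (c6.mul (u1.mul zR))).add (c7.mul (u2.mul zR))

lemma Coeff.Admissible.integrable {c : Coeff N} (hc : c.Admissible r) (hr : r ≤ 1)
    {u z : Space N → State N} (hu : MemLp u 2 (mu N r)) (hz : MemLp z 2 (mu N r)) :
    Integrable (fun y => c.eval y (u y) (z y)) (mu N r) := by
  obtain ⟨A, -, hA⟩ := hc.exists_bound hr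
  have h1 : Integrable (fun y => ‖u y‖ * ‖z y‖) (mu N r) := hu.norm.integrable_mul hz.norm
  refine (h1.const_mul A).mono' (hc.aestronglyMeasurable hu.1 hz.1) ?_
  filter_upwards [ae_restrict_mem Metric.isOpen_ball.measurableSet] with y hy
  exact hA y hy _ _

/-- The bounded bilinear form on the phase space with given coefficients. -/
def formCLM (c : Coeff N) (hc : c.Admissible r) (hr : r ≤ 1) :
    Phase N r →L[ℝ] Phase N r →L[ℝ] ℝ :=
  (LinearMap.mk₂ ℝ (fun u z : Phase N r => ∫ y, c.eval y (u y) (z y) ∂(mu N r))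
    (fun u u' z => by
      rw [← integral_add (hc.integrable hr (Lp.memLp u) (Lp.memLp z))
        (hc.integrable hr (Lp.memLp u') (Lp.memLp z))]
      refine integral_congr_ae ?_
      filter_upwards [Lp.coeFn_add u u'] with y hy
      rw [hy, Pi.add_apply, c.eval_add_left])
    (fun a u z => by
      rw [smul_eq_mul, ← integral_const_mul]
      refine integral_congr_ae ?_
      filter_upwards [Lp.coeFn_smul a u] with y hy
      rw [hy, Pi.smul_apply, c.eval_smul_left])
    (fun u z z' => by
      rw [← integral_add (hc.integrable hr (Lp.memLp u) (Lp.memLp z))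
        (hc.integrable hr (Lp.memLp u) (Lp.memLp z'))]
      refine integral_congr_ae ?_
      filter_upwards [Lp.coeFn_add z z'] with y hy
      rw [hy, Pi.add_apply, c.eval_add_right])
    (fun a u z => by
      rw [smul_eq_mul, ← integral_const_mul]
      refine integral_congr_ae ?_
      filter_upwards [Lp.coeFn_smul a z] with y hy
      rw [hy, Pi.smul_apply, c.eval_smul_right])).mkContinuousOfExistsBound₂ (by
    obtain ⟨A, hA0, hA⟩ := hc.exists_bound hr
    refine ⟨A, fun u z => ?_⟩
    have hu := (Lp.memLp u).norm
    have hz := (Lp.memLp z).norm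
    have h1 : Integrable (fun y => ‖u y‖ * ‖z y‖) (mu N r) := hu.integrable_mul hz
    have e1 : ‖hu.toLp _‖ = ‖u‖ := by
      rw [Lp.norm_toLp, eLpNorm_norm, Lp.norm_def]
    have e2 : ‖hz.toLp _‖ = ‖z‖ := by
      rw [Lp.norm_toLp, eLpNorm_norm, Lp.norm_def]
    -- Cauchy-Schwarz, read off from the inner product of the scalar functions `‖u‖` and `‖z‖` in
    -- real `L²`.
    have h2 : ∫ y, ‖u y‖ * ‖z y‖ ∂(mu N r) ≤ ‖u‖ * ‖z‖ := by
      rw [← e1, ← e2]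
      refine le_trans (le_of_eq ?_) (real_inner_le_norm _ _)
      rw [L2.inner_def]
      refine integral_congr_ae ?_
      filter_upwards [hu.coeFn_toLp, hz.coeFn_toLp] with y h3 h4
      rw [h3, h4]; simp [mul_comm]
    calc ‖∫ y, c.eval y (u y) (z y) ∂(mu N r)‖
        ≤ ∫ y, A * (‖u y‖ * ‖z y‖) ∂(mu N r) := by
          refine norm_integral_le_of_norm_le (h1.const_mul A) ?_
          filter_upwards [ae_restrict_mem Metric.isOpen_ball.measurableSet] with y hy
          exact hA y hy _ _
      _ ≤ A * ‖u‖ * ‖z‖ := by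
          rw [integral_const_mul, mul_assoc]; gcongr)

lemma formCLM_apply (c : Coeff N) (hc : c.Admissible r) (hr : r ≤ 1) (u z : Phase N r) :
    formCLM c hc hr u z = ∫ y, c.eval y (u y) (z y) ∂(mu N r) := rfl

/-- The linear functional `(w, v, G) ↦ ∫ a w + b v + ⟪g, G⟫` on the phase space. -/
def linCLM (a b : Lp ℝ 2 (mu N r)) (g : Lp (Space N) 2 (mu N r)) : Phase N r →L[ℝ] ℝ :=
  (innerSL ℝ a).comp ((ContinuousLinearMap.fst ℝ ℝ (ℝ × Space N)).compLpL 2 (mu N r))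
  + (innerSL ℝ b).comp (((ContinuousLinearMap.fst ℝ ℝ (Space N)).comp
      (ContinuousLinearMap.snd ℝ ℝ (ℝ × Space N))).compLpL 2 (mu N r))
  + (innerSL ℝ g).comp (((ContinuousLinearMap.snd ℝ ℝ (Space N)).comp
      (ContinuousLinearMap.snd ℝ ℝ (ℝ × Space N))).compLpL 2 (mu N r))

lemma integrable_lin {a b : Space N → ℝ} {g : Space N → Space N} (ha : MemLp a 2 (mu N r))
    (hb : MemLp b 2 (mu N r)) (hg : MemLp g 2 (mu N r)) (u : Phase N r) :
    Integrable (fun y => a y * (u y).1 + b y * (u y).2.1 + ⟪g y, (u y).2.2⟫) (mu N r) := by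
  have hu := Lp.memLp u
  refine ((ha.integrable_mul hu.fst).add (hb.integrable_mul hu.snd.fst)).add ?_
  exact (hg.norm.integrable_mul hu.snd.snd.norm).mono' (hg.1.inner (𝕜 := ℝ) hu.snd.snd.1)
    (ae_of_all _ fun y => norm_inner_le_norm _ _)

lemma linCLM_apply {a b : Space N → ℝ} {g : Space N → Space N} (ha : MemLp a 2 (mu N r))
    (hb : MemLp b 2 (mu N r)) (hg : MemLp g 2 (mu N r)) (u : Phase N r) :
    linCLM (ha.toLp a) (hb.toLp b) (hg.toLp g) u
      = ∫ y, (a y * (u y).1 + b y * (u y).2.1 + ⟪g y, (u y).2.2⟫) ∂(mu N r) := by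
  have hu := Lp.memLp u
  have h1 : Integrable (fun y => a y * (u y).1) (mu N r) := ha.integrable_mul hu.fst
  have h2 : Integrable (fun y => b y * (u y).2.1) (mu N r) := hb.integrable_mul hu.snd.fst
  have h3 : Integrable (fun y => ⟪g y, (u y).2.2⟫) (mu N r) := by
    have h4 := hg.norm.integrable_mul hu.snd.snd.norm
    exact h4.mono' (hg.1.inner (𝕜 := ℝ) hu.snd.snd.1) (ae_of_all _ fun y =>
      norm_inner_le_norm _ _)
  have h12 : Integrable (fun y => a y * (u y).1 + b y * (u y).2.1) (mu N r) := h1.add h2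
  rw [integral_add h12 h3, integral_add h1 h2]
  simp only [linCLM, _root_.add_apply, ContinuousLinearMap.comp_apply,
    innerSL_apply_apply, L2.inner_def]
  congr 1
  · congr 1
    · refine integral_congr_ae ?_
      filter_upwards [ha.coeFn_toLp, ContinuousLinearMap.coeFn_compLpL
        (ContinuousLinearMap.fst ℝ ℝ (ℝ × Space N)) u] with y h4 h5
      rw [h4, h5]; simp [mul_comm]
    · refine integral_congr_ae ?_
      filter_upwards [hb.coeFn_toLp, ContinuousLinearMap.coeFn_compLpL
        ((ContinuousLinearMap.fst ℝ ℝ (Space N)).comp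
          (ContinuousLinearMap.snd ℝ ℝ (ℝ × Space N))) u] with y h4 h5
      rw [h4, h5]; simp [mul_comm]
  · refine integral_congr_ae ?_
    filter_upwards [hg.coeFn_toLp, ContinuousLinearMap.coeFn_compLpL
      ((ContinuousLinearMap.snd ℝ ℝ (Space N)).comp
        (ContinuousLinearMap.snd ℝ ℝ (ℝ × Space N))) u] with y h4 h5
    rw [h4, h5]; simp

end

/-! ### Testing weak divergence identities with Sobolev functions. -/

section

section Convolution

variable {N : ℕ} {F : Type*} [NormedAddCommGroup F] [InnerProductSpace ℝ F]

/-- The correlation of two square integrable functions is continuous. -/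
lemma continuous_integral_inner_translate {f g : Space N → F} (hf : MemLp f 2 volume)
    (hg : MemLp g 2 volume) : Continuous fun t : Space N => ∫ x, ⟪f x, g (x - t)⟫ := by
  have : Fact ((2 : ENNReal) ≠ ⊤) := ⟨by norm_num⟩
  -- Translations act continuously on `L²`; the action is the one of `DomAddAct`.
  have h1 : Continuous fun t : Space N => (DomAddAct.mk (-t)) +ᵥ (hg.toLp g) := by
    have : Continuous fun t : Space N => DomAddAct.mk (-t) :=
      DomAddAct.continuous_mk.comp continuous_neg
    exact this.vadd continuous_const
  have h2 : Continuous fun t : Space N =>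
      ⟪hf.toLp f, (DomAddAct.mk (-t)) +ᵥ (hg.toLp g)⟫ := continuous_const.inner h1
  convert h2 using 2 with t
  rw [DomAddAct.mk_vadd_toLp, L2.inner_def]
  refine integral_congr_ae ?_
  filter_upwards [hf.coeFn_toLp, MemLp.coeFn_toLp (hg.comp_measurePreserving
    (measurePreserving_vadd (-t) volume))] with x h3 h4
  rw [h3]
  refine congrArg _ (Eq.trans ?_ h4.symm)
  simp [vadd_eq_add, sub_eq_neg_add]

/-- The product is dominated by `|η(t)| (|f(x)|² + |g(x-t)|²)`. The first summand is a product
function and the second a convolution integrand, so both are integrable on the product space. -/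
lemma integrable_inner_smul_translate {f g : Space N → F} (hf : MemLp f 2 volume)
    (hg : MemLp g 2 volume) {η : Space N → ℝ} (hη : Continuous η) (hηc : HasCompactSupport η) :
    Integrable (fun p : Space N × Space N => ⟪f p.1, η p.2 • g (p.1 - p.2)⟫)
      (volume.prod volume) := by
  have hηi : Integrable η volume := hη.integrable_of_hasCompactSupport hηc
  have hf2 : Integrable (fun x => ‖f x‖ ^ 2) volume := hf.norm.integrable_sq
  have hg2 : Integrable (fun x => ‖g x‖ ^ 2) volume := hg.norm.integrable_sq
  have b1 : Integrable (fun p : Space N × Space N => ‖f p.1‖ ^ 2 * ‖η p.2‖)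
    (volume.prod volume) := hf2.mul_prod hηi.norm
  have b2 : Integrable (fun p : Space N × Space N => ‖η p.2‖ * ‖g (p.1 - p.2)‖ ^ 2)
    (volume.prod volume) :=
    Integrable.convolution_integrand (ContinuousLinearMap.mul ℝ ℝ) hηi.norm hg2
  have m1 : AEStronglyMeasurable (fun p : Space N × Space N => η p.2 • g (p.1 - p.2))
    (volume.prod volume) :=
    AEStronglyMeasurable.convolution_integrand (ContinuousLinearMap.lsmul ℝ ℝ) hηi.1 hg.1
  have m2 : AEStronglyMeasurable (fun p : Space N × Space N => f p.1) (volume.prod volume) :=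
    hf.1.comp_fst
  refine (b1.add b2).mono' (m2.inner (𝕜 := ℝ) m1) (ae_of_all _ fun p => ?_)
  refine (norm_inner_le_norm _ _).trans ?_
  rw [norm_smul]
  simp only [Pi.add_apply]
  have := norm_nonneg (η p.2)
  nlinarith [mul_nonneg this (sq_nonneg (‖f p.1‖ - ‖g (p.1 - p.2)‖)),
    mul_nonneg this (add_nonneg (sq_nonneg ‖f p.1‖) (sq_nonneg ‖g (p.1 - p.2)‖))]

lemma integrable_smul_translate {g : Space N → F} (hg : MemLp g 2 volume) {η : Space N → ℝ}
    (hη : Continuous η) (hηc : HasCompactSupport η) (x : Space N) :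
    Integrable (fun t => η t • g (x - t)) volume :=
  hηc.convolutionExists_left (ContinuousLinearMap.lsmul ℝ ℝ) hη
    (hg.locallyIntegrable (by norm_num)) x

/-- Fubini: pairing with a mollified function is the same as averaging the correlation against the
mollifier. -/
lemma integral_inner_convolution [CompleteSpace F] {f g : Space N → F} (hf : MemLp f 2 volume)
    (hg : MemLp g 2 volume) {η : Space N → ℝ} (hη : Continuous η) (hηc : HasCompactSupport η) :
    ∫ x, ⟪f x, ∫ t, η t • g (x - t)⟫ = ∫ t, η t * ∫ x, ⟪f x, g (x - t)⟫ := by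
  have h1 : ∀ x, ⟪f x, ∫ t, η t • g (x - t)⟫ = ∫ t, ⟪f x, η t • g (x - t)⟫ := fun x =>
    (integral_inner (integrable_smul_translate hg hη hηc x) (f x)).symm
  simp_rw [h1]
  rw [integral_integral_swap (integrable_inner_smul_translate hf hg hη hηc)]
  refine integral_congr_ae (ae_of_all _ fun t => ?_)
  simp only [real_inner_smul_right]
  rw [integral_const_mul]

end Convolution

variable {N : ℕ} {r : ℝ}

instance : IsFiniteMeasure (mu N r) :=
  ⟨by rw [Measure.restrict_apply_univ]; exact measure_ball_lt_top⟩

/-- Test functions on the ball of radius `r`. -/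
structure IsTestOn (N : ℕ) (r : ℝ) (φ : Space N → ℝ) : Prop where
  smooth : ContDiff ℝ ∞ φ
  compact : HasCompactSupport φ
  supp : tsupport φ ⊆ Metric.ball 0 r

/-- `U` is the weak gradient of `u` on the ball of radius `r`. -/
def HasGradOn (r : ℝ) (u : Space N → ℝ) (U : Space N → Space N) : Prop :=
  ∀ φ : Space N → ℝ, IsTestOn N r φ → ∀ e : Space N,
    ∫ y, u y * ⟪gradient φ y, e⟫ ∂(mu N r) = -∫ y, ⟪U y, e⟫ * φ y ∂(mu N r)

lemma gradient_mul {f g : Space N → ℝ} {x : Space N} (hf : DifferentiableAt ℝ f x)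
    (hg : DifferentiableAt ℝ g x) :
    gradient (fun y => f y * g y) x = f x • gradient g x + g x • gradient f x := by
  refine ext_inner_right ℝ fun e => ?_
  rw [inner_gradient_left, fderiv_fun_mul hf hg, inner_add_left, real_inner_smul_left,
    real_inner_smul_left, inner_gradient_left, inner_gradient_left]
  simp

lemma continuous_gradient {f : Space N → ℝ} (hf : ContDiff ℝ ∞ f) : Continuous (gradient f) := by
  have h := hf.continuous_fderiv (by simp)
  exact (InnerProductSpace.toDual ℝ (Space N)).symm.continuous.comp h

lemma IsTestOn.mul_smooth {ψ ζ : Space N → ℝ} (hψ : IsTestOn N r ψ) (hζ : ContDiff ℝ ∞ ζ) :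
    IsTestOn N r fun y => ψ y * ζ y where
  smooth := hψ.smooth.mul hζ
  compact := hψ.compact.mul_right
  supp := (tsupport_mul_subset_left (f := ψ) (g := ζ)).trans hψ.supp

/-- Leibniz rule for `ψ u`. Compact support is supplied by `ψ`, so `ζ` need only be smooth; this
allows `ζ` to be a translated and reflected convolution kernel. -/
lemma HasGradOn.mul_test {u : Space N → ℝ} {U : Space N → Space N} (h : HasGradOn r u U)
    (hu : MemLp u 2 (mu N r)) (hU : MemLp U 2 (mu N r)) {ψ ζ : Space N → ℝ}
    (hψ : IsTestOn N r ψ) (hζ : ContDiff ℝ ∞ ζ) (e : Space N) :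
    ∫ y, ψ y * u y * ⟪gradient ζ y, e⟫ ∂(mu N r)
      = -∫ y, ⟪ψ y • U y + u y • gradient ψ y, e⟫ * ζ y ∂(mu N r) := by
  have h0 := h _ (hψ.mul_smooth hζ) e
  have hbdd : ∀ {b : Space N → ℝ}, Continuous b → ∀ {v : Space N → ℝ}, MemLp v 2 (mu N r) →
      Integrable (fun y => v y * b y) (mu N r) := by
    intro b hb v hv
    obtain ⟨C, hC⟩ := (isCompact_closedBall (0 : Space N) r).exists_bound_of_continuousOn
      hb.continuousOn
    refine (hv.integrable (by norm_num)).mul_bdd (c := C) hb.aestronglyMeasurable ?_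
    filter_upwards [ae_restrict_mem Metric.isOpen_ball.measurableSet] with y hy
    exact hC y (Metric.ball_subset_closedBall hy)
  have cψ := continuous_gradient hψ.smooth
  have cζ := continuous_gradient hζ
  have i1 : Integrable (fun y => u y * (ψ y * ⟪gradient ζ y, e⟫)) (mu N r) :=
    hbdd (hψ.smooth.continuous.mul (cζ.inner continuous_const)) hu
  have i2 : Integrable (fun y => u y * (ζ y * ⟪gradient ψ y, e⟫)) (mu N r) :=
    hbdd (hζ.continuous.mul (cψ.inner continuous_const)) hu
  have i3 : Integrable (fun y => ⟪U y, e⟫ * (ψ y * ζ y)) (mu N r) :=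
    hbdd (hψ.smooth.continuous.mul hζ.continuous) (hU.inner_const e)
  have e1 : ∀ y, u y * ⟪gradient (fun y => ψ y * ζ y) y, e⟫
      = u y * (ψ y * ⟪gradient ζ y, e⟫) + u y * (ζ y * ⟪gradient ψ y, e⟫) := fun y => by
    rw [gradient_mul (hψ.smooth.differentiable (by simp) y) (hζ.differentiable (by simp) y),
      inner_add_left, real_inner_smul_left, real_inner_smul_left]; ring
  simp_rw [e1] at h0
  rw [integral_add i1 i2] at h0
  have e2 : ∀ y, ⟪ψ y • U y + u y • gradient ψ y, e⟫ * ζ y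
      = ⟪U y, e⟫ * (ψ y * ζ y) + u y * (ζ y * ⟪gradient ψ y, e⟫) := fun y => by
    rw [inner_add_left, real_inner_smul_left, real_inner_smul_left]; ring
  simp_rw [e2]
  rw [integral_add i3 i2]
  have e3 : ∀ y, ψ y * u y * ⟪gradient ζ y, e⟫ = u y * (ψ y * ⟪gradient ζ y, e⟫) :=
    fun y => by ring
  simp_rw [e3]
  linarith

lemma memLp_mul_continuous {F : Type*} [NormedAddCommGroup F] [NormedSpace ℝ F]
    {b : Space N → ℝ} (hb : ContinuousOn b (Metric.closedBall 0 r)) {v : Space N → F}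
    (hv : MemLp v 2 (mu N r)) : MemLp (fun y => b y • v y) 2 (mu N r) := by
  obtain ⟨C, hC⟩ := (isCompact_closedBall (0 : Space N) r).exists_bound_of_continuousOn hb
  refine hv.of_le_mul (c := C) ((aestronglyMeasurable_of_continuousOn_closedBall hb).smul hv.1) ?_
  filter_upwards [ae_restrict_mem Metric.isOpen_ball.measurableSet] with y hy
  rw [norm_smul]
  gcongr
  exact hC y (Metric.ball_subset_closedBall hy)

lemma memLp_smul_continuous {F : Type*} [NormedAddCommGroup F] [NormedSpace ℝ F]
    [SecondCountableTopology F]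
    {b : Space N → F} (hb : ContinuousOn b (Metric.closedBall 0 r)) {v : Space N → ℝ}
    (hv : MemLp v 2 (mu N r)) : MemLp (fun y => v y • b y) 2 (mu N r) := by
  obtain ⟨C, hC⟩ := (isCompact_closedBall (0 : Space N) r).exists_bound_of_continuousOn hb
  refine hv.of_le_mul (c := C) (hv.1.smul (aestronglyMeasurable_of_continuousOn_closedBall hb)) ?_
  filter_upwards [ae_restrict_mem Metric.isOpen_ball.measurableSet] with y hy
  rw [norm_smul, mul_comm]
  gcongr
  exact hC y (Metric.ball_subset_closedBall hy)

/-- If `P = -div Q` weakly on a ball, this may be tested with a localized Sobolev function. -/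
theorem integral_mul_eq_integral_inner_of_hasGradOn {P u : Space N → ℝ}
    {Q U : Space N → Space N} (hP : MemLp P 2 (mu N r)) (hQ : MemLp Q 2 (mu N r))
    (hu : MemLp u 2 (mu N r)) (hU : MemLp U 2 (mu N r))
    (hPQ : ∀ φ : Space N → ℝ, IsTestOn N r φ →
      ∫ y, P y * φ y ∂(mu N r) = ∫ y, ⟪Q y, gradient φ y⟫ ∂(mu N r))
    (hgrad : HasGradOn r u U) {ψ : Space N → ℝ} (hψ : IsTestOn N r ψ) :
    ∫ y, P y * (ψ y * u y) ∂(mu N r)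
      = ∫ y, ⟪Q y, ψ y • U y + u y • gradient ψ y⟫ ∂(mu N r) := by
  set B : Set (Space N) := Metric.ball 0 r with hB
  have hBm : MeasurableSet B := Metric.isOpen_ball.measurableSet
  set v : Space N → ℝ := B.indicator fun y => ψ y * u y with hv
  set V : Space N → Space N := B.indicator fun y => ψ y • U y + u y • gradient ψ y with hV
  have cψ := continuous_gradient hψ.smooth
  have mv0 : MemLp (fun y => ψ y * u y) 2 (mu N r) :=
    memLp_mul_continuous hψ.smooth.continuous.continuousOn hu
  have mV0 : MemLp (fun y => ψ y • U y + u y • gradient ψ y) 2 (mu N r) :=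
    (memLp_mul_continuous hψ.smooth.continuous.continuousOn hU).add
      (memLp_smul_continuous cψ.continuousOn hu)
  have mP : MemLp (B.indicator P) 2 volume := (memLp_indicator_iff_restrict hBm).2 hP
  have mQ : MemLp (B.indicator Q) 2 volume := (memLp_indicator_iff_restrict hBm).2 hQ
  have mv : MemLp v 2 volume := (memLp_indicator_iff_restrict hBm).2 mv0
  have mV : MemLp V 2 volume := (memLp_indicator_iff_restrict hBm).2 mV0
  -- The defect of the desired identity after shifting `v = ψ u` and its gradient `V` by `t`. The
  -- claim is that this continuous function vanishes at `t = 0`.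
  set c : Space N → ℝ := fun t =>
    (∫ x, ⟪B.indicator P x, v (x - t)⟫) - ∫ x, ⟪B.indicator Q x, V (x - t)⟫ with hc
  have hcc : Continuous c := (continuous_integral_inner_translate mP mv).sub
    (continuous_integral_inner_translate mQ mV)
  -- the support of `ψ` is at positive distance from the sphere
  obtain ⟨δ, hδ, hδK⟩ : ∃ δ > 0, Metric.cthickening δ (tsupport ψ) ⊆ B :=
    hψ.compact.isCompact.exists_cthickening_subset_open Metric.isOpen_ball hψ.supp
  -- For `η` supported within distance `δ` of the origin, `η * v` is still a test function on the
  -- ball; the hypothesis on `P` and `Q` then says that `η` integrates the defect to zero.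
  have key : ∀ η : Space N → ℝ, ContDiff ℝ ∞ η → HasCompactSupport η →
      tsupport η ⊆ Metric.ball 0 δ → ∫ t, η t • c t = 0 := by
    intro η hη hηc hηs
    have hηi : Integrable η volume := hη.continuous.integrable_of_hasCompactSupport hηc
    set φ : Space N → ℝ := fun x => ∫ t, η t • v (x - t) with hφ
    have hvloc : LocallyIntegrable v volume := mv.locallyIntegrable (by norm_num)
    have hφc : φ = (MeasureTheory.convolution η v (ContinuousLinearMap.lsmul ℝ ℝ) volume) := by
      ext x; rfl
    have supp_v : Function.support v ⊆ tsupport ψ := by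
      intro y hy
      refine subset_tsupport _ ?_
      rw [Function.mem_support] at hy ⊢
      intro h0
      exact hy (by simp [hv, Set.indicator, h0])
    have hsub : tsupport φ ⊆ Metric.cthickening δ (tsupport ψ) := by
      refine closure_minimal ?_ Metric.isClosed_cthickening
      rw [hφc]
      refine (support_convolution_subset (ContinuousLinearMap.lsmul ℝ ℝ)).trans ?_
      rintro _ ⟨t, ht, z, hz, rfl⟩
      refine Metric.mem_cthickening_of_dist_le _ z _ _ (supp_v hz) ?_
      have := hηs (subset_tsupport _ ht)
      rw [mem_ball_zero_iff] at this
      simpa [dist_eq_norm] using this.le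
    have hφt : IsTestOn N r φ := by
      refine ⟨?_, ?_, hsub.trans hδK⟩
      · rw [hφc]
        exact hηc.contDiff_convolution_left (ContinuousLinearMap.lsmul ℝ ℝ) hη hvloc
      · exact (hψ.compact.isCompact.cthickening).of_isClosed_subset (isClosed_tsupport _) hsub
    -- The derivative first falls on the kernel and is then moved onto `v` by the weak gradient,
    -- through `HasGradOn.mul_test`.
    have hgradφ : ∀ x, gradient φ x = ∫ t, η t • V (x - t) := by
      intro x
      refine ext_inner_right ℝ fun e => ?_
      have hd := hηc.hasFDerivAt_convolution_left (ContinuousLinearMap.lsmul ℝ ℝ)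
        (hη.of_le (by simp)) hvloc x
      rw [← hφc] at hd
      rw [inner_gradient_left, hd.fderiv, convolution_def,
        ContinuousLinearMap.integral_apply]
      swap
      · exact (hηc.fderiv ℝ).convolutionExists_left _ (hη.continuous_fderiv (by simp)) hvloc x
      have hζ : ContDiff ℝ ∞ fun z => η (x - z) := hη.comp (contDiff_const.sub contDiff_id)
      have hg : ∀ z, ⟪gradient (fun z => η (x - z)) z, e⟫ = -(fderiv ℝ η (x - z) e) := by
        intro z
        rw [inner_gradient_left]
        have : HasFDerivAt (fun z => η (x - z))
            ((fderiv ℝ η (x - z)).comp (-ContinuousLinearMap.id ℝ (Space N))) z :=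
          ((hη.differentiable (by simp)) (x - z)).hasFDerivAt.comp z
            ((hasFDerivAt_id z).const_sub x)
        rw [this.fderiv]; simp
      have h1 := hgrad.mul_test hu hU hψ hζ e
      simp_rw [hg] at h1
      have e1 : ∫ t, ((ContinuousLinearMap.lsmul ℝ ℝ).precompL (Space N)
          (fderiv ℝ η t) (v (x - t))) e
          = ∫ z, v z * fderiv ℝ η (x - z) e := by
        rw [← integral_sub_left_eq_self _ volume x]
        refine integral_congr_ae (ae_of_all _ fun z => ?_)
        simp [ContinuousLinearMap.precompL_apply, mul_comm]
      have e2 : ∫ z, v z * fderiv ℝ η (x - z) e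
          = ∫ z, ψ z * u z * fderiv ℝ η (x - z) e ∂(mu N r) := by
        rw [← integral_indicator hBm]
        refine integral_congr_ae (ae_of_all _ fun z => ?_)
        by_cases hz : z ∈ B <;> simp [hv, hz]
      have e3 : ⟪∫ t, η t • V (x - t), e⟫ = ∫ z, ⟪V z, e⟫ * η (x - z) := by
        rw [real_inner_comm, ← integral_inner (integrable_smul_translate mV hη.continuous hηc x),
          ← integral_sub_left_eq_self _ volume x]
        refine integral_congr_ae (ae_of_all _ fun z => ?_)
        simp [real_inner_smul_right, real_inner_comm, mul_comm]
      have e4 : ∫ z, ⟪V z, e⟫ * η (x - z)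
          = ∫ z, ⟪ψ z • U z + u z • gradient ψ z, e⟫ * η (x - z) ∂(mu N r) := by
        rw [← integral_indicator hBm]
        refine integral_congr_ae (ae_of_all _ fun z => ?_)
        by_cases hz : z ∈ B <;> simp [hV, hz]
      rw [e1, e2, e3, e4]
      simp only [mul_neg, integral_neg] at h1
      linarith
    have h2 := hPQ φ hφt
    have h3 : ∫ y, P y * φ y ∂(mu N r) = ∫ x, ⟪B.indicator P x, φ x⟫ := by
      rw [← integral_indicator hBm]
      refine integral_congr_ae (ae_of_all _ fun z => ?_)
      by_cases hz : z ∈ B <;> simp [hz, mul_comm]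
    have h4 : ∫ y, ⟪Q y, gradient φ y⟫ ∂(mu N r)
        = ∫ x, ⟪B.indicator Q x, ∫ t, η t • V (x - t)⟫ := by
      rw [← integral_indicator hBm]
      refine integral_congr_ae (ae_of_all _ fun z => ?_)
      by_cases hz : z ∈ B <;> simp [hz, hgradφ]
    rw [h3, h4, integral_inner_convolution mP mv hη.continuous hηc,
      integral_inner_convolution mQ mV hη.continuous hηc] at h2
    have i1 : Integrable (fun t => η t * ∫ x, ⟪B.indicator P x, v (x - t)⟫) volume :=
      (hη.continuous.mul (continuous_integral_inner_translate mP mv)).integrable_of_hasCompactSupport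
        hηc.mul_right
    have i2 : Integrable (fun t => η t * ∫ x, ⟪B.indicator Q x, V (x - t)⟫) volume :=
      (hη.continuous.mul (continuous_integral_inner_translate mQ mV)).integrable_of_hasCompactSupport
        hηc.mul_right
    simp only [hc, smul_eq_mul, mul_sub]
    rw [integral_sub i1 i2, h2, sub_self]
  -- The fundamental lemma gives a zero defect almost everywhere near the origin; continuity then
  -- gives it at the origin itself.
  have hae := Metric.isOpen_ball.ae_eq_zero_of_integral_contDiff_smul_eq_zero
    (U := Metric.ball (0 : Space N) δ) (hcc.locallyIntegrable.locallyIntegrableOn _) key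
  have h0 : c 0 = 0 := by
    have h1 : c =ᵐ[volume.restrict (Metric.ball (0 : Space N) δ)] fun _ => (0 : ℝ) :=
      (ae_restrict_iff' Metric.isOpen_ball.measurableSet).2 hae
    exact Measure.eqOn_open_of_ae_eq h1 Metric.isOpen_ball hcc.continuousOn continuousOn_const
      (Metric.mem_ball_self hδ)
  have h3 : ∫ y, P y * (ψ y * u y) ∂(mu N r) = ∫ x, ⟪B.indicator P x, v x⟫ := by
    rw [← integral_indicator hBm]
    refine integral_congr_ae (ae_of_all _ fun z => ?_)
    by_cases hz : z ∈ B <;> simp [hz, hv, mul_comm]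
  have h4 : ∫ y, ⟪Q y, ψ y • U y + u y • gradient ψ y⟫ ∂(mu N r)
      = ∫ x, ⟪B.indicator Q x, V x⟫ := by
    rw [← integral_indicator hBm]
    refine integral_congr_ae (ae_of_all _ fun z => ?_)
    by_cases hz : z ∈ B <;> simp [hz, hV]
  simp only [hc, sub_zero] at h0
  rw [h3, h4]; linarith

end

/-! ### The weight, radial cutoffs and the radial integration by parts. -/

section

variable {N : ℕ} {p r : ℝ}

lemma alpha_pos (hp : 1 < p) (hpc : ((N : ℝ) - 1) * (p - 1) < 4) : 0 < alpha N p := by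
  have h : 0 < p - 1 := by linarith
  rw [alpha, sub_pos, div_lt_div_iff₀ (by norm_num) h]
  linarith

/-- The reason for the choice of `α`: `div(ρ y) = (N + 2α - 2α/(1-|y|²)) ρ`, so the constant part of
the divergence cancels the damping coefficient `(p+3)/(p-1)` in the energy identity. -/
lemma nat_add_two_mul_alpha (hp : 1 < p) : (N : ℝ) + 2 * alpha N p = (p + 3) / (p - 1) := by
  have h : p - 1 ≠ 0 := by linarith
  rw [alpha]; field_simp; ring

lemma one_sub_normSq_pos {y : Space N} (hy : y ∈ unitBall N) : 0 < 1 - ‖y‖ ^ 2 := by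
  have h : ‖y‖ < 1 := mem_ball_zero_iff.1 hy
  nlinarith [norm_nonneg y]

lemma rho_pos {y : Space N} (hy : y ∈ unitBall N) : 0 < rho N p y :=
  Real.rpow_pos_of_pos (one_sub_normSq_pos hy) _

lemma rho_le_one (hα : 0 ≤ alpha N p) {y : Space N} (hy : y ∈ unitBall N) : rho N p y ≤ 1 :=
  Real.rpow_le_one (one_sub_normSq_pos hy).le (by nlinarith [sq_nonneg ‖y‖]) hα

lemma ball_subset_unitBall (hr : r ≤ 1) : Metric.ball (0 : Space N) r ⊆ unitBall N :=
  Metric.ball_subset_ball hr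

lemma closedBall_subset_unitBall (hr : r < 1) : Metric.closedBall (0 : Space N) r ⊆ unitBall N :=
  Metric.closedBall_subset_ball hr

lemma contDiff_one_sub_normSq : ContDiff ℝ ∞ fun y : Space N => 1 - ‖y‖ ^ 2 :=
  contDiff_const.sub (contDiff_norm_sq ℝ)

lemma contDiffAt_rho {y : Space N} (hy : y ∈ unitBall N) : ContDiffAt ℝ ∞ (rho N p) y :=
  contDiff_one_sub_normSq.contDiffAt.rpow_const_of_ne (one_sub_normSq_pos hy).ne'

lemma hasGradientAt_normSq (y : Space N) :
    HasGradientAt (fun y : Space N => 1 - ‖y‖ ^ 2) ((-2 : ℝ) • y) y := by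
  rw [hasGradientAt_iff_hasFDerivAt]
  refine ((hasStrictFDerivAt_norm_sq y).hasFDerivAt.const_sub 1).congr_fderiv ?_
  ext e
  simp [InnerProductSpace.toDual_apply_apply]

lemma hasGradientAt_comp_one_sub_normSq {h : ℝ → ℝ} {h' : ℝ} (y : Space N)
    (hh : HasDerivAt h h' (1 - ‖y‖ ^ 2)) :
    HasGradientAt (fun y : Space N => h (1 - ‖y‖ ^ 2)) ((-2 * h') • y) y := by
  rw [hasGradientAt_iff_hasFDerivAt]
  refine (hh.comp_hasFDerivAt y (hasGradientAt_normSq y).hasFDerivAt).congr_fderiv ?_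
  ext e
  simp [InnerProductSpace.toDual_apply_apply]; ring

lemma gradient_rho {y : Space N} (hy : y ∈ unitBall N) :
    gradient (rho N p) y = (-(2 * alpha N p * rho N p y / (1 - ‖y‖ ^ 2))) • y := by
  have hd := one_sub_normSq_pos hy
  have h := hasGradientAt_comp_one_sub_normSq y
    (Real.hasDerivAt_rpow_const (p := alpha N p) (Or.inl hd.ne'))
  rw [show rho N p = fun y => (1 - ‖y‖ ^ 2) ^ alpha N p from rfl, h.gradient]
  congr 1
  rw [Real.rpow_sub hd, Real.rpow_one]; ring

lemma continuousOn_rho (hr : r < 1) : ContinuousOn (rho N p) (Metric.closedBall 0 r) :=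
  fun _ hy => (contDiffAt_rho (closedBall_subset_unitBall hr hy)).continuousAt.continuousWithinAt

lemma continuous_one_sub_normSq : Continuous fun y : Space N => 1 - ‖y‖ ^ 2 :=
  contDiff_one_sub_normSq.continuous

lemma continuousOn_inv_one_sub_normSq (hr : r < 1) :
    ContinuousOn (fun y : Space N => (1 - ‖y‖ ^ 2)⁻¹) (Metric.closedBall 0 r) :=
  continuous_one_sub_normSq.continuousOn.inv₀ fun _ hy =>
    (one_sub_normSq_pos (closedBall_subset_unitBall hr hy)).ne'

/-- A radial cutoff `χ` supported in the ball of radius `r`, with `∇χ = -k y`. -/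
structure IsCutoff (N : ℕ) (r : ℝ) (χ k : Space N → ℝ) : Prop where
  test : IsTestOn N r χ
  cont : Continuous k
  grad : ∀ y, gradient χ y = (-k y) • y
  nonneg : ∀ y, 0 ≤ χ y
  le_one : ∀ y, χ y ≤ 1
  k_nonneg : ∀ y, 0 ≤ k y

/-- The weight is known to be smooth only inside the unit ball, so smoothness is checked separately
on the support and off the support of the product. -/
lemma IsTestOn.mul_rho (hr : r ≤ 1) {φ : Space N → ℝ} (hφ : IsTestOn N r φ) :
    IsTestOn N r fun y => φ y * rho N p y where
  smooth := by
    refine contDiff_iff_contDiffAt.2 fun y => ?_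
    by_cases hy : y ∈ tsupport fun y => φ y * rho N p y
    swap
    · exact contDiffAt_const.congr_of_eventuallyEq (notMem_tsupport_iff_eventuallyEq.1 hy)
    have hy' := (tsupport_mul_subset_left (f := φ) (g := rho N p)) hy
    exact hφ.smooth.contDiffAt.mul (contDiffAt_rho (ball_subset_unitBall hr (hφ.supp hy')))
  compact := hφ.compact.mul_right
  supp := (tsupport_mul_subset_left (f := φ) (g := rho N p)).trans hφ.supp

lemma IsCutoff.gradient_mul_rho {χ k : Space N → ℝ} (h : IsCutoff N r χ k) {y : Space N}
    (hy : y ∈ unitBall N) : gradient (fun y => χ y * rho N p y) y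
      = (-(rho N p y * (χ y * (2 * alpha N p / (1 - ‖y‖ ^ 2)) + k y))) • y := by
  rw [gradient_mul (h.test.smooth.differentiable (by simp) y)
    ((contDiffAt_rho hy).differentiableAt (by simp)), gradient_rho hy, h.grad, smul_smul,
    smul_smul, ← add_smul]
  congr 1; ring

lemma memLp_inner_continuous {g : Space N → Space N} (hg : ContinuousOn g (Metric.closedBall 0 r))
    {U : Space N → Space N} (hU : MemLp U 2 (mu N r)) :
    MemLp (fun y => ⟪g y, U y⟫) 2 (mu N r) := by
  obtain ⟨C, hC⟩ := (isCompact_closedBall (0 : Space N) r).exists_bound_of_continuousOn hg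
  refine hU.of_le_mul (c := C)
    ((aestronglyMeasurable_of_continuousOn_closedBall hg).inner (𝕜 := ℝ) hU.1) ?_
  filter_upwards [ae_restrict_mem Metric.isOpen_ball.measurableSet] with y hy
  refine (norm_inner_le_norm _ _).trans ?_
  gcongr
  exact hC y (Metric.ball_subset_closedBall hy)

/-- Testing a weak gradient against the radial vector field. -/
lemma HasGradOn.radial {u : Space N → ℝ} {U : Space N → Space N} (h : HasGradOn r u U)
    (hu : MemLp u 2 (mu N r)) (hU : MemLp U 2 (mu N r)) {φ : Space N → ℝ}
    (hφ : IsTestOn N r φ) :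
    ∫ y, -(⟪y, U y⟫ + N * u y) * φ y ∂(mu N r)
      = ∫ y, ⟪u y • y, gradient φ y⟫ ∂(mu N r) := by
  -- The divergence of `u y` is assembled from coordinates: the weak gradient in direction `b i` is
  -- tested with `φ y_i` and the results are summed over `i`. The derivatives of the `y_i` add up to
  -- the term `N u`.
  set b := EuclideanSpace.basisFun (Fin N) ℝ with hb
  have hcoord : ∀ i, ContDiff ℝ ∞ fun y : Space N => ⟪b i, y⟫ := fun i =>
    contDiff_const.inner ℝ contDiff_id
  have hsum : ∀ y z : Space N, ∑ i, ⟪b i, y⟫ * ⟪z, b i⟫ = ⟪z, y⟫ := fun y z => by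
    rw [← b.sum_inner_mul_inner z y]
    exact Finset.sum_congr rfl fun i _ => mul_comm _ _
  have hgi : ∀ i y, ⟪gradient (fun y => φ y * ⟪b i, y⟫) y, b i⟫
      = ⟪b i, y⟫ * ⟪gradient φ y, b i⟫ + φ y := by
    intro i y
    rw [gradient_mul (hφ.smooth.differentiable (by simp) y)
      ((hcoord i).differentiable (by simp) y), inner_add_left, real_inner_smul_left,
      real_inner_smul_left]
    have : gradient (fun y : Space N => ⟪b i, y⟫) y = b i := by
      refine ext_inner_right ℝ fun e => ?_
      rw [inner_gradient_left]
      have : HasFDerivAt (fun y : Space N => ⟪b i, y⟫) (innerSL ℝ (b i)) y :=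
        (innerSL ℝ (b i)).hasFDerivAt
      rw [this.fderiv]; rfl
    rw [this]
    simp [add_comm]
  have cφ := continuous_gradient hφ.smooth
  have h1 : ∀ i, ∫ y, u y * (⟪b i, y⟫ * ⟪gradient φ y, b i⟫ + φ y) ∂(mu N r)
      = -∫ y, ⟪U y, b i⟫ * (φ y * ⟪b i, y⟫) ∂(mu N r) := fun i => by
    rw [← h _ (hφ.mul_smooth (hcoord i)) (b i)]
    simp_rw [hgi]
  have i1 : ∀ i, Integrable (fun y => u y * (⟪b i, y⟫ * ⟪gradient φ y, b i⟫ + φ y)) (mu N r) := by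
    intro i
    have hc : Continuous fun y : Space N => ⟪b i, y⟫ * ⟪gradient φ y, b i⟫ + φ y :=
      ((hcoord i).continuous.mul (cφ.inner continuous_const)).add hφ.smooth.continuous
    exact (memLp_smul_continuous hc.continuousOn hu).integrable (by norm_num)
  have i2 : ∀ i, Integrable (fun y => ⟪U y, b i⟫ * (φ y * ⟪b i, y⟫)) (mu N r) := by
    intro i
    have hc : Continuous fun y : Space N => φ y * ⟪b i, y⟫ :=
      hφ.smooth.continuous.mul (hcoord i).continuous
    exact (memLp_smul_continuous hc.continuousOn (hU.inner_const (b i))).integrable (by norm_num)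
  have h2 : ∑ i, ∫ y, u y * (⟪b i, y⟫ * ⟪gradient φ y, b i⟫ + φ y) ∂(mu N r)
      = -∑ i, ∫ y, ⟪U y, b i⟫ * (φ y * ⟪b i, y⟫) ∂(mu N r) := by
    rw [← Finset.sum_neg_distrib]
    exact Finset.sum_congr rfl fun i _ => h1 i
  rw [← integral_finsetSum _ fun i _ => i1 i, ← integral_finsetSum _ fun i _ => i2 i] at h2
  have e1 : ∀ y, ∑ i, u y * (⟪b i, y⟫ * ⟪gradient φ y, b i⟫ + φ y)
      = ⟪u y • y, gradient φ y⟫ + N * u y * φ y := fun y => by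
    rw [← Finset.mul_sum, Finset.sum_add_distrib, hsum, real_inner_smul_left, real_inner_comm]
    simp; ring
  have e2 : ∀ y, ∑ i, ⟪U y, b i⟫ * (φ y * ⟪b i, y⟫) = ⟪y, U y⟫ * φ y := fun y => by
    rw [real_inner_comm, ← hsum, Finset.sum_mul]
    exact Finset.sum_congr rfl fun i _ => by ring
  simp_rw [e1, e2] at h2
  have j1 : Integrable (fun y => ⟪u y • y, gradient φ y⟫) (mu N r) := by
    have hc : Continuous fun y : Space N => ⟪y, gradient φ y⟫ := continuous_id.inner cφ
    refine ((memLp_smul_continuous hc.continuousOn hu).integrable (by norm_num)).congr ?_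
    exact ae_of_all _ fun y => by simp
  have j2 : Integrable (fun y => (N : ℝ) * u y * φ y) (mu N r) := by
    have hc : Continuous fun y : Space N => (N : ℝ) * φ y := hφ.smooth.continuous.const_mul _
    refine ((memLp_smul_continuous hc.continuousOn hu).integrable (by norm_num)).congr ?_
    exact ae_of_all _ fun y => by simp; ring
  have j3 : Integrable (fun y => ⟪y, U y⟫ * φ y) (mu N r) := by
    exact (memLp_smul_continuous hφ.smooth.continuous.continuousOn
      (memLp_inner_continuous continuous_id.continuousOn hU)).integrable (by norm_num)
  rw [integral_add j1 j2] at h2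
  have e3 : ∀ y, -(⟪y, U y⟫ + N * u y) * φ y = -(⟪y, U y⟫ * φ y) - N * u y * φ y :=
    fun y => by ring
  have j4 : Integrable (fun y => -(⟪y, U y⟫ * φ y)) (mu N r) := j3.neg
  simp_rw [e3]
  rw [integral_sub j4 j2, integral_neg]
  linarith

/-- Integration by parts in `∫ χ ρ u y·∇u`. -/
theorem IsCutoff.integral_radial {χ k : Space N → ℝ} (h : IsCutoff N r χ k) (hp : 1 < p)
    (hr : r < 1) {u : Space N → ℝ} {U : Space N → Space N} (hg : HasGradOn r u U)
    (hu : MemLp u 2 (mu N r)) (hU : MemLp U 2 (mu N r)) :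
    2 * ∫ y, χ y * rho N p y * (u y * ⟪y, U y⟫) ∂(mu N r)
      = -∫ y, rho N p y * (χ y * ((p + 3) / (p - 1) - 2 * alpha N p / (1 - ‖y‖ ^ 2))
          - k y * ‖y‖ ^ 2) * u y ^ 2 ∂(mu N r) := by
  have hρ := continuousOn_rho (N := N) (p := p) hr
  have hd := continuousOn_inv_one_sub_normSq (N := N) hr
  have cχ := h.test.smooth.continuous.continuousOn (s := Metric.closedBall 0 r)
  have ck := h.cont.continuousOn (s := Metric.closedBall 0 r)
  have cn : ContinuousOn (fun y : Space N => ‖y‖ ^ 2) (Metric.closedBall 0 r) :=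
    (continuous_norm.pow 2).continuousOn
  have mR : MemLp (fun y => ⟪y, U y⟫) 2 (mu N r) :=
    memLp_inner_continuous continuous_id.continuousOn hU
  have mP : MemLp (fun y => -(⟪y, U y⟫ + N * u y)) 2 (mu N r) :=
    (mR.add (hu.const_mul (N : ℝ))).neg
  -- Take `Q = u y` and `P = -div(u y)`, and test with `χ ρ u`. The term `u y·∇u` occurs on both
  -- sides with opposite signs, whence the factor `2`.
  have key := integral_mul_eq_integral_inner_of_hasGradOn mP
    (memLp_smul_continuous continuous_id.continuousOn hu) hu hU (fun φ hφ => hg.radial hu hU hφ)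
    hg (h.test.mul_rho (p := p) hr.le)
  have i1 : Integrable (fun y => χ y * rho N p y * (u y * ⟪y, U y⟫)) (mu N r) := by
    have : MemLp (fun y => (χ y * rho N p y) • u y) 2 (mu N r) :=
      memLp_mul_continuous (cχ.mul hρ) hu
    refine (this.integrable_mul mR).congr (ae_of_all _ fun y => ?_)
    simp; ring
  have sq : ∀ {b : Space N → ℝ}, ContinuousOn b (Metric.closedBall 0 r) →
      Integrable (fun y => b y * u y ^ 2) (mu N r) := fun {b} hb => by
    have : MemLp (fun y => b y • u y) 2 (mu N r) := memLp_mul_continuous hb hu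
    refine (this.integrable_mul hu).congr (ae_of_all _ fun y => ?_)
    simp; ring
  have i2 : Integrable (fun y => (N : ℝ) * (χ y * rho N p y) * u y ^ 2) (mu N r) :=
    sq ((cχ.mul hρ).const_mul _)
  have c3 : ContinuousOn (fun y => rho N p y * (χ y * (2 * alpha N p / (1 - ‖y‖ ^ 2)) + k y)
      * ‖y‖ ^ 2) (Metric.closedBall 0 r) := by
    simp only [div_eq_mul_inv]
    exact (hρ.mul ((cχ.mul (hd.const_mul _)).add ck)).mul cn
  have i3 := sq c3
  have e1 : ∫ y, -(⟪y, U y⟫ + N * u y) * (χ y * rho N p y * u y) ∂(mu N r)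
      = -(∫ y, χ y * rho N p y * (u y * ⟪y, U y⟫) ∂(mu N r))
        - ∫ y, (N : ℝ) * (χ y * rho N p y) * u y ^ 2 ∂(mu N r) := by
    have i4 : Integrable (fun y => -(χ y * rho N p y * (u y * ⟪y, U y⟫))) (mu N r) := i1.neg
    rw [← integral_neg, ← integral_sub i4 i2]
    exact integral_congr_ae (ae_of_all _ fun y => by ring)
  have e2 : ∫ y, ⟪u y • y, (χ y * rho N p y) • U y
        + u y • gradient (fun y => χ y * rho N p y) y⟫ ∂(mu N r)
      = (∫ y, χ y * rho N p y * (u y * ⟪y, U y⟫) ∂(mu N r))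
        - ∫ y, rho N p y * (χ y * (2 * alpha N p / (1 - ‖y‖ ^ 2)) + k y) * ‖y‖ ^ 2 * u y ^ 2
          ∂(mu N r) := by
    rw [← integral_sub i1 i3]
    refine integral_congr_ae ?_
    filter_upwards [ae_restrict_mem Metric.isOpen_ball.measurableSet] with y hy
    rw [h.gradient_mul_rho (ball_subset_unitBall hr.le hy), inner_add_right, real_inner_smul_left,
      real_inner_smul_right, real_inner_smul_left, real_inner_smul_right, real_inner_smul_right,
      real_inner_self_eq_norm_sq]
    ring
  simp only [id] at key
  rw [e1, e2] at key
  have e3 : ∫ y, rho N p y * (χ y * ((p + 3) / (p - 1) - 2 * alpha N p / (1 - ‖y‖ ^ 2))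
          - k y * ‖y‖ ^ 2) * u y ^ 2 ∂(mu N r)
      = (∫ y, (N : ℝ) * (χ y * rho N p y) * u y ^ 2 ∂(mu N r))
        - ∫ y, rho N p y * (χ y * (2 * alpha N p / (1 - ‖y‖ ^ 2)) + k y) * ‖y‖ ^ 2 * u y ^ 2
          ∂(mu N r) := by
    rw [← integral_sub i2 i3]
    refine integral_congr_ae ?_
    filter_upwards [ae_restrict_mem Metric.isOpen_ball.measurableSet] with y hy
    have hdy := (one_sub_normSq_pos (ball_subset_unitBall hr.le hy)).ne'
    rw [← nat_add_two_mul_alpha (N := N) hp]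
    field_simp
    ring
  rw [e3]; linarith

end

/-! ### Solutions as continuous paths in the local phase space. -/

section

variable {N : ℕ} {p r s₀ : ℝ}

lemma norm_toLp_sq {α F : Type*} [MeasurableSpace α] {μ : Measure α} [NormedAddCommGroup F]
    {f : α → F} (hf : MemLp f 2 μ) : ‖hf.toLp f‖ ^ 2 = ∫ y, ‖f y‖ ^ 2 ∂μ := by
  have e : ‖hf.toLp f‖ = ‖hf.norm.toLp _‖ := by
    rw [Lp.norm_toLp, Lp.norm_toLp, eLpNorm_norm]
  rw [e, ← real_inner_self_eq_norm_sq, L2.inner_def]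
  refine integral_congr_ae ?_
  filter_upwards [hf.norm.coeFn_toLp] with y hy
  rw [hy]; simp [sq]

/-- The constant of equivalence between the weighted and the flat norms on the ball of
radius `r`. -/
def lowerWeight (N : ℕ) (p r : ℝ) : ℝ := (1 - r ^ 2) ^ (alpha N p + 1)

lemma lowerWeight_pos (hr0 : 0 < r) (hr : r < 1) : 0 < lowerWeight N p r :=
  Real.rpow_pos_of_pos (by nlinarith) _

/-- The smallest weight in the norm of `ℋ` is the one on the gradient, `(1-|y|²)^(α+1)`, and it
decreases with `|y|`. -/
lemma lowerWeight_le (hα : 0 < alpha N p) (hr : r < 1) {y : Space N}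
    (hy : y ∈ Metric.ball (0 : Space N) r) :
    lowerWeight N p r ≤ (1 - ‖y‖ ^ 2) * rho N p y := by
  have h : ‖y‖ < r := mem_ball_zero_iff.1 hy
  have hd := one_sub_normSq_pos (ball_subset_unitBall hr.le hy)
  have h1 : 1 - r ^ 2 ≤ 1 - ‖y‖ ^ 2 := by nlinarith [norm_nonneg y]
  have h0 : 0 ≤ 1 - r ^ 2 := by nlinarith [norm_nonneg y]
  calc lowerWeight N p r ≤ (1 - ‖y‖ ^ 2) ^ (alpha N p + 1) :=
        Real.rpow_le_rpow h0 h1 (by linarith)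
    _ = (1 - ‖y‖ ^ 2) * rho N p y := by
        rw [Real.rpow_add hd, Real.rpow_one, mul_comm]; rfl

lemma lowerWeight_mul_le (hα : 0 < alpha N p) (hr0 : 0 < r) (hr : r < 1) {w₁ w₂ : Space N → ℝ}
    {G : Space N → Space N} {y : Space N} (hy : y ∈ Metric.ball (0 : Space N) r) :
    lowerWeight N p r * ‖((w₁ y, w₂ y, G y) : State N)‖ ^ 2 ≤ normDensity N p w₁ G w₂ y := by
  have hd := one_sub_normSq_pos (ball_subset_unitBall hr.le hy)
  have hρ := rho_pos (p := p) (ball_subset_unitBall hr.le hy)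
  have h1 := lowerWeight_le hα hr hy
  have h2 : (1 - ‖y‖ ^ 2) * rho N p y ≤ rho N p y := by nlinarith [sq_nonneg ‖y‖]
  have h0 := (lowerWeight_pos (N := N) (p := p) hr0 hr).le
  have hs : ‖((w₁ y, w₂ y, G y) : State N)‖ ^ 2 ≤ w₁ y ^ 2 + w₂ y ^ 2 + ‖G y‖ ^ 2 := by
    rw [Prod.norm_def, Prod.norm_def]
    simp only [Real.norm_eq_abs]
    rcases max_choice |w₁ y| (max |w₂ y| ‖G y‖) with h | h <;> rw [h]
    · rw [sq_abs]; nlinarith [sq_nonneg (w₂ y), sq_nonneg ‖G y‖]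
    · rcases max_choice |w₂ y| ‖G y‖ with h | h <;> rw [h]
      · rw [sq_abs]; nlinarith [sq_nonneg (w₁ y), sq_nonneg ‖G y‖]
      · nlinarith [sq_nonneg (w₁ y), sq_nonneg (w₂ y)]
  calc lowerWeight N p r * ‖((w₁ y, w₂ y, G y) : State N)‖ ^ 2
      ≤ lowerWeight N p r * (w₁ y ^ 2 + w₂ y ^ 2 + ‖G y‖ ^ 2) := by gcongr
    _ ≤ w₂ y ^ 2 * rho N p y + ‖G y‖ ^ 2 * ((1 - ‖y‖ ^ 2) * rho N p y)
        + w₁ y ^ 2 * rho N p y := by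
        nlinarith [sq_nonneg (w₁ y), sq_nonneg (w₂ y), sq_nonneg ‖G y‖,
          mul_le_mul_of_nonneg_left h1 (sq_nonneg ‖G y‖),
          mul_le_mul_of_nonneg_left (h1.trans h2) (sq_nonneg (w₁ y)),
          mul_le_mul_of_nonneg_left (h1.trans h2) (sq_nonneg (w₂ y))]
    _ = normDensity N p w₁ G w₂ y := by rw [normDensity]; ring

lemma measurableSet_unitBall : MeasurableSet (unitBall N) := Metric.isOpen_ball.measurableSet

lemma MemH.aestronglyMeasurable {w₁ w₂ : Space N → ℝ} {G : Space N → Space N}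
    (h : MemH N p w₁ G w₂) :
    AEStronglyMeasurable (fun y => ((w₁ y, w₂ y, G y) : State N))
      (volume.restrict (unitBall N)) :=
  h.weakGradient.locInt.aestronglyMeasurable.prodMk
    (h.measurable_snd.prodMk h.weakGradient.locInt_grad.aestronglyMeasurable)

lemma MemH.memLp {w₁ w₂ : Space N → ℝ} {G : Space N → Space N} (hα : 0 < alpha N p)
    (hr0 : 0 < r) (hr : r < 1) (h : MemH N p w₁ G w₂) :
    MemLp (fun y => ((w₁ y, w₂ y, G y) : State N)) 2 (mu N r) := by
  have hm := h.aestronglyMeasurable.mono_set (ball_subset_unitBall hr.le)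
  rw [memLp_two_iff_integrable_sq_norm hm]
  have hc := lowerWeight_pos (N := N) (p := p) hr0 hr
  refine ((h.finite.mono_set (ball_subset_unitBall hr.le)).const_mul
    (lowerWeight N p r)⁻¹).mono' (hm.norm.pow 2) ?_
  filter_upwards [ae_restrict_mem Metric.isOpen_ball.measurableSet] with y hy
  rw [norm_pow, norm_norm, ← div_eq_inv_mul, le_div_iff₀ hc, mul_comm]
  exact lowerWeight_mul_le hα hr0 hr hy

lemma measurable_rho : Measurable (rho N p) :=
  (continuous_one_sub_normSq.measurable).pow_const _

lemma normDensity_nonneg {w₁ w₂ : Space N → ℝ} {G : Space N → Space N} {y : Space N}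
    (hy : y ∈ unitBall N) : 0 ≤ normDensity N p w₁ G w₂ y := by
  have := one_sub_normSq_pos hy
  have := rho_pos (p := p) hy
  rw [normDensity]; positivity

lemma normDensity_sub_le {w₁ w₂ w₁' w₂' : Space N → ℝ} {G G' : Space N → Space N} {y : Space N}
    (hy : y ∈ unitBall N) : normDensity N p (w₁ - w₁') (G - G') (w₂ - w₂') y
      ≤ 2 * normDensity N p w₁ G w₂ y + 2 * normDensity N p w₁' G' w₂' y := by
  have hd := one_sub_normSq_pos hy
  have hρ := rho_pos (p := p) hy
  have h3 : ‖G y - G' y‖ ^ 2 ≤ 2 * ‖G y‖ ^ 2 + 2 * ‖G' y‖ ^ 2 := by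
    have := norm_sub_le (G y) (G' y)
    nlinarith [norm_nonneg (G y - G' y), sq_nonneg (‖G y‖ - ‖G' y‖), norm_nonneg (G y),
      norm_nonneg (G' y)]
  simp only [normDensity, Pi.sub_apply]
  have key : (w₂ y - w₂' y) ^ 2 + ‖G y - G' y‖ ^ 2 * (1 - ‖y‖ ^ 2) + (w₁ y - w₁' y) ^ 2
      ≤ 2 * (w₂ y ^ 2 + ‖G y‖ ^ 2 * (1 - ‖y‖ ^ 2) + w₁ y ^ 2)
        + 2 * (w₂' y ^ 2 + ‖G' y‖ ^ 2 * (1 - ‖y‖ ^ 2) + w₁' y ^ 2) := by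
    nlinarith [mul_le_mul_of_nonneg_right h3 hd.le, sq_nonneg (w₁ y + w₁' y),
      sq_nonneg (w₂ y + w₂' y)]
  calc _ ≤ (2 * (w₂ y ^ 2 + ‖G y‖ ^ 2 * (1 - ‖y‖ ^ 2) + w₁ y ^ 2)
        + 2 * (w₂' y ^ 2 + ‖G' y‖ ^ 2 * (1 - ‖y‖ ^ 2) + w₁' y ^ 2)) * rho N p y := by gcongr
    _ = _ := by ring

lemma aestronglyMeasurable_normDensity {w₁ w₂ : Space N → ℝ} {G : Space N → Space N}
    {μ : Measure (Space N)}
    (h : AEStronglyMeasurable (fun y => ((w₁ y, w₂ y, G y) : State N)) μ) :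
    AEStronglyMeasurable (normDensity N p w₁ G w₂) μ :=
  (((h.snd.fst.pow 2).add ((h.snd.snd.norm.pow 2).mul
    continuous_one_sub_normSq.aestronglyMeasurable)).add (h.fst.pow 2)).mul
    measurable_rho.aestronglyMeasurable

lemma MemH.integrableOn_sub {w₁ w₂ w₁' w₂' : Space N → ℝ} {G G' : Space N → Space N}
    (h : MemH N p w₁ G w₂) (h' : MemH N p w₁' G' w₂') :
    IntegrableOn (normDensity N p (w₁ - w₁') (G - G') (w₂ - w₂')) (unitBall N) := by
  refine ((h.finite.const_mul 2).add (h'.finite.const_mul 2)).mono'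
    (aestronglyMeasurable_normDensity
      (h.aestronglyMeasurable.sub h'.aestronglyMeasurable)) ?_
  filter_upwards [ae_restrict_mem measurableSet_unitBall] with y hy
  rw [Real.norm_of_nonneg (normDensity_nonneg hy)]
  exact normDensity_sub_le hy

/-- The trajectory in the phase space over the ball of radius `r`, frozen before `s₀`. -/
def path (hα : 0 < alpha N p) (hr0 : 0 < r) (hr : r < 1) {w : ℝ → Space N → ℝ}
    {G : ℝ → Space N → Space N} {ws : ℝ → Space N → ℝ} (h : ContinuousInH N p s₀ w G ws)
    (t : ℝ) : Phase N r :=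
  ((h.mem (max t s₀) (le_max_right _ _)).memLp hα hr0 hr).toLp _

section path

variable (hα : 0 < alpha N p) (hr0 : 0 < r) (hr : r < 1) {w : ℝ → Space N → ℝ}
  {G : ℝ → Space N → Space N} {ws : ℝ → Space N → ℝ} (h : ContinuousInH N p s₀ w G ws)

lemma path_ae_eq {t : ℝ} (ht : s₀ ≤ t) :
    path hα hr0 hr h t =ᵐ[mu N r] fun y => ((w t y, ws t y, G t y) : State N) := by
  have := ((h.mem (max t s₀) (le_max_right _ _)).memLp hα hr0 hr).coeFn_toLp
  simp only [max_eq_left ht] at this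
  simpa only [path, max_eq_left ht] using this

lemma norm_path_sub_sq_le (t s : ℝ) :
    ‖path hα hr0 hr h t - path hα hr0 hr h s‖ ^ 2 ≤ (lowerWeight N p r)⁻¹ *
      ∫ y in unitBall N, normDensity N p (w (max t s₀) - w (max s s₀))
        (G (max t s₀) - G (max s s₀)) (ws (max t s₀) - ws (max s s₀)) y := by
  have ht := h.mem (max t s₀) (le_max_right _ _)
  have hs := h.mem (max s s₀) (le_max_right _ _)
  have hc := lowerWeight_pos (N := N) (p := p) hr0 hr
  have hint := ht.integrableOn_sub hs
  rw [path, path, ← MemLp.toLp_sub, norm_toLp_sq, ← integral_const_mul]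
  have hm := (ht.memLp hα hr0 hr).sub (hs.memLp hα hr0 hr)
  calc _ ≤ ∫ y, (lowerWeight N p r)⁻¹ * normDensity N p (w (max t s₀) - w (max s s₀))
        (G (max t s₀) - G (max s s₀)) (ws (max t s₀) - ws (max s s₀)) y ∂(mu N r) := by
        refine integral_mono_ae hm.norm.integrable_sq
          ((hint.mono_set (ball_subset_unitBall hr.le)).const_mul _) ?_
        filter_upwards [ae_restrict_mem Metric.isOpen_ball.measurableSet] with y hy
        rw [← div_eq_inv_mul, le_div_iff₀ hc, mul_comm]
        exact lowerWeight_mul_le (w₁ := w (max t s₀) - w (max s s₀))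
          (w₂ := ws (max t s₀) - ws (max s s₀)) (G := G (max t s₀) - G (max s s₀)) hα hr0 hr hy
    _ ≤ _ := by
        refine setIntegral_mono_set (hint.const_mul _) ?_
          (ball_subset_unitBall hr.le).eventuallyLE
        filter_upwards [ae_restrict_mem measurableSet_unitBall] with y hy
        exact mul_nonneg (inv_nonneg.2 hc.le) (normDensity_nonneg hy)

/-- Composing with the retraction `t ↦ max t s₀` makes the path continuous on the whole line, so
time averages need no care at `s₀`. -/
lemma continuous_path : Continuous (path hα hr0 hr h) := by
  refine continuous_iff_continuousAt.2 fun s => ?_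
  have h1 : Tendsto (fun t => max t s₀) (𝓝 s) (𝓝[Ici s₀] (max s s₀)) :=
    tendsto_nhdsWithin_iff.2 ⟨(continuous_id.max continuous_const).tendsto s,
      Eventually.of_forall fun t => le_max_right t s₀⟩
  have h2 := ((h.cont (max s s₀) (le_max_right _ _)).comp h1).const_mul (lowerWeight N p r)⁻¹
  rw [mul_zero] at h2
  have h3 : Tendsto (fun t => ‖path hα hr0 hr h t - path hα hr0 hr h s‖ ^ 2) (𝓝 s) (𝓝 0) :=
    squeeze_zero (fun _ => by positivity) (fun t => norm_path_sub_sq_le hα hr0 hr h t s) h2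
  have h4 := h3.sqrt
  simp only [Real.sqrt_sq (norm_nonneg _), Real.sqrt_zero] at h4
  exact tendsto_iff_norm_sub_tendsto_zero.2 h4

end path

lemma IsTestOn.isTest (hr : r ≤ 1) {φ : Space N → ℝ} (h : IsTestOn N r φ) : IsTest φ :=
  ⟨h.smooth, h.compact, h.supp.trans (ball_subset_unitBall hr)⟩

lemma IsTestOn.eq_zero {φ : Space N → ℝ} (h : IsTestOn N r φ) {y : Space N}
    (hy : y ∉ Metric.ball (0 : Space N) r) : φ y = 0 :=
  image_eq_zero_of_notMem_tsupport fun h' => hy (h.supp h')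

lemma IsTestOn.gradient_eq_zero {φ : Space N → ℝ} (h : IsTestOn N r φ) {y : Space N}
    (hy : y ∉ Metric.ball (0 : Space N) r) : gradient φ y = 0 := by
  have h1 : φ =ᶠ[𝓝 y] fun _ => 0 :=
    notMem_tsupport_iff_eventuallyEq.1 fun h' => hy (h.supp h')
  rw [h1.gradient_eq, gradient_fun_const]

lemma integral_unitBall_eq (hr : r ≤ 1) {h : Space N → ℝ}
    (hh : ∀ y ∉ Metric.ball (0 : Space N) r, h y = 0) :
    ∫ y in unitBall N, h y = ∫ y, h y ∂(mu N r) :=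
  setIntegral_eq_of_subset_of_forall_sdiff_eq_zero measurableSet_unitBall
    (ball_subset_unitBall hr) fun y hy => hh y hy.2

lemma HasWeakGradient.hasGradOn (hr : r ≤ 1) {u : Space N → ℝ} {U : Space N → Space N}
    (h : HasWeakGradient u U) : HasGradOn r u U := fun φ hφ e => by
  have h1 := h.byParts φ (hφ.isTest hr) e
  rwa [integral_unitBall_eq hr fun y hy => by simp [hφ.gradient_eq_zero hy],
    integral_unitBall_eq hr fun y hy => by simp [hφ.eq_zero hy]] at h1

lemma HasGradOn.congr {u u' : Space N → ℝ} {U U' : Space N → Space N} (h : HasGradOn r u U)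
    (hu : u =ᵐ[mu N r] u') (hU : U =ᵐ[mu N r] U') : HasGradOn r u' U' := fun φ hφ e => by
  rw [← integral_congr_ae (hu.mono fun y hy => by simp only [hy] :
      (fun y => u y * ⟪gradient φ y, e⟫) =ᵐ[mu N r] fun y => u' y * ⟪gradient φ y, e⟫),
    ← integral_congr_ae (hU.mono fun y hy => by simp only [hy] :
      (fun y => ⟪U y, e⟫ * φ y) =ᵐ[mu N r] fun y => ⟪U' y, e⟫ * φ y)]
  exact h φ hφ e

/-- In the phase space element `u`, the third component is the gradient of the first. -/
def IsGrad (u : Phase N r) : Prop := HasGradOn r (fun y => (u y).1) (fun y => (u y).2.2)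

lemma memLp_of_continuous {F : Type*} [NormedAddCommGroup F] [SecondCountableTopology F]
    {b : Space N → F} (hb : ContinuousOn b (Metric.closedBall 0 r)) : MemLp b 2 (mu N r) := by
  obtain ⟨C, hC⟩ := (isCompact_closedBall (0 : Space N) r).exists_bound_of_continuousOn hb
  refine MemLp.of_bound (aestronglyMeasurable_of_continuousOn_closedBall hb) C ?_
  filter_upwards [ae_restrict_mem Metric.isOpen_ball.measurableSet] with y hy
  exact hC y (Metric.ball_subset_closedBall hy)

/-- Being a gradient is the vanishing of a family of continuous linear functionals, hence it is
stable under differences and under time integrals of continuous paths. -/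
lemma isGrad_iff (u : Phase N r) : IsGrad u ↔ ∀ φ : Space N → ℝ, ∀ hφ : IsTestOn N r φ,
    ∀ e : Space N, linCLM ((memLp_of_continuous (((continuous_gradient hφ.smooth).inner
      (continuous_const (y := e))).continuousOn)).toLp fun y => ⟪gradient φ y, e⟫)
      ((memLp_of_continuous continuousOn_const).toLp fun _ => (0 : ℝ))
      ((memLp_of_continuous ((hφ.smooth.continuous.smul
        (continuous_const (y := e))).continuousOn)).toLp fun y => φ y • e) u = 0 := by
  refine forall_congr' fun φ => forall_congr' fun hφ => forall_congr' fun e => ?_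
  rw [linCLM_apply]
  have cφ := continuous_gradient hφ.smooth
  have hu := Lp.memLp u
  have i1 : Integrable (fun y => (u y).1 * ⟪gradient φ y, e⟫) (mu N r) :=
    (memLp_smul_continuous (cφ.inner (continuous_const (y := e))).continuousOn
      hu.fst).integrable (by norm_num)
  have i2 : Integrable (fun y => ⟪(u y).2.2, e⟫ * φ y) (mu N r) :=
    (memLp_smul_continuous hφ.smooth.continuous.continuousOn
      (hu.snd.snd.inner_const e)).integrable (by norm_num)
  have e1 : ∀ y, ⟪gradient φ y, e⟫ * (u y).1 + 0 * (u y).2.1 + ⟪φ y • e, (u y).2.2⟫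
      = (u y).1 * ⟪gradient φ y, e⟫ + ⟪(u y).2.2, e⟫ * φ y := fun y => by
    rw [real_inner_smul_left, real_inner_comm e ((u y).2.2)]; ring
  simp_rw [e1]
  rw [integral_add i1 i2]
  constructor <;> intro h' <;> linarith

lemma IsGrad.sub {u v : Phase N r} (hu : IsGrad u) (hv : IsGrad v) : IsGrad (u - v) := by
  rw [isGrad_iff] at *
  intro φ hφ e
  rw [map_sub, hu φ hφ e, hv φ hφ e, sub_zero]

lemma IsGrad.intervalIntegral {X : ℝ → Phase N r} (hX : Continuous X) (h : ∀ t, IsGrad (X t))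
    (a b : ℝ) : IsGrad (∫ t in a..b, X t) := by
  rw [isGrad_iff]
  intro φ hφ e
  rw [← ContinuousLinearMap.intervalIntegral_comp_comm _ (hX.intervalIntegrable a b)]
  rw [intervalIntegral.integral_congr (g := fun _ => (0 : ℝ)) fun t _ => (isGrad_iff _).1 (h t) φ hφ e]
  simp

lemma ae_eq_of_forall_test {u v : Space N → ℝ} (hu : Integrable u (mu N r))
    (hv : Integrable v (mu N r))
    (h : ∀ φ, IsTestOn N r φ → ∫ y, φ y * u y ∂(mu N r) = ∫ y, φ y * v y ∂(mu N r)) :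
    u =ᵐ[mu N r] v := by
  have hB : MeasurableSet (Metric.ball (0 : Space N) r) := Metric.isOpen_ball.measurableSet
  have h1 := Metric.isOpen_ball.ae_eq_zero_of_integral_contDiff_smul_eq_zero
    (U := Metric.ball (0 : Space N) r) (μ := volume) (f := u - v)
    (IntegrableOn.locallyIntegrableOn (hu.sub hv)) fun φ h1 h2 h3 => by
      have hφ : IsTestOn N r φ := ⟨h1, h2, h3⟩
      rw [← setIntegral_eq_integral_of_forall_compl_eq_zero (s := Metric.ball (0 : Space N) r)
        fun y hy => by simp [hφ.eq_zero hy]]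
      obtain ⟨C, hC⟩ := h2.exists_bound_of_continuous h1.continuous
      have i1 : Integrable (fun y => φ y * u y) (mu N r) :=
        hu.bdd_mul h1.continuous.aestronglyMeasurable (ae_of_all _ hC)
      have i2 : Integrable (fun y => φ y * v y) (mu N r) :=
        hv.bdd_mul h1.continuous.aestronglyMeasurable (ae_of_all _ hC)
      simp only [Pi.sub_apply, smul_eq_mul, mul_sub]
      rw [integral_sub i1 i2, h φ hφ, sub_self]
  have h2 := (ae_restrict_iff' hB).2 h1
  filter_upwards [h2] with y hy
  exact sub_eq_zero.1 hy

end

/-! ### Steklov averages and the energy identity in the limit. -/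

section

section Steklov

variable {V : Type*} [NormedAddCommGroup V] [NormedSpace ℝ V] [CompleteSpace V]

/-- The forward average of `X` over `[s, s + h]`. -/
def steklov (X : ℝ → V) (h s : ℝ) : V := h⁻¹ • ∫ t in s..s + h, X t

lemma hasDerivAt_steklov {X : ℝ → V} (hX : Continuous X) (h s : ℝ) :
    HasDerivAt (steklov X h) (h⁻¹ • (X (s + h) - X s)) s := by
  have h1 : ∀ u, ∫ t in u..u + h, X t = (∫ t in (0 : ℝ)..u + h, X t) - ∫ t in (0 : ℝ)..u, X t :=
    fun u => (intervalIntegral.integral_interval_sub_left (hX.intervalIntegrable _ _)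
      (hX.intervalIntegrable _ _)).symm
  have h2 : HasDerivAt (fun u => ∫ t in (0 : ℝ)..u, X t) (X s) s := hX.integral_hasStrictDerivAt 0 s
    |>.hasDerivAt
  have h3 : HasDerivAt (fun u => ∫ t in (0 : ℝ)..u, X t) (X (s + h)) (s + h) :=
    (hX.integral_hasStrictDerivAt 0 (s + h)).hasDerivAt
  have h4 : HasDerivAt (fun u => ∫ t in u..u + h, X t) (X (s + h) - X s) s := by
    simp_rw [h1]
    exact (h3.comp_add_const s h).sub h2
  exact h4.const_smul h⁻¹

lemma continuous_steklov {X : ℝ → V} (hX : Continuous X) (h : ℝ) : Continuous (steklov X h) :=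
  continuous_iff_continuousAt.2 fun s => (hasDerivAt_steklov hX h s).continuousAt

lemma norm_steklov_sub_le {X : ℝ → V} (hX : Continuous X) {h s ε : ℝ} (hh : 0 < h) (x : V)
    (hb : ∀ t ∈ Icc s (s + h), ‖X t - x‖ ≤ ε) : ‖steklov X h s - x‖ ≤ ε := by
  have e : steklov X h s - x = h⁻¹ • ∫ t in s..s + h, (X t - x) := by
    rw [intervalIntegral.integral_sub (hX.intervalIntegrable _ _) intervalIntegrable_const,
      intervalIntegral.integral_const, smul_sub, smul_smul, add_sub_cancel_left,
      inv_mul_cancel₀ hh.ne', one_smul, steklov]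
  have h1 := intervalIntegral.norm_integral_le_of_norm_le_const (a := s) (b := s + h)
    (f := fun t => X t - x) (C := ε) fun t ht => by
      rw [uIoc_of_le (by linarith)] at ht
      exact hb t ⟨ht.1.le, ht.2⟩
  rw [add_sub_cancel_left, abs_of_pos hh] at h1
  rw [e, norm_smul, norm_inv, Real.norm_of_nonneg hh.le, inv_mul_le_iff₀ hh]
  linarith

lemma norm_steklov_le {X : ℝ → V} (hX : Continuous X) {h s C : ℝ} (hh : 0 < h)
    (hb : ∀ t ∈ Icc s (s + h), ‖X t‖ ≤ C) : ‖steklov X h s‖ ≤ C := by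
  simpa using norm_steklov_sub_le hX hh 0 (by simpa using hb)

/-- Averages over `[s, s + h]` converge, uniformly in `s` near `t`. -/
lemma eventually_steklov_near {X : ℝ → V} (hX : Continuous X) (t : ℝ) {ε : ℝ} (hε : 0 < ε) :
    ∃ δ > 0, ∀ h, 0 < h → h < δ → ∀ s ∈ Icc (t - h) t, ‖steklov X h s - X t‖ ≤ ε := by
  obtain ⟨δ, hδ, h1⟩ := Metric.continuous_iff.1 hX t ε hε
  refine ⟨δ, hδ, fun h hh hhδ s hs => norm_steklov_sub_le hX hh _ fun u hu => ?_⟩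
  rw [← dist_eq_norm]
  refine (h1 u ?_).le
  rw [Real.dist_eq, abs_lt]
  constructor <;> linarith [hs.1, hs.2, hu.1, hu.2]

lemma tendsto_steklov {X : ℝ → V} (hX : Continuous X) {h : ℕ → ℝ} (hh : ∀ n, 0 < h n)
    (hh0 : Tendsto h atTop (𝓝 0)) (t : ℝ) :
    Tendsto (fun n => steklov X (h n) t) atTop (𝓝 (X t)) := by
  rw [Metric.tendsto_nhds]
  intro ε hε
  obtain ⟨δ, hδ, h1⟩ := eventually_steklov_near hX t (half_pos hε)
  filter_upwards [hh0.eventually (gt_mem_nhds hδ)] with n hn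
  rw [dist_eq_norm]
  linarith [h1 (h n) (hh n) hn t ⟨by linarith [hh n], le_rfl⟩]

/-- Averaging an integrable source against averaged continuous functions. -/
lemma tendsto_integral_steklov_source {X S : ℝ → V} (hX : Continuous X)
    (hS : ∀ a b, IntervalIntegrable S volume a b) (π : V →L[ℝ] V →L[ℝ] ℝ) {h : ℕ → ℝ}
    (hh : ∀ n, 0 < h n) (hh1 : ∀ n, h n ≤ 1) (hh0 : Tendsto h atTop (𝓝 0)) {a b : ℝ}
    (hab : a ≤ b) :
    Tendsto (fun n => ∫ s in a..b, π (steklov S (h n) s) (steklov X (h n) s)) atTop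
      (𝓝 (∫ t in a..b, π (S t) (X t))) := by
  obtain ⟨C, hC⟩ := (isCompact_Icc (a := a) (b := b + 1)).exists_bound_of_continuousOn
    hX.continuousOn
  have hC0 : 0 ≤ C := (norm_nonneg _).trans (hC a ⟨le_rfl, by linarith⟩)
  have hA : ∀ n, ∀ s ∈ Ioc a b, ‖steklov X (h n) s‖ ≤ C := fun n s hs =>
    norm_steklov_le hX (hh n) fun t ht => hC t ⟨by linarith [hs.1, ht.1],
      by linarith [hs.2, ht.2, hh1 n]⟩
  set μ : Measure ℝ := volume.restrict (Ioc a b) with hμ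
  -- The forward windows starting in `(a, b]` reach at most `b + 1`, because the step is at most
  -- `1`.
  set ν : Measure ℝ := volume.restrict (Ioc a (b + 1)) with hν
  have hSν : Integrable S ν :=
    (intervalIntegrable_iff_integrableOn_Ioc_of_le (by linarith)).1 (hS a (b + 1))
  set D : ℕ → Set (ℝ × ℝ) := fun n => {q | q.1 < q.2 ∧ q.2 ≤ q.1 + h n} with hD
  have hDm : ∀ n, MeasurableSet (D n) := fun n =>
    (measurableSet_lt measurable_fst measurable_snd).inter
      (measurableSet_le measurable_snd (measurable_fst.add_const _))
  set K : ℕ → ℝ × ℝ → ℝ := fun n =>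
    (D n).indicator fun q => π (S q.2) (steklov X (h n) q.1) with hK
  have hKi : ∀ n, Integrable (K n) (μ.prod ν) := fun n => by
    have b1 : Integrable (fun q : ℝ × ℝ => (1 : ℝ) * ‖S q.2‖) (μ.prod ν) :=
      (integrable_const (1 : ℝ)).mul_prod hSν.norm
    refine Integrable.indicator ?_ (hDm n)
    refine (b1.const_mul (‖π‖ * C)).mono' ?_ ?_
    · exact π.aestronglyMeasurable_comp₂ hSν.1.comp_snd
        (continuous_steklov hX (h n)).aestronglyMeasurable.comp_fst
    · have : ∀ᵐ q ∂(μ.prod ν), q.1 ∈ Ioc a b :=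
        Measure.quasiMeasurePreserving_fst.ae (ae_restrict_mem measurableSet_Ioc)
      filter_upwards [this] with q hq
      refine (π.le_opNorm₂ _ _).trans ?_
      have := hA n q.1 hq
      have h1 : ‖π‖ * ‖S q.2‖ * ‖steklov X (h n) q.1‖ ≤ ‖π‖ * ‖S q.2‖ * C := by gcongr
      linarith
  -- Fubini transposes the averaging of `S` onto the continuous factor. Afterwards `S` is evaluated
  -- at a single time only, so dominated convergence with the bound `‖π‖ ‖S t‖ C` is enough and no
  -- convergence of averages of `S` is needed.
  have e1 : ∀ n, ∫ s in a..b, π (steklov S (h n) s) (steklov X (h n) s)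
      = ∫ t, (h n)⁻¹ * ∫ s, K n (s, t) ∂μ ∂ν := fun n => by
    rw [integral_const_mul, ← integral_integral_swap (f := fun s t => K n (s, t)) (hKi n),
      ← integral_const_mul, intervalIntegral.integral_of_le hab]
    refine setIntegral_congr_fun measurableSet_Ioc fun s hs => ?_
    have e2 : ∫ t, K n (s, t) ∂ν = ∫ t in s..s + h n, π (S t) (steklov X (h n) s) := by
      have e3 : (fun t => K n (s, t))
          = (Ioc s (s + h n)).indicator fun t => π (S t) (steklov X (h n) s) := by
        ext t
        simp only [hK, hD, Set.indicator, mem_ofPred_eq, mem_Ioc]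
      rw [e3, integral_indicator measurableSet_Ioc,
        intervalIntegral.integral_of_le (by linarith [hh n]), hν,
        Measure.restrict_restrict measurableSet_Ioc, inter_eq_left.2]
      exact Ioc_subset_Ioc hs.1.le (by linarith [hs.2, hh1 n])
    rw [e2]
    have e4 := ContinuousLinearMap.intervalIntegral_comp_comm
      (π.flip (steklov X (h n) s)) (hS s (s + h n))
    simp only [ContinuousLinearMap.flip_apply] at e4
    rw [e4]
    simp [steklov]
  simp_rw [e1]
  -- Times beyond `b` do not contribute to the limit, since the window `[t-h, t)` eventually leaves
  -- `(a, b]`; the time `b` itself is negligible.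
  have e5 : ∫ t in a..b, π (S t) (X t) = ∫ t, (Iio b).indicator (fun t => π (S t) (X t)) t ∂ν := by
    rw [integral_indicator measurableSet_Iio, hν, Measure.restrict_restrict measurableSet_Iio,
      intervalIntegral.integral_of_le hab, integral_Ioc_eq_integral_Ioo]
    congr 2
    ext t; simp only [mem_Ioo, mem_inter_iff, mem_Iio, mem_Ioc]
    exact ⟨fun ht => ⟨ht.2, ht.1, by linarith [ht.2]⟩, fun ht => ⟨ht.2.1, ht.1⟩⟩
  rw [e5]
  have e6 : ∀ n t, ∫ s, K n (s, t) ∂μ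
      = ∫ s in Ioc a b ∩ Ico (t - h n) t, π (S t) (steklov X (h n) s) := fun n t => by
    have e3 : (fun s => K n (s, t))
        = (Ico (t - h n) t).indicator fun s => π (S t) (steklov X (h n) s) := by
      ext s
      simp only [hK, hD, Set.indicator, mem_ofPred_eq, mem_Ico]
      congr 1
      simp only [eq_iff_iff]
      constructor <;> rintro ⟨h1, h2⟩ <;> constructor <;> linarith
    rw [e3, integral_indicator measurableSet_Ico, hμ, Measure.restrict_restrict measurableSet_Ico,
      inter_comm]
  refine tendsto_integral_of_dominated_convergence (fun t => ‖π‖ * ‖S t‖ * C)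
    (fun n => ((hKi n).integral_prod_right.1.const_mul _)) ((hSν.norm.const_mul _).mul_const _) ?_ ?_
  · intro n
    refine ae_of_all _ fun t => ?_
    rw [e6, norm_mul, norm_inv, Real.norm_of_nonneg (hh n).le, inv_mul_le_iff₀ (hh n)]
    have h1 : ‖∫ s in Ioc a b ∩ Ico (t - h n) t, π (S t) (steklov X (h n) s)‖
        ≤ (‖π‖ * ‖S t‖ * C) * (volume.real (Ioc a b ∩ Ico (t - h n) t)) := by
      refine norm_setIntegral_le_of_norm_le_const
        ((measure_mono inter_subset_right).trans_lt (by simp)) fun s hs => ?_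
      refine (π.le_opNorm₂ _ _).trans ?_
      gcongr
      exact hA n s hs.1
    have h2 : volume.real (Ioc a b ∩ Ico (t - h n) t) ≤ h n := by
      refine (measureReal_mono inter_subset_right (by simp)).trans ?_
      simp [(hh n).le]
    refine h1.trans ?_
    rw [mul_comm (h n)]
    gcongr
  · filter_upwards [ae_restrict_mem measurableSet_Ioc, Measure.ae_ne (volume.restrict _) b]
      with t ht htb
    rcases lt_or_gt_of_ne htb with hlt | hgt
    · rw [indicator_of_mem (show t ∈ Iio b from hlt), Metric.tendsto_nhds]
      intro ε hε
      obtain ⟨δ, hδ, h1⟩ := eventually_steklov_near hX t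
        (ε := ε / (2 * (‖π (S t)‖ + 1))) (by positivity)
      filter_upwards [hh0.eventually (gt_mem_nhds hδ),
        hh0.eventually (gt_mem_nhds (sub_pos.2 ht.1))] with n hn hn2
      have hsub : Ioc a b ∩ Ico (t - h n) t = Ico (t - h n) t :=
        inter_eq_right.2 fun s hs => ⟨by linarith [hs.1], by linarith [hs.2]⟩
      have hvol : volume.real (Ico (t - h n) t) = h n := by simp [(hh n).le]
      have hi : IntegrableOn (fun s => π (S t) (steklov X (h n) s)) (Ico (t - h n) t) :=
        (((π (S t)).continuous.comp (continuous_steklov hX (h n))).integrableOn_Icc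
          (a := t - h n) (b := t)).mono_set Ico_subset_Icc_self
      have e7 : (h n)⁻¹ * (∫ s in Ico (t - h n) t, π (S t) (steklov X (h n) s)) - π (S t) (X t)
          = (h n)⁻¹ * ∫ s in Ico (t - h n) t, π (S t) (steklov X (h n) s - X t) := by
        simp_rw [map_sub]
        rw [integral_sub hi (integrable_const _), setIntegral_const, hvol, smul_eq_mul, mul_sub,
          inv_mul_cancel_left₀ (hh n).ne']
      have h3 : ‖∫ s in Ico (t - h n) t, π (S t) (steklov X (h n) s - X t)‖
          ≤ (‖π (S t)‖ * (ε / (2 * (‖π (S t)‖ + 1)))) * volume.real (Ico (t - h n) t) := by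
        refine norm_setIntegral_le_of_norm_le_const (by simp) fun s hs => ?_
        refine ((π (S t)).le_opNorm _).trans ?_
        gcongr
        exact h1 (h n) (hh n) hn s ⟨hs.1, hs.2.le⟩
      rw [e6, hsub, Real.dist_eq, e7, abs_mul, abs_inv, abs_of_pos (hh n), ← Real.norm_eq_abs]
      rw [hvol] at h3
      have h4 : ‖π (S t)‖ * (ε / (2 * (‖π (S t)‖ + 1))) < ε := by
        rw [← mul_div_assoc, div_lt_iff₀ (by positivity)]
        nlinarith [norm_nonneg (π (S t))]
      calc _ ≤ (h n)⁻¹ * ((‖π (S t)‖ * (ε / (2 * (‖π (S t)‖ + 1)))) * h n) :=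
            mul_le_mul_of_nonneg_left h3 (inv_nonneg.2 (hh n).le)
        _ = ‖π (S t)‖ * (ε / (2 * (‖π (S t)‖ + 1))) := by
            rw [mul_comm, mul_assoc, mul_inv_cancel₀ (hh n).ne', mul_one]
        _ < ε := h4
    · rw [indicator_of_notMem (by simpa using hgt.le)]
      refine tendsto_const_nhds.congr' ?_
      filter_upwards [hh0.eventually (gt_mem_nhds (sub_pos.2 hgt))] with n hn
      have : Ioc a b ∩ Ico (t - h n) t = ∅ := by
        ext s
        simp only [mem_inter_iff, mem_Ioc, mem_Ico, mem_empty_iff_false, iff_false]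
        rintro ⟨⟨_, h1⟩, h2, _⟩
        linarith
      rw [e6, this]; simp

lemma tendsto_bilinear_self {W ι : Type*} [NormedAddCommGroup W] [NormedSpace ℝ W]
    {l : Filter ι} (B : W →L[ℝ] W →L[ℝ] ℝ) {u : ι → W} {x : W}
    (hu : Tendsto u l (𝓝 x)) : Tendsto (fun n => B (u n) (u n)) l (𝓝 (B x x)) := by
  have h : Continuous fun y => B y y := B.continuous.clm_apply continuous_id
  exact (h.tendsto x).comp hu

/-- An energy identity that holds for increments of averages holds for the path itself. -/
theorem energy_identity_of_increments {X S : ℝ → V} (hX : Continuous X)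
    (hS : ∀ a b, IntervalIntegrable S volume a b) (q B π : V →L[ℝ] V →L[ℝ] ℝ) {s₀ : ℝ}
    (hid : ∀ s h, s₀ ≤ s → 0 < h →
      q (X (s + h) - X s) (∫ t in s..s + h, X t) + q (∫ t in s..s + h, X t) (X (s + h) - X s)
        = B (∫ t in s..s + h, X t) (∫ t in s..s + h, X t)
          + π (∫ t in s..s + h, S t) (∫ t in s..s + h, X t))
    {a b : ℝ} (ha : s₀ ≤ a) (hab : a ≤ b) :
    q (X b) (X b) - q (X a) (X a) = (∫ t in a..b, B (X t) (X t)) + ∫ t in a..b, π (S t) (X t) := by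
  set h : ℕ → ℝ := fun n => 1 / ((n : ℝ) + 1) with hh'
  have hh : ∀ n, 0 < h n := fun n => by positivity
  have hh1 : ∀ n, h n ≤ 1 := fun n => by
    rw [hh', div_le_one (by positivity)]; linarith [(Nat.cast_nonneg n : (0 : ℝ) ≤ n)]
  have hh0 : Tendsto h atTop (𝓝 0) := tendsto_one_div_add_atTop_nhds_zero_nat
  -- An average is continuously differentiable and its derivative is a difference quotient, so the
  -- quadratic form of the average obeys the classical product rule. The hypothesis on increments,
  -- multiplied by `h⁻²`, identifies this derivative.
  have main : ∀ n, q (steklov X (h n) b) (steklov X (h n) b)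
      - q (steklov X (h n) a) (steklov X (h n) a)
      = (∫ t in a..b, B (steklov X (h n) t) (steklov X (h n) t))
        + ∫ t in a..b, π (steklov S (h n) t) (steklov X (h n) t) := fun n => by
    have cA := continuous_steklov hX (h n)
    have cX : Continuous fun s => (h n)⁻¹ • (X (s + h n) - X s) := by fun_prop
    have d : ∀ s, HasDerivAt (fun s => q (steklov X (h n) s) (steklov X (h n) s))
        (q (steklov X (h n) s) ((h n)⁻¹ • (X (s + h n) - X s))
          + q ((h n)⁻¹ • (X (s + h n) - X s)) (steklov X (h n) s)) s := fun s => by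
      have h1 := hasDerivAt_steklov hX (h n) s
      have h2 := (q.hasFDerivAt.comp_hasDerivAt s h1).clm_apply h1
      exact h2.congr_deriv (add_comm _ _)
    have cd : Continuous fun s => q (steklov X (h n) s) ((h n)⁻¹ • (X (s + h n) - X s))
          + q ((h n)⁻¹ • (X (s + h n) - X s)) (steklov X (h n) s) :=
      ((q.continuous.comp cA).clm_apply cX).add ((q.continuous.comp cX).clm_apply cA)
    rw [← intervalIntegral.integral_eq_sub_of_hasDerivAt (fun s _ => d s)
      (cd.intervalIntegrable _ _)]
    have e1 : ∀ s ∈ Icc a b, π (steklov S (h n) s) (steklov X (h n) s)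
        = q (steklov X (h n) s) ((h n)⁻¹ • (X (s + h n) - X s))
          + q ((h n)⁻¹ • (X (s + h n) - X s)) (steklov X (h n) s)
          - B (steklov X (h n) s) (steklov X (h n) s) := fun s hs => by
      have := hid s (h n) (ha.trans hs.1) (hh n)
      simp only [steklov, map_smul, _root_.smul_apply, smul_eq_mul]
      linear_combination -(h n)⁻¹ * (h n)⁻¹ * this
    have cB : Continuous fun s => B (steklov X (h n) s) (steklov X (h n) s) :=
      (B.continuous.comp cA).clm_apply cA
    rw [intervalIntegral.integral_congr (g := fun s => _) fun s hs =>
        e1 s (by rwa [uIcc_of_le hab] at hs),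
      intervalIntegral.integral_sub (cd.intervalIntegrable _ _) (cB.intervalIntegrable _ _)]
    ring
  have hl : Tendsto (fun n => q (steklov X (h n) b) (steklov X (h n) b)
      - q (steklov X (h n) a) (steklov X (h n) a)) atTop
      (𝓝 (q (X b) (X b) - q (X a) (X a))) := by
    have hb := tendsto_steklov hX hh hh0 b
    have ha := tendsto_steklov hX hh hh0 a
    exact (tendsto_bilinear_self q hb).sub (tendsto_bilinear_self q ha)
  have hr : Tendsto (fun n => ∫ t in a..b, B (steklov X (h n) t) (steklov X (h n) t)) atTop
      (𝓝 (∫ t in a..b, B (X t) (X t))) := by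
    obtain ⟨C, hC⟩ := (isCompact_Icc (a := a) (b := b + 1)).exists_bound_of_continuousOn
      hX.continuousOn
    refine intervalIntegral.tendsto_integral_filter_of_dominated_convergence
      (fun _ => ‖B‖ * C * C) (Eventually.of_forall fun n => ?_) (Eventually.of_forall fun n => ?_)
      intervalIntegrable_const ?_
    · have cA := continuous_steklov hX (h n)
      exact ((B.continuous.comp cA).clm_apply cA).aestronglyMeasurable
    · refine ae_of_all _ fun t ht => ?_
      rw [uIoc_of_le hab] at ht
      have h1 : ‖steklov X (h n) t‖ ≤ C := norm_steklov_le hX (hh n) fun u hu =>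
        hC u ⟨by linarith [ht.1, hu.1], by linarith [ht.2, hu.2, hh1 n]⟩
      refine (B.le_opNorm₂ _ _).trans ?_
      have hC0 : 0 ≤ C := (norm_nonneg _).trans h1
      gcongr
    · refine ae_of_all _ fun t _ => ?_
      have hb := tendsto_steklov hX hh hh0 t
      exact tendsto_bilinear_self B hb
  have hs := tendsto_integral_steklov_source hX hS π hh hh1 hh0 hab
  exact tendsto_nhds_unique hl ((hr.add hs).congr fun n => (main n).symm)

end Steklov

end

/-! ### Jointly measurable representatives and measurability into `L²`. -/

section

section JointMeasurability

variable {α F : Type*} [MeasurableSpace α] {μ : Measure α} [NormedAddCommGroup F]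

/-- The squared errors form a geometric series after integration, so their pointwise sum is finite
almost everywhere and its terms tend to zero. -/
lemma ae_tendsto_of_norm_toLp_le {u : ℕ → Lp F 2 μ} {v : Lp F 2 μ}
    (h : ∀ n, ‖u n - v‖ ≤ (1 / 2) ^ n) :
    ∀ᵐ y ∂μ, Tendsto (fun n => u n y) atTop (𝓝 (v y)) := by
  have h1 : ∀ n, ∫⁻ y, ‖u n y - v y‖ₑ ^ (2 : ℝ) ∂μ ≤ (1 / 4) ^ n := fun n => by
    have e1 : eLpNorm (u n - v : Lp F 2 μ) 2 μ = ENNReal.ofReal ‖u n - v‖ := by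
      rw [Lp.norm_def, ENNReal.ofReal_toReal (Lp.eLpNorm_ne_top _)]
    have e2 : eLpNorm (u n - v : Lp F 2 μ) 2 μ = eLpNorm (fun y => u n y - v y) 2 μ :=
      eLpNorm_congr_ae (Lp.coeFn_sub _ _)
    have e3 := eLpNorm_nnreal_pow_eq_lintegral (f := fun y => u n y - v y) (μ := μ) (p := 2)
      (by norm_num)
    simp only [ENNReal.coe_ofNat, NNReal.coe_ofNat] at e3
    rw [← e3, ← e2, e1, ENNReal.rpow_ofNat, ← ENNReal.ofReal_pow (norm_nonneg _)]
    have h2 : ‖u n - v‖ ^ 2 ≤ (1 / 4) ^ n := by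
      calc ‖u n - v‖ ^ 2 ≤ ((1 / 2) ^ n) ^ 2 := by gcongr; exact h n
        _ = (1 / 4) ^ n := by rw [← pow_mul, mul_comm, pow_mul]; norm_num
    refine (ENNReal.ofReal_le_ofReal h2).trans (le_of_eq ?_)
    rw [ENNReal.ofReal_pow (by norm_num)]
    congr 1
    rw [ENNReal.ofReal_div_of_pos (by norm_num)]
    norm_num
  have hm : ∀ n, AEMeasurable (fun y => ‖u n y - v y‖ₑ ^ (2 : ℝ)) μ := fun n =>
    (((Lp.stronglyMeasurable (u n)).sub (Lp.stronglyMeasurable v)).enorm.pow_const _).aemeasurable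
  have h2 : ∫⁻ y, ∑' n, ‖u n y - v y‖ₑ ^ (2 : ℝ) ∂μ ≠ ⊤ := by
    rw [lintegral_tsum hm]
    refine ne_top_of_le_ne_top ?_ (ENNReal.tsum_le_tsum h1)
    rw [ENNReal.tsum_geometric]
    exact ENNReal.inv_ne_top.2 (tsub_pos_of_lt (by
      rw [ENNReal.div_lt_iff (by norm_num) (by norm_num)]; norm_num)).ne'
  filter_upwards [ae_lt_top' (AEMeasurable.tsum hm) h2] with y hy
  have h3 := ENNReal.tendsto_atTop_zero_of_tsum_ne_top hy.ne
  have h4 : Tendsto (fun n => ‖u n y - v y‖ₑ) atTop (𝓝 0) := by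
    have h5 := h3.ennrpow_const (1 / 2)
    rw [ENNReal.zero_rpow_of_pos (by norm_num)] at h5
    refine h5.congr fun n => ?_
    rw [← ENNReal.rpow_mul]; norm_num
  rw [tendsto_iff_edist_tendsto_0]
  simpa [edist_eq_enorm_sub] using h4

/-- A continuous path of square integrable functions has a jointly measurable representative. -/
theorem exists_jointly_measurable [CompleteSpace F] [SecondCountableTopology F]
    [MeasurableSpace F] [BorelSpace F] {X : ℝ → Lp F 2 μ} (hX : Continuous X) {a b : ℝ} (hab : a ≤ b) :
    ∃ W : ℝ × α → F, Measurable W ∧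
      ∀ t ∈ Icc a b, (fun y => W (t, y)) =ᵐ[μ] X t := by
  have huc := (isCompact_Icc (a := a) (b := b)).uniformContinuousOn_of_continuous hX.continuousOn
  have hδ : ∀ n : ℕ, ∃ δ > 0, ∀ t ∈ Icc a b, ∀ t' ∈ Icc a b, |t - t'| < δ →
      ‖X t - X t'‖ ≤ (1 / 2) ^ n := fun n => by
    obtain ⟨δ, hδ, h⟩ := Metric.uniformContinuousOn_iff.1 huc ((1 / 2) ^ n) (by positivity)
    refine ⟨δ, hδ, fun t ht t' ht' htt => ?_⟩
    rw [← dist_eq_norm]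
    exact (h t ht t' ht' (by rwa [Real.dist_eq])).le
  choose δ hδ0 hδ using hδ
  -- Grid of mesh `δ n / 2`, clipped to `[a, b]`. Rounding time down to the grid gives approximants
  -- that use countably many representatives, hence are jointly measurable, and that are within
  -- `(1/2)^n` of the path uniformly in time.
  set j : ℕ → ℤ → ℝ := fun n m => max a (min b (δ n / 2 * m)) with hj
  have hjm : ∀ n m, j n m ∈ Icc a b := fun n m =>
    ⟨le_max_left _ _, max_le hab (min_le_left _ _)⟩
  have hjt : ∀ n, ∀ t ∈ Icc a b, |j n ⌊t / (δ n / 2)⌋ - t| < δ n := fun n t ht => by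
    have hd := half_pos (hδ0 n)
    have h1 := Int.floor_le (t / (δ n / 2))
    have h2 := Int.lt_floor_add_one (t / (δ n / 2))
    rw [le_div_iff₀ hd] at h1
    rw [div_lt_iff₀ hd] at h2
    set m := ⌊t / (δ n / 2)⌋
    have h3 : min b (δ n / 2 * m) = δ n / 2 * m := min_eq_right (by linarith [ht.2])
    simp only [hj, h3]
    rw [abs_lt]
    rcases max_cases a (δ n / 2 * m) with ⟨h4, h5⟩ | ⟨h4, h5⟩ <;> rw [h4] <;>
      constructor <;> linarith [ht.1, ht.2, hδ0 n]
  set Wn : ℕ → ℝ × α → F := fun n q => X (j n ⌊q.1 / (δ n / 2)⌋) q.2 with hWn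
  have hWm : ∀ n, Measurable (Wn n) := fun n => by
    have h1 : Measurable fun q : ℤ × α => X (j n q.1) q.2 :=
      measurable_from_prod_countable_right fun m => (Lp.stronglyMeasurable (X (j n m))).measurable
    have h2 : Measurable fun q : ℝ × α => (⌊q.1 / (δ n / 2)⌋, q.2) :=
      (Int.measurable_floor.comp (measurable_fst.div_const _)).prodMk measurable_snd
    exact h1.comp h2
  refine ⟨fun q => limUnder atTop fun n => Wn n q, ?_, fun t ht => ?_⟩
  · have : Nonempty F := ⟨0⟩
    exact (StronglyMeasurable.limUnder fun n => (hWm n).stronglyMeasurable).measurable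
  · have h1 : ∀ n, ‖X (j n ⌊t / (δ n / 2)⌋) - X t‖ ≤ (1 / 2) ^ n := fun n =>
      hδ n _ (hjm _ _) t ht (hjt n t ht)
    filter_upwards [ae_tendsto_of_norm_toLp_le h1] with y hy
    exact hy.limUnder_eq

end JointMeasurability

section LpValued

variable {M : Type*} [PseudoMetricSpace M] [SecondCountableTopology M] [MeasurableSpace M]
  [BorelSpace M] {β : Type*} [MeasurableSpace β]

/-- In a separable metric space an open set is a countable union of balls with centres in a dense
sequence and rational radii. -/
lemma measurable_of_measurable_dist {f : β → M} (h : ∀ g, Measurable fun t => dist (f t) g) :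
    Measurable f := by
  refine measurable_of_isOpen fun U hU => ?_
  rcases isEmpty_or_nonempty M with hM | hM
  · have : U = ∅ := Set.eq_empty_of_isEmpty U
    simp [this]
  have e : f ⁻¹' U = ⋃ (n : ℕ) (q : ℚ) (_ : Metric.ball (TopologicalSpace.denseSeq M n) q ⊆ U),
      {t | dist (f t) (TopologicalSpace.denseSeq M n) < q} := by
    ext t
    simp only [mem_preimage, mem_iUnion, mem_ofPred_eq, exists_prop]
    constructor
    · intro ht
      obtain ⟨ε, hε, hεU⟩ := Metric.isOpen_iff.1 hU _ ht
      obtain ⟨n, hn⟩ := Metric.denseRange_iff.1 (TopologicalSpace.denseRange_denseSeq M) (f t)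
        (ε / 2) (half_pos hε)
      obtain ⟨q, hq1, hq2⟩ := exists_rat_btwn hn
      refine ⟨n, q, fun z hz => hεU ?_, hq1⟩
      rw [Metric.mem_ball] at hz ⊢
      calc dist z (f t) ≤ dist z _ + dist _ (f t) := dist_triangle _ (TopologicalSpace.denseSeq M n) _
        _ < ε := by rw [dist_comm _ (f t)]; linarith
    · rintro ⟨n, q, hsub, hq⟩
      exact hsub hq
  rw [e]
  refine MeasurableSet.iUnion fun n => MeasurableSet.iUnion fun q => MeasurableSet.iUnion fun _ => ?_
  exact measurableSet_lt (h _) measurable_const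

end LpValued

lemma measurable_eLpNorm_section {α F : Type*} [MeasurableSpace α] {μ : Measure α} [SFinite μ]
    [NormedAddCommGroup F] [MeasurableSpace F] [OpensMeasurableSpace F] {W : ℝ × α → F}
    (hW : Measurable W) : Measurable fun t => eLpNorm (fun y => W (t, y)) 2 μ := by
  have h1 : ∀ t, eLpNorm (fun y => W (t, y)) 2 μ
      = (∫⁻ y, ‖W (t, y)‖ₑ ^ (2 : ℝ) ∂μ) ^ (1 / (2 : ℝ)) := fun t => by
    rw [eLpNorm_eq_lintegral_rpow_enorm_toReal (by norm_num) (by norm_num)]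
    norm_num
  simp_rw [h1]
  refine Measurable.pow_const ?_ _
  exact Measurable.lintegral_prod_right' (f := fun q : ℝ × α => ‖W q‖ₑ ^ (2 : ℝ))
    (hW.enorm.pow_const _)

/-- A family of square integrable functions with a jointly measurable representative is
strongly measurable as a map into `L²`. -/
theorem aestronglyMeasurable_of_joint {α F : Type*} [MeasurableSpace α]
    [MeasurableSpace.CountablyGenerated α] {μ : Measure α} [SFinite μ]
    [NormedAddCommGroup F] [SecondCountableTopology F] [MeasurableSpace F]
    [BorelSpace F] {W : ℝ × α → F} (hW : Measurable W)
    {S : ℝ → Lp F 2 μ} {ν : Measure ℝ} (hS : ∀ᵐ t ∂ν, S t =ᵐ[μ] fun y => W (t, y)) :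
    AEStronglyMeasurable S ν := by
  have : Fact ((2 : ENNReal) ≠ ⊤) := ⟨by norm_num⟩
  have hWt : ∀ t, Measurable fun y => W (t, y) := fun t => hW.comp measurable_prodMk_left
  have key : ∀ g : α → F, Measurable g →
      Measurable fun t => eLpNorm (fun y => W (t, y) - g y) 2 μ := fun g hg =>
    measurable_eLpNorm_section (W := fun q : ℝ × α => W q - g q.2)
      (hW.sub (hg.comp measurable_snd))
  -- The times whose section is square integrable form a measurable set. Elsewhere the candidate
  -- `S'` is set to zero, which is harmless because almost every time belongs to this set.
  let T : Set ℝ := {t | eLpNorm (fun y => W (t, y)) 2 μ < ⊤}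
  have hTm : MeasurableSet T := measurableSet_lt (measurable_eLpNorm_section hW) measurable_const
  have hmem : ∀ t ∈ T, MemLp (fun y => W (t, y)) 2 μ := fun t ht =>
    ⟨(hWt t).aestronglyMeasurable, ht⟩
  classical
  let S' : ℝ → Lp F 2 μ := fun t => if ht : t ∈ T then (hmem t ht).toLp _ else 0
  have hS1 : ∀ t (ht : t ∈ T), S' t = (hmem t ht).toLp _ := fun t ht => dif_pos ht
  have hS2 : ∀ t, t ∉ T → S' t = 0 := fun t ht => dif_neg ht
  let _ : MeasurableSpace (Lp F 2 μ) := borel _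
  have : BorelSpace (Lp F 2 μ) := ⟨rfl⟩
  have hS'm : Measurable S' := by
    refine measurable_of_measurable_dist fun g => ?_
    have e : (fun t => dist (S' t) g) = fun t => if t ∈ T then
        (eLpNorm (fun y => W (t, y) - g y) 2 μ).toReal else ‖g‖ := by
      ext t
      by_cases ht : t ∈ T
      · rw [if_pos ht, hS1 t ht, Lp.dist_def]
        congr 1
        refine eLpNorm_congr_ae ?_
        filter_upwards [(hmem t ht).coeFn_toLp] with y hy
        rw [Pi.sub_apply, hy]
      · rw [if_neg ht, hS2 t ht, dist_zero_left]
    rw [e]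
    exact Measurable.ite hTm (key g (Lp.stronglyMeasurable g).measurable).ennreal_toReal
      measurable_const
  refine ⟨S', hS'm.stronglyMeasurable, ?_⟩
  filter_upwards [hS] with t ht
  have htT : t ∈ T := by
    have : eLpNorm (fun y => W (t, y)) 2 μ < ⊤ := by
      rw [← eLpNorm_congr_ae ht]; exact Lp.eLpNorm_lt_top _
    exact this
  rw [hS1 t htT]
  exact Lp.ext (ht.trans (hmem t htT).coeFn_toLp.symm)

end

/-! ### The source as an integrable path, and the equation for increments. -/

section

variable {N : ℕ} {p r s₀ : ℝ}

/-- The nonlinear source as a function of the state. -/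
def sourceFun {N : ℕ} (p : ℝ) (f g : ℝ → ℝ) (s : ℝ) (y : Space N) (x : State N) : ℝ :=
  |x.1| ^ (p - 1) * x.1
    + Real.exp (-(2 * p * s / (p - 1))) * f (Real.exp (2 * s / (p - 1)) * x.1)
    + Real.exp (-(2 * p * s / (p - 1))) *
        g (Real.exp ((p + 1) * s / (p - 1)) * (x.2.1 + ⟪y, x.2.2⟫ + 2 / (p - 1) * x.1))

lemma source_eq {f g : ℝ → ℝ} {w : ℝ → Space N → ℝ} {G : ℝ → Space N → Space N}
    {ws : ℝ → Space N → ℝ} (s : ℝ) (y : Space N) :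
    source p f g w G ws s y = sourceFun p f g s y (w s y, ws s y, G s y) := rfl

lemma measurable_sourceFun {f g : ℝ → ℝ} (hf : Continuous f) (hg : Continuous g) :
    Measurable fun q : ℝ × Space N × State N => sourceFun p f g q.1 q.2.1 q.2.2 := by
  have m1 : Measurable fun q : ℝ × Space N × State N => q.2.2.1 := by fun_prop
  have m2 : Measurable fun q : ℝ × Space N × State N => q.2.2.2.1 := by fun_prop
  have m3 : Measurable fun q : ℝ × Space N × State N => ⟪q.2.1, q.2.2.2.2⟫ :=
    (by fun_prop : Continuous fun q : ℝ × Space N × State N => ⟪q.2.1, q.2.2.2.2⟫).measurable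
  have m4 : Measurable fun q : ℝ × Space N × State N => Real.exp (-(2 * p * q.1 / (p - 1))) := by
    fun_prop
  have m5 : Measurable fun q : ℝ × Space N × State N => Real.exp (2 * q.1 / (p - 1)) := by
    fun_prop
  have m6 : Measurable fun q : ℝ × Space N × State N => Real.exp ((p + 1) * q.1 / (p - 1)) := by
    fun_prop
  have m0 : Measurable fun q : ℝ × Space N × State N => |q.2.2.1| ^ (p - 1) :=
    (continuous_abs.measurable.comp m1).pow_const _
  exact ((m0.mul m1).add (m4.mul (hf.measurable.comp (m5.mul m1)))).add
    (m4.mul (hg.measurable.comp (m6.mul ((m2.add m3).add (m1.const_mul _)))))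

section Solution

variable {f g : ℝ → ℝ} {w : ℝ → Space N → ℝ} {G : ℝ → Space N → Space N}
  {ws : ℝ → Space N → ℝ}

lemma isGrad_path (hα : 0 < alpha N p) (hr0 : 0 < r) (hr : r < 1)
    (h : ContinuousInH N p s₀ w G ws) (t : ℝ) : IsGrad (path hα hr0 hr h t) := by
  have hm := h.mem (max t s₀) (le_max_right _ _)
  have he := (hm.memLp hα hr0 hr).coeFn_toLp
  exact (hm.weakGradient.hasGradOn hr.le).congr (he.mono fun y hy => (congrArg Prod.fst hy).symm)
    (he.mono fun y hy => (congrArg (fun x : State N => x.2.2) hy).symm)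

/-- A joint representative of the trajectory, defined on the whole ball of radius `r`. -/
lemma exists_joint_state (hα : 0 < alpha N p) (hr0 : 0 < r) (hr : r < 1)
    (h : ContinuousInH N p s₀ w G ws) (T : ℝ) (hT : s₀ ≤ T) :
    ∃ W : ℝ × Space N → State N, Measurable W ∧ ∀ t ∈ Icc s₀ T,
      (fun y => W (t, y)) =ᵐ[mu N r] fun y => ((w t y, ws t y, G t y) : State N) := by
  obtain ⟨W, hW, hWX⟩ := exists_jointly_measurable (continuous_path hα hr0 hr h) hT
  exact ⟨W, hW, fun t ht => (hWX t ht).trans (path_ae_eq hα hr0 hr h ht.1)⟩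

/-- The hypothesis on the source bounds a lower integral whose integrand need not be measurable in
time. Replacing the state by a joint representative makes the integrand measurable, and only then
does finiteness at almost every time follow. -/
lemma ae_memLp_source (hα : 0 < alpha N p) (hr0 : 0 < r) (hr : r < 1)
    (hf : Continuous f) (hg : Continuous g)
    (sol : IsSolution N p f g s₀ w G ws) (T : ℝ) :
    ∀ᵐ t ∂(volume.restrict (Icc s₀ T)), MemLp (source p f g w G ws t) 2 (mu N r) := by
  rcases lt_or_ge T s₀ with hT | hT
  · rw [Icc_eq_empty (by linarith)]; simp
  obtain ⟨W, hW, hWX⟩ := exists_joint_state hα hr0 hr sol.continuousInH T hT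
  have hm : Measurable fun q : ℝ × Space N => sourceFun p f g q.1 q.2 (W q) :=
    (measurable_sourceFun hf hg).comp (measurable_fst.prodMk (measurable_snd.prodMk hW))
  have he : ∀ t ∈ Icc s₀ T, (fun y => sourceFun p f g t y (W (t, y)))
      =ᵐ[mu N r] source p f g w G ws t := fun t ht => by
    filter_upwards [hWX t ht] with y hy
    rw [source_eq, hy]
  have hle : ∫⁻ t in Icc s₀ T, eLpNorm (fun y => sourceFun p f g t y (W (t, y))) 2 (mu N r)
      < ⊤ := by
    refine lt_of_le_of_lt (setLIntegral_mono' measurableSet_Icc fun t ht => ?_)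
      (sol.source_loc r hr T)
    rw [eLpNorm_congr_ae (he t ht)]
    exact eLpNorm_mono_measure _ (Measure.restrict_mono Metric.ball_subset_closedBall le_rfl)
  have hlt := ae_lt_top (measurable_eLpNorm_section (μ := mu N r) hm) hle.ne
  filter_upwards [hlt, ae_restrict_mem measurableSet_Icc] with t h1 h2
  refine ⟨AEStronglyMeasurable.congr ?_ (he t h2), by rwa [← eLpNorm_congr_ae (he t h2)]⟩
  exact (hm.comp measurable_prodMk_left).aestronglyMeasurable

lemma memLp_inl {u : Space N → ℝ} (hu : MemLp u 2 (mu N r)) :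
    MemLp (fun y => ((u y, 0, 0) : State N)) 2 (mu N r) :=
  (ContinuousLinearMap.inl ℝ ℝ (ℝ × Space N)).comp_memLp' hu

open Classical in
/-- The source as a path in the phase space (in the first slot). -/
def sourcePath (p r s₀ : ℝ) (f g : ℝ → ℝ) (w : ℝ → Space N → ℝ) (G : ℝ → Space N → Space N)
    (ws : ℝ → Space N → ℝ) (t : ℝ) : Phase N r :=
  -- The value is zero before `s₀` and wherever the source is not square integrable. Putting the
  -- source in the first slot lets `crossCoeff` pair it with `w_s` and `massCoeff` pair it with `w`.
  if h : s₀ ≤ t ∧ MemLp (source p f g w G ws t) 2 (mu N r) then (memLp_inl h.2).toLp _ else 0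

lemma sourcePath_ae_eq {t : ℝ} (ht : s₀ ≤ t) (hm : MemLp (source p f g w G ws t) 2 (mu N r)) :
    sourcePath p r s₀ f g w G ws t
      =ᵐ[mu N r] fun y => ((source p f g w G ws t y, 0, 0) : State N) := by
  rw [sourcePath, dif_pos ⟨ht, hm⟩]
  exact (memLp_inl hm).coeFn_toLp

/-- Strong measurability comes from the joint representative, and the norm is controlled by the
assumed local bound on the source. Extension by zero to the left of `s₀` then covers every interval.
-/
lemma intervalIntegrable_sourcePath (hα : 0 < alpha N p) (hr0 : 0 < r) (hr : r < 1)
    (hf : Continuous f) (hg : Continuous g)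
    (sol : IsSolution N p f g s₀ w G ws) (a b : ℝ) :
    IntervalIntegrable (sourcePath p r s₀ f g w G ws) volume a b := by
  have key : ∀ T, s₀ ≤ T → IntegrableOn (sourcePath p r s₀ f g w G ws) (Icc s₀ T) := fun T hT => by
    obtain ⟨W, hW, hWX⟩ := exists_joint_state hα hr0 hr sol.continuousInH T hT
    have hm : Measurable fun q : ℝ × Space N =>
        ((sourceFun p f g q.1 q.2 (W q), 0, 0) : State N) :=
      ((measurable_sourceFun hf hg).comp
        (measurable_fst.prodMk (measurable_snd.prodMk hW))).prodMk measurable_const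
    refine ⟨aestronglyMeasurable_of_joint hm ?_, ?_⟩
    · filter_upwards [ae_memLp_source hα hr0 hr hf hg sol T, ae_restrict_mem measurableSet_Icc]
        with t h1 h2
      filter_upwards [sourcePath_ae_eq h2.1 h1, hWX t h2] with y hy hy'
      rw [hy, source_eq, hy']
    · refine lt_of_le_of_lt (setLIntegral_mono' measurableSet_Icc fun t ht => ?_)
        (sol.source_loc r hr T)
      by_cases h : s₀ ≤ t ∧ MemLp (source p f g w G ws t) 2 (mu N r)
      · rw [sourcePath, dif_pos h, Lp.enorm_toLp]
        refine le_trans (le_of_eq ?_) (eLpNorm_mono_measure _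
          (Measure.restrict_mono Metric.ball_subset_closedBall le_rfl))
        exact eLpNorm_congr_norm_ae (ae_of_all _ fun y => by simp [Prod.norm_def])
      · rw [sourcePath, dif_neg h]; simp
  have hz : IntegrableOn (sourcePath p r s₀ f g w G ws) (Iio s₀) := by
    refine (integrableOn_congr_fun (fun t ht => ?_) measurableSet_Iio).2 integrableOn_zero
    rw [sourcePath, dif_neg fun h => absurd h.1 (not_le.2 ht)]
  have hU : IntegrableOn (sourcePath p r s₀ f g w G ws) (Iio s₀ ∪ Icc s₀ (max s₀ (max a b))) :=
    hz.union (key _ (le_max_left _ _))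
  refine intervalIntegrable_iff.2 (hU.mono_set fun t ht => ?_)
  rcases lt_or_ge t s₀ with h | h
  · exact Or.inl h
  · exact Or.inr ⟨h, le_max_of_le_right ht.2⟩

/-- The increment of `w` is the time integral of `w_s`. -/
lemma fst_increment (hα : 0 < alpha N p) (hr0 : 0 < r) (hr : r < 1)
    (sol : IsSolution N p f g s₀ w G ws) {a b : ℝ} (ha : s₀ ≤ a) (hab : a ≤ b) :
    (fun y => ((path hα hr0 hr sol.continuousInH b - path hα hr0 hr sol.continuousInH a :
        Phase N r) y).1)
      =ᵐ[mu N r] fun y => ((∫ t in a..b, path hα hr0 hr sol.continuousInH t : Phase N r) y).2.1 := by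
  have hX := continuous_path hα hr0 hr sol.continuousInH
  have m0 : MemLp (fun _ : Space N => (0 : Space N)) 2 (mu N r) :=
    memLp_of_continuous continuousOn_const
  have m1 : MemLp (fun _ : Space N => (0 : ℝ)) 2 (mu N r) :=
    memLp_of_continuous continuousOn_const
  refine ae_eq_of_forall_test ((Lp.memLp _).fst.integrable (by norm_num))
    ((Lp.memLp _).snd.fst.integrable (by norm_num)) fun φ hφ => ?_
  have mφ : MemLp φ 2 (mu N r) := memLp_of_continuous hφ.smooth.continuous.continuousOn
  have e1 := linCLM_apply mφ m1 m0
    (path hα hr0 hr sol.continuousInH b - path hα hr0 hr sol.continuousInH a)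
  have e2 := linCLM_apply m1 mφ m0 (∫ t in a..b, path hα hr0 hr sol.continuousInH t)
  simp only [zero_mul, add_zero, zero_add, inner_zero_left] at e1 e2
  rw [← e1, ← e2, ← ContinuousLinearMap.intervalIntegral_comp_comm _ (hX.intervalIntegrable _ _)]
  have h1 := sol.timeDeriv φ (hφ.isTest hr.le) a b ha hab
  have h2 : ∀ t ∈ uIcc a b, linCLM (m1.toLp _) (mφ.toLp _) (m0.toLp _)
      (path hα hr0 hr sol.continuousInH t) = ∫ y in unitBall N, ws t y * φ y := fun t ht => by
    rw [uIcc_of_le hab] at ht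
    rw [linCLM_apply, integral_unitBall_eq hr.le fun y hy => by simp [hφ.eq_zero hy]]
    refine integral_congr_ae ?_
    filter_upwards [path_ae_eq hα hr0 hr sol.continuousInH (ha.trans ht.1)] with y hy
    rw [hy]; simp [mul_comm]
  rw [intervalIntegral.integral_congr h2, ← h1, e1,
    integral_unitBall_eq hr.le fun y hy => by simp [hφ.eq_zero hy]]
  refine integral_congr_ae ?_
  filter_upwards [path_ae_eq hα hr0 hr sol.continuousInH (ha.trans hab),
    path_ae_eq hα hr0 hr sol.continuousInH ha, Lp.coeFn_sub
      (path hα hr0 hr sol.continuousInH b) (path hα hr0 hr sol.continuousInH a)] with y h1 h2 h3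
  rw [h3, Pi.sub_apply, h1, h2]; simp [mul_comm]

end Solution

/-- The zeroth order part of the increment of the equation. -/
def incrP (p : ℝ) (dx x σ : Phase N r) (y : Space N) : ℝ :=
  rho N p y * ((dx y).2.1 + (2 * p + 2) / (p - 1) ^ 2 * (x y).1 + (p + 3) / (p - 1) * (x y).2.1
    - 2 * ((p + 3) / (p - 1) - 2 * alpha N p * (1 - ‖y‖ ^ 2)⁻¹) * (x y).2.1 - (σ y).1)

/-- The flux in the increment of the equation. -/
def incrQ (p : ℝ) (x : Phase N r) (y : Space N) : Space N :=
  rho N p y • (-((x y).2.2 - ⟪y, (x y).2.2⟫ • y) + (2 * (x y).2.1) • y)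

lemma memLp_incrP (hr : r < 1) (dx x σ : Phase N r) : MemLp (incrP p dx x σ) 2 (mu N r) := by
  have hd := continuousOn_inv_one_sub_normSq (N := N) hr
  have h1 := Lp.memLp dx
  have h2 := Lp.memLp x
  have h3 := Lp.memLp σ
  have h4 : MemLp (fun y => (2 * ((p + 3) / (p - 1) - 2 * alpha N p * (1 - ‖y‖ ^ 2)⁻¹))
      • (x y).2.1) 2 (mu N r) :=
    memLp_mul_continuous ((continuousOn_const.sub (hd.const_mul _)).const_mul _) h2.snd.fst
  exact memLp_mul_continuous (continuousOn_rho hr) ((((h1.snd.fst.add (h2.fst.const_mul _)).add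
    (h2.snd.fst.const_mul _)).sub h4).sub h3.fst)

lemma memLp_incrQ (hr : r < 1) (x : Phase N r) : MemLp (incrQ p x) 2 (mu N r) := by
  have h2 := Lp.memLp x
  have h3 : MemLp (fun y => ⟪y, (x y).2.2⟫ • y) 2 (mu N r) :=
    memLp_smul_continuous continuous_id.continuousOn
      (memLp_inner_continuous continuous_id.continuousOn h2.snd.snd)
  have h4 : MemLp (fun y => (2 * (x y).2.1) • y) 2 (mu N r) :=
    memLp_smul_continuous continuous_id.continuousOn (h2.snd.fst.const_mul 2)
  exact memLp_mul_continuous (continuousOn_rho hr) ((h2.snd.snd.sub h3).neg.add h4)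

section Solution

variable {f g : ℝ → ℝ} {w : ℝ → Space N → ℝ} {G : ℝ → Space N → Space N}
  {ws : ℝ → Space N → ℝ}

/-- The equation for increments over a time interval, in weak divergence form. -/
theorem integral_incrP_mul (hα : 0 < alpha N p) (hr0 : 0 < r) (hr : r < 1)
    (hp : 1 < p) (hf : Continuous f) (hg : Continuous g)
    (sol : IsSolution N p f g s₀ w G ws) {a b : ℝ} (ha : s₀ ≤ a) (hab : a ≤ b) {φ : Space N → ℝ}
    (hφ : IsTestOn N r φ) :
    ∫ y, incrP p (path hα hr0 hr sol.continuousInH b - path hα hr0 hr sol.continuousInH a)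
        (∫ t in a..b, path hα hr0 hr sol.continuousInH t)
        (∫ t in a..b, sourcePath p r s₀ f g w G ws t) y * φ y ∂(mu N r)
      = ∫ y, ⟪incrQ p (∫ t in a..b, path hα hr0 hr sol.continuousInH t) y, gradient φ y⟫
          ∂(mu N r) := by
  set X := path hα hr0 hr sol.continuousInH with hXdef
  set S := sourcePath p r s₀ f g w G ws with hSdef
  have hX : Continuous X := continuous_path hα hr0 hr sol.continuousInH
  have hS : ∀ a b, IntervalIntegrable S volume a b :=
    intervalIntegrable_sourcePath hα hr0 hr hf hg sol
  have hd := continuousOn_inv_one_sub_normSq (N := N) hr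
  have hρ := continuousOn_rho (N := N) (p := p) hr
  have cφ := hφ.smooth.continuous.continuousOn (s := Metric.closedBall (0 : Space N) r)
  have cg := (continuous_gradient hφ.smooth).continuousOn (s := Metric.closedBall (0 : Space N) r)
  have cy := (continuous_id (X := Space N)).continuousOn (s := Metric.closedBall (0 : Space N) r)
  have cyg : ContinuousOn (fun y => ⟪y, gradient φ y⟫) (Metric.closedBall (0 : Space N) r) :=
    cy.inner cg
  have m0 : MemLp (fun _ : Space N => (0 : Space N)) 2 (mu N r) :=
    memLp_of_continuous continuousOn_const
  have m1 : MemLp (fun _ : Space N => (0 : ℝ)) 2 (mu N r) :=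
    memLp_of_continuous continuousOn_const
  have mφ : MemLp (fun y => φ y * rho N p y) 2 (mu N r) := memLp_of_continuous (cφ.mul hρ)
  have ma : MemLp (fun y => -((2 * p + 2) / (p - 1) ^ 2) * (φ y * rho N p y)) 2 (mu N r) :=
    memLp_of_continuous ((cφ.mul hρ).const_mul _)
  have mb : MemLp (fun y => (-((p + 3) / (p - 1)) * φ y + 2 * (⟪y, gradient φ y⟫
      + ((p + 3) / (p - 1) - 2 * alpha N p * (1 - ‖y‖ ^ 2)⁻¹) * φ y)) * rho N p y) 2 (mu N r) :=
    memLp_of_continuous (((cφ.const_mul _).add ((cyg.add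
      ((continuousOn_const.sub (hd.const_mul _)).mul cφ)).const_mul _)).mul hρ)
  have mc : MemLp (fun y => rho N p y • (-(gradient φ y - ⟪y, gradient φ y⟫ • y))) 2 (mu N r) :=
    memLp_of_continuous (hρ.smul (cg.sub (cyg.smul cy)).neg)
  set LA := linCLM (ma.toLp _) (mb.toLp _) (mc.toLp _) with hLA
  set LS := linCLM (mφ.toLp _) (m1.toLp _) (m0.toLp _) with hLS
  set LV := linCLM (m1.toLp _) (mφ.toLp _) (m0.toLp _) with hLV
  have i1 : IntervalIntegrable (fun t => LA (X t)) volume a b :=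
    (LA.continuous.comp hX).intervalIntegrable _ _
  have i2 : IntervalIntegrable (fun t => LS (S t)) volume a b :=
    ⟨LS.integrable_comp (hS a b).1, LS.integrable_comp (hS a b).2⟩
  have e0 : LV (X b - X a) = ∫ y in unitBall N, (ws b y - ws a y) * φ y * rho N p y := by
    rw [hLV, linCLM_apply, integral_unitBall_eq hr.le fun y hy => by simp [hφ.eq_zero hy]]
    refine integral_congr_ae ?_
    filter_upwards [path_ae_eq hα hr0 hr sol.continuousInH (ha.trans hab),
      path_ae_eq hα hr0 hr sol.continuousInH ha, Lp.coeFn_sub (X b) (X a)] with y h1 h2 h3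
    rw [h3, Pi.sub_apply, h1, h2]; simp; ring
  -- At almost every time the tested right-hand side is a bounded linear functional of the state
  -- plus one of the source. Such functionals commute with the time integral, which turns the
  -- equation into one between `x` and `σ`.
  have e2 : ∀ᵐ t ∂(volume.restrict (Ioc a b)),
      weakRHS N p f g w G ws φ t = LA (X t) + LS (S t) := by
    have h1 := ae_restrict_of_ae_restrict_of_subset
      (Ioc_subset_Icc_self.trans (Icc_subset_Icc_left ha) : Ioc a b ⊆ Icc s₀ b)
      (ae_memLp_source hα hr0 hr hf hg sol b)
    filter_upwards [h1, ae_restrict_mem measurableSet_Ioc] with t ht htab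
    have hst : s₀ ≤ t := ha.trans htab.1.le
    rw [weakRHS, integral_unitBall_eq hr.le fun y hy => by
      simp [hφ.eq_zero hy, hφ.gradient_eq_zero hy], hLA, hLS, linCLM_apply, linCLM_apply,
      ← integral_add (integrable_lin ma mb mc _) (integrable_lin mφ m1 m0 _)]
    refine integral_congr_ae ?_
    filter_upwards [path_ae_eq hα hr0 hr sol.continuousInH hst, sourcePath_ae_eq hst ht,
      ae_restrict_mem Metric.isOpen_ball.measurableSet] with y h2 h3 hy
    have hdy := (one_sub_normSq_pos (ball_subset_unitBall hr.le hy)).ne'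
    rw [h2, h3, ← nat_add_two_mul_alpha (N := N) hp]
    simp only [inner_zero_left, zero_mul, add_zero, real_inner_smul_left, inner_neg_left,
      inner_sub_left, real_inner_comm (gradient φ y) (G t y)]
    field_simp
    ring
  have e1 : LV (X b - X a) = LA (∫ t in a..b, X t) + LS (∫ t in a..b, S t) := by
    rw [← LA.intervalIntegral_comp_comm (hX.intervalIntegrable _ _),
      ← LS.intervalIntegral_comp_comm (hS _ _), ← intervalIntegral.integral_add i1 i2, e0,
      sol.equation φ (hφ.isTest hr.le) a b ha hab]
    refine intervalIntegral.integral_congr_ae ?_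
    rw [uIoc_of_le hab]
    exact (ae_restrict_iff' measurableSet_Ioc).1 e2
  set x := ∫ t in a..b, X t
  set σ := ∫ t in a..b, S t
  rw [hLV, hLA, hLS, linCLM_apply, linCLM_apply, linCLM_apply] at e1
  have j1 := integrable_lin m1 mφ m0 (X b - X a)
  have j2 := integrable_lin ma mb mc x
  have j3 := integrable_lin mφ m1 m0 σ
  have jP : Integrable (fun y => incrP p (X b - X a) x σ y * φ y) (mu N r) :=
    (memLp_incrP hr _ _ _).integrable_mul (memLp_of_continuous cφ)
  have jQ : Integrable (fun y => ⟪incrQ p x y, gradient φ y⟫) (mu N r) := by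
    refine ((memLp_inner_continuous cg (memLp_incrQ (p := p) hr x)).integrable (by norm_num)).congr ?_
    exact ae_of_all _ fun y => real_inner_comm _ _
  have e2' := integral_add j2 j3
  have e3 := integral_sub j1 (j2.add j3)
  simp only [Pi.add_apply] at e3
  rw [← sub_eq_zero, ← e2', ← e3] at e1
  rw [← sub_eq_zero, ← integral_sub jP jQ, ← e1]
  refine integral_congr_ae (ae_of_all _ fun y => ?_)
  simp only [incrP, incrQ, inner_zero_left, zero_mul, add_zero, zero_add,
    real_inner_smul_left, inner_neg_left, inner_sub_left, inner_add_left,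
    real_inner_comm (gradient φ y) ((x y).2.2)]
  ring

end Solution

end

/-! ### Localized quadratic forms and their increments. -/

section

variable {N : ℕ} {p r s₀ : ℝ}

/-- The quadratic part of the localized energy. -/
def energyCoeff (p : ℝ) (χ : Space N → ℝ) : Coeff N where
  ww y := 1 / 2 * ((2 * p + 2) / (p - 1) ^ 2) * (χ y * rho N p y)
  wv _ := 0
  vv y := 1 / 2 * (χ y * rho N p y)
  GG y := 1 / 2 * (χ y * rho N p y)
  RR y := -(1 / 2) * (χ y * rho N p y)
  wR _ := 0
  vR _ := 0

/-- The time derivative of the localized energy, up to the source. -/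
def energyFlux (p : ℝ) (χ k : Space N → ℝ) : Coeff N where
  ww _ := 0
  wv _ := 0
  -- The first term is the interior dissipation; the second is the flux through the cutoff layer,
  -- which arises from `∇χ = -k y` and has a good sign.
  vv y := -(2 * alpha N p * (1 - ‖y‖ ^ 2)⁻¹ * (χ y * rho N p y)) - k y * ‖y‖ ^ 2 * rho N p y
  GG _ := 0
  RR _ := 0
  wR _ := 0
  vR y := k y * (1 - ‖y‖ ^ 2) * rho N p y

/-- The localized pairing of `w` and `w_s`. -/
def crossCoeff (p : ℝ) (χ : Space N → ℝ) : Coeff N where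
  ww _ := 0
  wv y := χ y * rho N p y
  vv _ := 0
  GG _ := 0
  RR _ := 0
  wR _ := 0
  vR _ := 0

/-- The time derivative of the localized pairing, up to the source. -/
def crossFlux (p : ℝ) (χ k : Space N → ℝ) : Coeff N where
  ww y := -((2 * p + 2) / (p - 1) ^ 2) * (χ y * rho N p y)
  wv y := ((p + 3) / (p - 1) - 4 * alpha N p * (1 - ‖y‖ ^ 2)⁻¹) * (χ y * rho N p y)
    - 2 * (k y * ‖y‖ ^ 2 * rho N p y)
  vv y := χ y * rho N p y
  GG y := -(χ y * rho N p y)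
  RR y := χ y * rho N p y
  wR y := k y * (1 - ‖y‖ ^ 2) * rho N p y
  vR y := 2 * (χ y * rho N p y)

/-- The localized `L²` pairing of the first components. -/
def massCoeff (p : ℝ) (χ : Space N → ℝ) : Coeff N where
  ww y := χ y * rho N p y
  wv _ := 0
  vv _ := 0
  GG _ := 0
  RR _ := 0
  wR _ := 0
  vR _ := 0

section Admissible

variable {χ k : Space N → ℝ}

lemma IsCutoff.continuousOn_mul_rho (h : IsCutoff N r χ k) (hr : r < 1) :
    ContinuousOn (fun y => χ y * rho N p y) (Metric.closedBall 0 r) :=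
  h.test.smooth.continuous.continuousOn.mul (continuousOn_rho hr)

lemma IsCutoff.energyCoeff (h : IsCutoff N r χ k) (hr : r < 1) :
    (energyCoeff p χ).Admissible r := by
  have c := h.continuousOn_mul_rho (p := p) hr
  exact ⟨c.const_mul _, continuousOn_const, c.const_mul _, c.const_mul _, c.const_mul _,
    continuousOn_const, continuousOn_const⟩

lemma IsCutoff.crossCoeff (h : IsCutoff N r χ k) (hr : r < 1) :
    (crossCoeff p χ).Admissible r := by
  have c := h.continuousOn_mul_rho (p := p) hr
  exact ⟨continuousOn_const, c, continuousOn_const, continuousOn_const, continuousOn_const,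
    continuousOn_const, continuousOn_const⟩

lemma IsCutoff.massCoeff (h : IsCutoff N r χ k) (hr : r < 1) :
    (massCoeff p χ).Admissible r := by
  have c := h.continuousOn_mul_rho (p := p) hr
  exact ⟨c, continuousOn_const, continuousOn_const, continuousOn_const, continuousOn_const,
    continuousOn_const, continuousOn_const⟩

lemma IsCutoff.energyFlux (h : IsCutoff N r χ k) (hr : r < 1) :
    (energyFlux p χ k).Admissible r := by
  have c := h.continuousOn_mul_rho (p := p) hr
  have ck := h.cont.continuousOn (s := Metric.closedBall 0 r)
  have cn : ContinuousOn (fun y : Space N => ‖y‖ ^ 2) (Metric.closedBall 0 r) :=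
    (continuous_norm.pow 2).continuousOn
  exact ⟨continuousOn_const, continuousOn_const,
    (((continuousOn_inv_one_sub_normSq hr).const_mul _).mul c).neg.sub
      ((ck.mul cn).mul (continuousOn_rho hr)), continuousOn_const, continuousOn_const,
    continuousOn_const, (ck.mul continuous_one_sub_normSq.continuousOn).mul (continuousOn_rho hr)⟩

lemma IsCutoff.crossFlux (h : IsCutoff N r χ k) (hr : r < 1) :
    (crossFlux p χ k).Admissible r := by
  have c := h.continuousOn_mul_rho (p := p) hr
  have ck := h.cont.continuousOn (s := Metric.closedBall 0 r)
  have cn : ContinuousOn (fun y : Space N => ‖y‖ ^ 2) (Metric.closedBall 0 r) :=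
    (continuous_norm.pow 2).continuousOn
  exact ⟨c.const_mul _, ((continuousOn_const.sub ((continuousOn_inv_one_sub_normSq hr).const_mul
      _)).mul c).sub (((ck.mul cn).mul (continuousOn_rho hr)).const_mul _), c, c.neg, c,
    (ck.mul continuous_one_sub_normSq.continuousOn).mul (continuousOn_rho hr), c.const_mul _⟩

end Admissible

/-- Reduces an identity between eight integrals to a pointwise algebraic identity. In the
applications the right-hand side vanishes by the weak identities for the increments. -/
lemma integral_combination {μ : Measure (Space N)} {f1 f2 f3 f4 f5 f6 f7 f8 : Space N → ℝ}
    (i1 : Integrable f1 μ) (i2 : Integrable f2 μ) (i3 : Integrable f3 μ) (i4 : Integrable f4 μ)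
    (i5 : Integrable f5 μ) (i6 : Integrable f6 μ) (i7 : Integrable f7 μ) (i8 : Integrable f8 μ)
    (h : ∀ᵐ y ∂μ, f1 y + f2 y - f3 y - f4 y = f5 y - f6 y + 2 * f7 y + f8 y) :
    ∫ y, f1 y ∂μ + ∫ y, f2 y ∂μ - ∫ y, f3 y ∂μ - ∫ y, f4 y ∂μ
      = ∫ y, f5 y ∂μ - ∫ y, f6 y ∂μ + 2 * ∫ y, f7 y ∂μ + ∫ y, f8 y ∂μ := by
  have e1 := integral_sub ((i1.add i2).sub i3) i4
  have e2 := integral_add ((i5.sub i6).add (i7.const_mul 2)) i8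
  rw [integral_sub' (i1.add i2) i3, integral_add' i1 i2] at e1
  rw [integral_add' (i5.sub i6) (i7.const_mul 2), integral_sub' i5 i6, integral_const_mul] at e2
  rw [← e1, ← e2]
  exact integral_congr_ae h

section Solution

variable {f g : ℝ → ℝ} {w : ℝ → Space N → ℝ} {G : ℝ → Space N → Space N}
  {ws : ℝ → Space N → ℝ} {χ k : Space N → ℝ}

/-- Testing the increment of the equation with the increment of `w`. -/
theorem energy_increment (hα : 0 < alpha N p) (hr0 : 0 < r) (hr : r < 1)
    (hp : 1 < p) (hf : Continuous f) (hg : Continuous g)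
    (sol : IsSolution N p f g s₀ w G ws) (hχ : IsCutoff N r χ k) {a b : ℝ} (ha : s₀ ≤ a)
    (hab : a ≤ b) :
    formCLM (energyCoeff p χ) (hχ.energyCoeff hr) hr.le
        (path hα hr0 hr sol.continuousInH b - path hα hr0 hr sol.continuousInH a)
        (∫ t in a..b, path hα hr0 hr sol.continuousInH t)
      + formCLM (energyCoeff p χ) (hχ.energyCoeff hr) hr.le
        (∫ t in a..b, path hα hr0 hr sol.continuousInH t)
        (path hα hr0 hr sol.continuousInH b - path hα hr0 hr sol.continuousInH a)
      = formCLM (energyFlux p χ k) (hχ.energyFlux hr) hr.le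
        (∫ t in a..b, path hα hr0 hr sol.continuousInH t)
        (∫ t in a..b, path hα hr0 hr sol.continuousInH t)
      + formCLM (crossCoeff p χ) (hχ.crossCoeff hr) hr.le
        (∫ t in a..b, sourcePath p r s₀ f g w G ws t)
        (∫ t in a..b, path hα hr0 hr sol.continuousInH t) := by
  have hPQ := fun φ => integral_incrP_mul hα hr0 hr hp hf hg sol ha hab (φ := φ)
  have hinc := fst_increment hα hr0 hr sol ha hab
  have hgrad := (isGrad_path hα hr0 hr sol.continuousInH b).sub
    (isGrad_path hα hr0 hr sol.continuousInH a)
  generalize path hα hr0 hr sol.continuousInH b - path hα hr0 hr sol.continuousInH a = dx at *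
  generalize (∫ t in a..b, path hα hr0 hr sol.continuousInH t) = x at *
  generalize (∫ t in a..b, sourcePath p r s₀ f g w G ws t) = σ at *
  have mdx := Lp.memLp dx
  have mx := Lp.memLp x
  have cχ := hχ.test.smooth.continuous.continuousOn (s := Metric.closedBall 0 r)
  have cgχ := (continuous_gradient hχ.test.smooth).continuousOn (s := Metric.closedBall 0 r)
  have cχρ := hχ.continuousOn_mul_rho (p := p) hr
  have hd := continuousOn_inv_one_sub_normSq (N := N) hr
  have cy := (continuous_id (X := Space N)).continuousOn (s := Metric.closedBall (0 : Space N) r)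
  have cn : ContinuousOn (fun y : Space N => ‖y‖ ^ 2) (Metric.closedBall 0 r) :=
    (continuous_norm.pow 2).continuousOn
  -- The test function is `χ` times the increment of `w`, which by `hinc` equals the time integral
  -- of `w_s`. This is the averaged form of testing with `χ w_s`.
  have d1 := integral_mul_eq_integral_inner_of_hasGradOn (memLp_incrP hr dx x σ)
    (memLp_incrQ hr x) mdx.fst mdx.snd.snd hPQ hgrad hχ.test
  -- The flux contributes `2 χ ρ v y·∇v`, where `v` is the increment of `w`. The radial identity
  -- removes it, and here the damping becomes `-2α/(1-|y|²)`.
  have d2 := hχ.integral_radial hp hr hgrad mdx.fst mdx.snd.snd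
  have i5 : Integrable (fun y => incrP p dx x σ y * (χ y * (dx y).1)) (mu N r) :=
    (memLp_incrP hr dx x σ).integrable_mul (memLp_mul_continuous cχ mdx.fst)
  have i6 : Integrable (fun y => ⟪incrQ p x y, χ y • (dx y).2.2 + (dx y).1 • gradient χ y⟫)
      (mu N r) := by
    have m := (memLp_mul_continuous cχ mdx.snd.snd).add (memLp_smul_continuous cgχ mdx.fst)
    exact ((memLp_incrQ (p := p) hr x).norm.integrable_mul m.norm).mono'
      ((memLp_incrQ (p := p) hr x).1.inner (𝕜 := ℝ) m.1)
      (ae_of_all _ fun y => norm_inner_le_norm _ _)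
  have i7 : Integrable (fun y => χ y * rho N p y * ((dx y).1 * ⟪y, (dx y).2.2⟫)) (mu N r) := by
    refine ((memLp_mul_continuous cχρ mdx.fst).integrable_mul
      (memLp_inner_continuous cy mdx.snd.snd)).congr (ae_of_all _ fun y => ?_)
    simp [mul_assoc]
  have i8 : Integrable (fun y => rho N p y * (χ y * ((p + 3) / (p - 1)
      - 2 * alpha N p / (1 - ‖y‖ ^ 2)) - k y * ‖y‖ ^ 2) * (dx y).1 ^ 2) (mu N r) := by
    have c : ContinuousOn (fun y => rho N p y * (χ y * ((p + 3) / (p - 1)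
      - 2 * alpha N p * (1 - ‖y‖ ^ 2)⁻¹) - k y * ‖y‖ ^ 2)) (Metric.closedBall (0 : Space N) r) :=
      (continuousOn_rho hr).mul ((cχ.mul (continuousOn_const.sub (hd.const_mul _))).sub
        (hχ.cont.continuousOn.mul cn))
    refine ((memLp_mul_continuous c mdx.fst).integrable_mul mdx.fst).congr
      (ae_of_all _ fun y => ?_)
    simp only [smul_eq_mul, Pi.mul_apply, div_eq_mul_inv]; ring
  have key := integral_combination
    ((hχ.energyCoeff (p := p) hr).integrable hr.le mdx mx)
    ((hχ.energyCoeff (p := p) hr).integrable hr.le mx mdx)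
    ((hχ.energyFlux (p := p) hr).integrable hr.le mx mx)
    ((hχ.crossCoeff (p := p) hr).integrable hr.le (Lp.memLp σ) mx) i5 i6 i7 i8 (by
      filter_upwards [hinc, ae_restrict_mem Metric.isOpen_ball.measurableSet] with y hy hyr
      have hdy := (one_sub_normSq_pos (ball_subset_unitBall hr.le hyr)).ne'
      simp only [PerturbedWave.energyCoeff, PerturbedWave.energyFlux, PerturbedWave.crossCoeff,
        Coeff.eval, incrP, incrQ, hχ.grad, hy, real_inner_smul_left, inner_add_left,
        inner_add_right, inner_sub_left, inner_neg_left, inner_neg_right, inner_sub_right,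
        real_inner_smul_right,
        real_inner_self_eq_norm_sq, real_inner_comm y, real_inner_comm (dx y).2.2 (x y).2.2]
      field_simp
      ring)
  simp only [formCLM_apply]
  linarith

/-- Testing the increment of the equation with the time integral of `w`. -/
theorem cross_increment (hα : 0 < alpha N p) (hr0 : 0 < r) (hr : r < 1)
    (hp : 1 < p) (hf : Continuous f) (hg : Continuous g)
    (sol : IsSolution N p f g s₀ w G ws) (hχ : IsCutoff N r χ k) {a b : ℝ} (ha : s₀ ≤ a)
    (hab : a ≤ b) :
    formCLM (crossCoeff p χ) (hχ.crossCoeff hr) hr.le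
        (path hα hr0 hr sol.continuousInH b - path hα hr0 hr sol.continuousInH a)
        (∫ t in a..b, path hα hr0 hr sol.continuousInH t)
      + formCLM (crossCoeff p χ) (hχ.crossCoeff hr) hr.le
        (∫ t in a..b, path hα hr0 hr sol.continuousInH t)
        (path hα hr0 hr sol.continuousInH b - path hα hr0 hr sol.continuousInH a)
      = formCLM (crossFlux p χ k) (hχ.crossFlux hr) hr.le
        (∫ t in a..b, path hα hr0 hr sol.continuousInH t)
        (∫ t in a..b, path hα hr0 hr sol.continuousInH t)
      + formCLM (massCoeff p χ) (hχ.massCoeff hr) hr.le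
        (∫ t in a..b, sourcePath p r s₀ f g w G ws t)
        (∫ t in a..b, path hα hr0 hr sol.continuousInH t) := by
  have hPQ := fun φ => integral_incrP_mul hα hr0 hr hp hf hg sol ha hab (φ := φ)
  have hinc := fst_increment hα hr0 hr sol ha hab
  have hgrad := IsGrad.intervalIntegral (continuous_path hα hr0 hr sol.continuousInH)
    (isGrad_path hα hr0 hr sol.continuousInH) a b
  generalize path hα hr0 hr sol.continuousInH b - path hα hr0 hr sol.continuousInH a = dx at *
  generalize (∫ t in a..b, path hα hr0 hr sol.continuousInH t) = x at *
  generalize (∫ t in a..b, sourcePath p r s₀ f g w G ws t) = σ at *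
  have mdx := Lp.memLp dx
  have mx := Lp.memLp x
  have cχ := hχ.test.smooth.continuous.continuousOn (s := Metric.closedBall 0 r)
  have cgχ := (continuous_gradient hχ.test.smooth).continuousOn (s := Metric.closedBall 0 r)
  -- The test function is now `χ` times the time integral of `w`. The product of `w_s` and `y·∇w`
  -- stays in the flux, so no radial identity is needed.
  have d1 := integral_mul_eq_integral_inner_of_hasGradOn (memLp_incrP hr dx x σ)
    (memLp_incrQ hr x) mx.fst mx.snd.snd hPQ hgrad hχ.test
  have i5 : Integrable (fun y => incrP p dx x σ y * (χ y * (x y).1)) (mu N r) :=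
    (memLp_incrP hr dx x σ).integrable_mul (memLp_mul_continuous cχ mx.fst)
  have i6 : Integrable (fun y => ⟪incrQ p x y, χ y • (x y).2.2 + (x y).1 • gradient χ y⟫)
      (mu N r) := by
    have m := (memLp_mul_continuous cχ mx.snd.snd).add (memLp_smul_continuous cgχ mx.fst)
    exact ((memLp_incrQ (p := p) hr x).norm.integrable_mul m.norm).mono'
      ((memLp_incrQ (p := p) hr x).1.inner (𝕜 := ℝ) m.1)
      (ae_of_all _ fun y => norm_inner_le_norm _ _)
  have i0 : Integrable (fun _ : Space N => (0 : ℝ)) (mu N r) := integrable_zero _ _ _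
  have key := integral_combination
    ((hχ.crossCoeff (p := p) hr).integrable hr.le mdx mx)
    ((hχ.crossCoeff (p := p) hr).integrable hr.le mx mdx)
    ((hχ.crossFlux (p := p) hr).integrable hr.le mx mx)
    ((hχ.massCoeff (p := p) hr).integrable hr.le (Lp.memLp σ) mx) i5 i6 i0 i0 (by
      filter_upwards [hinc, ae_restrict_mem Metric.isOpen_ball.measurableSet] with y hy hyr
      have hdy := (one_sub_normSq_pos (ball_subset_unitBall hr.le hyr)).ne'
      simp only [PerturbedWave.crossFlux, PerturbedWave.massCoeff, PerturbedWave.crossCoeff,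
        Coeff.eval, incrP, incrQ, hχ.grad, hy, real_inner_smul_left, inner_add_left,
        inner_add_right, inner_sub_left, inner_neg_left, inner_neg_right, inner_sub_right,
        real_inner_smul_right,
        real_inner_self_eq_norm_sq, real_inner_comm y]
      field_simp
      ring)
  simp only [formCLM_apply]
  simp only [integral_zero, mul_zero, add_zero] at key
  linarith

end Solution

end

/-! ### Calculus of absolutely continuous functions of time. -/

section

/-- `Z` is an indefinite integral of `z` on `[a, b]`. -/
structure IsPrimitiveOn (a b : ℝ) (Z z : ℝ → ℝ) : Prop where
  integrable : IntervalIntegrable z volume a b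
  eq : ∀ t ∈ Icc a b, Z t = Z a + ∫ τ in a..t, z τ

namespace IsPrimitiveOn

variable {a b : ℝ} {Z Z' z z' : ℝ → ℝ}

lemma sub_eq (h : IsPrimitiveOn a b Z z) (hab : a ≤ b) : Z b - Z a = ∫ τ in a..b, z τ := by
  rw [h.eq b ⟨hab, le_rfl⟩]; ring

lemma integrable_sub (h : IsPrimitiveOn a b Z z) {t : ℝ} (ht : t ∈ Icc a b) :
    IntervalIntegrable z volume a t :=
  h.integrable.mono_set (by
    rw [uIcc_of_le ht.1, uIcc_of_le (ht.1.trans ht.2)]; exact Icc_subset_Icc_right ht.2)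

lemma add (h : IsPrimitiveOn a b Z z) (h' : IsPrimitiveOn a b Z' z') :
    IsPrimitiveOn a b (fun t => Z t + Z' t) fun t => z t + z' t where
  integrable := h.integrable.add h'.integrable
  eq t ht := by
    rw [h.eq t ht, h'.eq t ht, intervalIntegral.integral_add (h.integrable_sub ht)
      (h'.integrable_sub ht)]
    ring

lemma const_mul (h : IsPrimitiveOn a b Z z) (c : ℝ) :
    IsPrimitiveOn a b (fun t => c * Z t) fun t => c * z t where
  integrable := h.integrable.const_mul c
  eq t ht := by
    rw [h.eq t ht, intervalIntegral.integral_const_mul]; ring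

lemma congr (h : IsPrimitiveOn a b Z z) (hab : a ≤ b) (hZ : ∀ t ∈ Icc a b, Z' t = Z t)
    (hz : ∀ᵐ t ∂(volume.restrict (Ioc a b)), z' t = z t) : IsPrimitiveOn a b Z' z' where
  integrable := by
    refine h.integrable.congr_ae ?_
    rw [uIoc_of_le hab]
    exact hz.mono fun _ => Eq.symm
  eq t ht := by
    rw [hZ t ht, hZ a ⟨le_rfl, hab⟩, h.eq t ht]
    congr 1
    refine intervalIntegral.integral_congr_ae ?_
    rw [uIoc_of_le ht.1]
    refine (ae_restrict_iff' measurableSet_Ioc).1 ?_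
    exact (ae_restrict_of_ae_restrict_of_subset (Ioc_subset_Ioc_right ht.2) hz).mono
      fun _ => Eq.symm

lemma of_absolutelyContinuous (hab : a ≤ b) (hZ : AbsolutelyContinuousOnInterval Z a b)
    (hz : ∀ᵐ t, t ∈ uIcc a b → deriv Z t = z t) : IsPrimitiveOn a b Z z := by
  have h0 : IsPrimitiveOn a b Z (deriv Z) := by
    refine ⟨hZ.intervalIntegrable_deriv, fun t ht => ?_⟩
    rw [(hZ.mono (c := a) (d := t) ?_).integral_deriv_eq_sub]
    · ring
    · rw [uIcc_of_le ht.1, uIcc_of_le hab]; exact Icc_subset_Icc_right ht.2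
  refine h0.congr hab (fun _ _ => rfl) ?_
  rw [ae_restrict_iff' measurableSet_Ioc]
  filter_upwards [hz] with t ht htab
  exact (ht (by rw [uIcc_of_le hab]; exact Ioc_subset_Icc_self htab)).symm

/-- Since `Z` is prescribed on `[a, b]` only, it is replaced by the indefinite integral itself,
which is differentiable almost everywhere with derivative `z` by Lebesgue's theorem. -/
lemma exists_absolutelyContinuous (h : IsPrimitiveOn a b Z z) :
    ∃ Y, AbsolutelyContinuousOnInterval Y a b ∧ (∀ t ∈ Icc a b, Z t = Y t) ∧
      ∀ᵐ t, t ∈ uIcc a b → HasDerivAt Y (z t) t := by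
  refine ⟨fun t => Z a + ∫ τ in a..t, z τ, ?_, h.eq, ?_⟩
  · exact (contDiff_const (c := Z a)).contDiffOn.absolutelyContinuousOnInterval.fun_add
      (h.integrable.absolutelyContinuousOnInterval_intervalIntegral left_mem_uIcc)
  · filter_upwards [h.integrable.ae_hasDerivAt_integral] with t ht htab
    exact (ht htab a left_mem_uIcc).const_add _

/-- The range of `Y` is bounded, and a continuously differentiable function is Lipschitz on a
compact interval. -/
lemma comp_absolutelyContinuous {ψ Y : ℝ → ℝ} (hψ : ContDiff ℝ 1 ψ)
    (hY : AbsolutelyContinuousOnInterval Y a b) :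
    AbsolutelyContinuousOnInterval (fun t => ψ (Y t)) a b := by
  obtain ⟨C, hC⟩ := hY.exists_bound
  obtain ⟨K, hK⟩ := hψ.contDiffOn.exists_lipschitzOnWith (s := Icc (-C) C) (by simp)
    (convex_Icc _ _) isCompact_Icc
  have hmem : ∀ t ∈ uIcc a b, Y t ∈ Icc (-C) C := fun t ht => abs_le.1 (hC t ht)
  rw [absolutelyContinuousOnInterval_iff] at hY ⊢
  intro ε hε
  obtain ⟨δ, hδ, h⟩ := hY (ε / (K + 1)) (by positivity)
  refine ⟨δ, hδ, fun E hE hEδ => ?_⟩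
  have h1 := h E hE hEδ
  calc ∑ i ∈ Finset.range E.1, dist (ψ (Y (E.2 i).1)) (ψ (Y (E.2 i).2))
      ≤ ∑ i ∈ Finset.range E.1, K * dist (Y (E.2 i).1) (Y (E.2 i).2) :=
        Finset.sum_le_sum fun i hi => hK.dist_le_mul _ (hmem _ (hE.left i hi).left) _
          (hmem _ (hE.left i hi).right)
    _ = K * ∑ i ∈ Finset.range E.1, dist (Y (E.2 i).1) (Y (E.2 i).2) := (Finset.mul_sum _ _ _).symm
    _ ≤ K * (ε / (K + 1)) := by gcongr
    _ < (K + 1) * (ε / (K + 1)) := by gcongr; linarith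
    _ = ε := by field

lemma comp (h : IsPrimitiveOn a b Z z) (hab : a ≤ b) {ψ : ℝ → ℝ} (hψ : ContDiff ℝ 1 ψ) :
    IsPrimitiveOn a b (fun t => ψ (Z t)) fun t => deriv ψ (Z t) * z t := by
  obtain ⟨Y, hY, hZY, hd⟩ := h.exists_absolutelyContinuous
  have h1 : IsPrimitiveOn a b (fun t => ψ (Y t)) fun t => deriv ψ (Y t) * z t := by
    refine of_absolutelyContinuous hab (comp_absolutelyContinuous hψ hY) ?_
    filter_upwards [hd] with t ht htab
    exact (((hψ.differentiable (by simp) (Y t)).hasDerivAt).comp t (ht htab)).deriv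
  refine h1.congr hab (fun t ht => by rw [hZY t ht]) ?_
  filter_upwards [ae_restrict_mem measurableSet_Ioc] with t ht
  rw [hZY t (Ioc_subset_Icc_self ht)]

lemma smooth_mul (h : IsPrimitiveOn a b Z z) (hab : a ≤ b) {m m' : ℝ → ℝ}
    (hm : ∀ t, HasDerivAt m (m' t) t) (hm' : Continuous m') :
    IsPrimitiveOn a b (fun t => m t * Z t) fun t => m' t * Z t + m t * z t := by
  obtain ⟨Y, hY, hZY, hd⟩ := h.exists_absolutelyContinuous
  have hmd : deriv m = m' := funext fun t => (hm t).deriv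
  have hmc : ContDiff ℝ 1 m := contDiff_one_iff_deriv.2
    ⟨fun t => (hm t).differentiableAt, hmd ▸ hm'⟩
  obtain ⟨K, hK⟩ := hmc.contDiffOn.exists_lipschitzOnWith (s := uIcc a b) (by simp)
    (convex_uIcc _ _) isCompact_uIcc
  have h1 : IsPrimitiveOn a b (fun t => m t * Y t) fun t => m' t * Y t + m t * z t := by
    refine of_absolutelyContinuous hab (hK.absolutelyContinuousOnInterval.fun_mul hY) ?_
    filter_upwards [hd] with t ht htab
    exact ((hm t).mul (ht htab)).deriv
  refine h1.congr hab (fun t ht => by rw [hZY t ht]) ?_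
  filter_upwards [ae_restrict_mem measurableSet_Ioc] with t ht
  rw [hZY t (Ioc_subset_Icc_self ht)]

lemma of_hasDerivAt {m m' : ℝ → ℝ} (hm : ∀ t, HasDerivAt m (m' t) t) (hm' : Continuous m') :
    IsPrimitiveOn a b m m' where
  integrable := hm'.intervalIntegrable _ _
  eq t _ := by
    rw [intervalIntegral.integral_eq_sub_of_hasDerivAt (fun x _ => hm x)
      (hm'.intervalIntegrable _ _)]
    ring

end IsPrimitiveOn

variable {N : ℕ} {p r s₀ : ℝ}

section Solution

variable {f g : ℝ → ℝ} {w : ℝ → Space N → ℝ} {G : ℝ → Space N → Space N}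
  {ws : ℝ → Space N → ℝ} {χ k : Space N → ℝ}

/-- The state `(w, w_s, ∇w)` of a solution at a point. -/
abbrev stateAt (w : ℝ → Space N → ℝ) (G : ℝ → Space N → Space N) (ws : ℝ → Space N → ℝ) (t : ℝ)
    (y : Space N) : State N := (w t y, ws t y, G t y)

lemma memLp_stateAt (hα : 0 < alpha N p) (hr0 : 0 < r) (hr : r < 1)
    (h : ContinuousInH N p s₀ w G ws) {t : ℝ} (ht : s₀ ≤ t) :
    MemLp (stateAt w G ws t) 2 (mu N r) := (h.mem t ht).memLp hα hr0 hr

lemma formCLM_path (hα : 0 < alpha N p) (hr0 : 0 < r) (hr : r < 1)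
    (h : ContinuousInH N p s₀ w G ws) {c : Coeff N} (hc : c.Admissible r) {t : ℝ} (ht : s₀ ≤ t) :
    formCLM c hc hr.le (path hα hr0 hr h t) (path hα hr0 hr h t)
      = ∫ y, c.eval y (stateAt w G ws t y) (stateAt w G ws t y) ∂(mu N r) := by
  rw [formCLM_apply]
  refine integral_congr_ae ?_
  filter_upwards [path_ae_eq hα hr0 hr h ht] with y hy
  rw [hy]

lemma formCLM_sourcePath (hα : 0 < alpha N p) (hr0 : 0 < r) (hr : r < 1)
    (h : ContinuousInH N p s₀ w G ws) {c : Coeff N} (hc : c.Admissible r) {t : ℝ} (ht : s₀ ≤ t)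
    (hm : MemLp (source p f g w G ws t) 2 (mu N r)) :
    formCLM c hc hr.le (sourcePath p r s₀ f g w G ws t) (path hα hr0 hr h t)
      = ∫ y, c.eval y (source p f g w G ws t y, 0, 0) (stateAt w G ws t y) ∂(mu N r) := by
  rw [formCLM_apply]
  refine integral_congr_ae ?_
  filter_upwards [path_ae_eq hα hr0 hr h ht, sourcePath_ae_eq ht hm] with y hy hy'
  rw [hy, hy']

lemma intervalIntegrable_bilinear {V : Type*} [NormedAddCommGroup V] [NormedSpace ℝ V]
    {X S : ℝ → V} (hX : Continuous X) {a b : ℝ} (hS : IntervalIntegrable S volume a b)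
    (π : V →L[ℝ] V →L[ℝ] ℝ) : IntervalIntegrable (fun t => π (S t) (X t)) volume a b := by
  obtain ⟨C, hC⟩ := (isCompact_uIcc (a := a) (b := b)).exists_bound_of_continuousOn hX.continuousOn
  rw [intervalIntegrable_iff] at *
  refine (hS.norm.const_mul (‖π‖ * C)).mono' (π.aestronglyMeasurable_comp₂ hS.1
    hX.aestronglyMeasurable) ?_
  filter_upwards [ae_restrict_mem measurableSet_uIoc] with t ht
  refine (π.le_opNorm₂ _ _).trans ?_
  have h1 : ‖π‖ * ‖S t‖ * ‖X t‖ ≤ ‖π‖ * ‖S t‖ * C := by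
    gcongr; exact hC t (uIoc_subset_uIcc ht)
  linarith

/-- A quadratic functional of the solution whose increments are known is a primitive. -/
lemma isPrimitiveOn_form (hα : 0 < alpha N p) (hr0 : 0 < r) (hr : r < 1)
    (hf : Continuous f) (hg : Continuous g)
    (sol : IsSolution N p f g s₀ w G ws) {q B π : Coeff N} (hq : q.Admissible r)
    (hB : B.Admissible r) (hπ : π.Admissible r)
    (hid : ∀ s h, s₀ ≤ s → 0 < h →
      formCLM q hq hr.le
        (path hα hr0 hr sol.continuousInH (s + h) - path hα hr0 hr sol.continuousInH s)
        (∫ t in s..s + h, path hα hr0 hr sol.continuousInH t)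
      + formCLM q hq hr.le (∫ t in s..s + h, path hα hr0 hr sol.continuousInH t)
        (path hα hr0 hr sol.continuousInH (s + h) - path hα hr0 hr sol.continuousInH s)
      = formCLM B hB hr.le (∫ t in s..s + h, path hα hr0 hr sol.continuousInH t)
        (∫ t in s..s + h, path hα hr0 hr sol.continuousInH t)
      + formCLM π hπ hr.le (∫ t in s..s + h, sourcePath p r s₀ f g w G ws t)
        (∫ t in s..s + h, path hα hr0 hr sol.continuousInH t))
    {a b : ℝ} (ha : s₀ ≤ a) (hab : a ≤ b) :
    IsPrimitiveOn a b (fun t => ∫ y, q.eval y (stateAt w G ws t y) (stateAt w G ws t y) ∂(mu N r))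
      fun t => ∫ y, (B.eval y (stateAt w G ws t y) (stateAt w G ws t y)
        + π.eval y (source p f g w G ws t y, 0, 0) (stateAt w G ws t y)) ∂(mu N r) := by
  set X := path hα hr0 hr sol.continuousInH with hXdef
  set S := sourcePath p r s₀ f g w G ws with hSdef
  have hX : Continuous X := continuous_path hα hr0 hr sol.continuousInH
  have hS : ∀ a b, IntervalIntegrable S volume a b :=
    intervalIntegrable_sourcePath hα hr0 hr hf hg sol
  have iB : ∀ a b, IntervalIntegrable (fun t => formCLM B hB hr.le (X t) (X t)) volume a b :=
    fun a b => intervalIntegrable_bilinear hX (hX.intervalIntegrable _ _) _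
  have iS : ∀ a b, IntervalIntegrable (fun t => formCLM π hπ hr.le (S t) (X t)) volume a b :=
    fun a b => intervalIntegrable_bilinear hX (hS _ _) _
  have h0 : IsPrimitiveOn a b (fun t => formCLM q hq hr.le (X t) (X t))
      fun t => formCLM B hB hr.le (X t) (X t) + formCLM π hπ hr.le (S t) (X t) := by
    refine ⟨(iB a b).add (iS a b), fun t ht => ?_⟩
    have := energy_identity_of_increments hX hS _ _ _ hid ha ht.1
    rw [intervalIntegral.integral_add (iB a t) (iS a t)]
    linarith
  refine h0.congr hab (fun t ht => (formCLM_path hα hr0 hr sol.continuousInH hq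
    (ha.trans ht.1)).symm) ?_
  have h1 := ae_restrict_of_ae_restrict_of_subset
      (Ioc_subset_Icc_self.trans (Icc_subset_Icc_left ha) : Ioc a b ⊆ Icc s₀ b)
      (ae_memLp_source hα hr0 hr hf hg sol b)
  filter_upwards [h1, ae_restrict_mem measurableSet_Ioc] with t hm ht
  have hst : s₀ ≤ t := ha.trans ht.1.le
  have hu := memLp_stateAt hα hr0 hr sol.continuousInH hst
  rw [formCLM_path hα hr0 hr sol.continuousInH hB hst,
    formCLM_sourcePath hα hr0 hr sol.continuousInH hπ hst hm,
    integral_add (hB.integrable hr.le hu hu) (hπ.integrable hr.le (memLp_inl hm) hu)]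

/-- The limiting form of `energy_increment`. The pairing of the source with `w_s` still contains the
derivative of the potential, which is split off through `isPrimitiveOn_potential`. -/
theorem isPrimitiveOn_energy (hα : 0 < alpha N p) (hr0 : 0 < r) (hr : r < 1)
    (hp : 1 < p) (hf : Continuous f) (hg : Continuous g)
    (sol : IsSolution N p f g s₀ w G ws) (hχ : IsCutoff N r χ k)
    {a b : ℝ} (ha : s₀ ≤ a) (hab : a ≤ b) :
    IsPrimitiveOn a b (fun t => ∫ y, (energyCoeff p χ).eval y (stateAt w G ws t y)
        (stateAt w G ws t y) ∂(mu N r))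
      fun t => ∫ y, ((energyFlux p χ k).eval y (stateAt w G ws t y) (stateAt w G ws t y)
        + (crossCoeff p χ).eval y (source p f g w G ws t y, 0, 0) (stateAt w G ws t y))
          ∂(mu N r) :=
  isPrimitiveOn_form hα hr0 hr hf hg sol (hχ.energyCoeff hr) (hχ.energyFlux hr) (hχ.crossCoeff hr)
    (fun _ _ hs hh => energy_increment hα hr0 hr hp hf hg sol hχ hs (by linarith)) ha hab

theorem isPrimitiveOn_cross (hα : 0 < alpha N p) (hr0 : 0 < r) (hr : r < 1)
    (hp : 1 < p) (hf : Continuous f) (hg : Continuous g)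
    (sol : IsSolution N p f g s₀ w G ws) (hχ : IsCutoff N r χ k)
    {a b : ℝ} (ha : s₀ ≤ a) (hab : a ≤ b) :
    IsPrimitiveOn a b (fun t => ∫ y, (crossCoeff p χ).eval y (stateAt w G ws t y)
        (stateAt w G ws t y) ∂(mu N r))
      fun t => ∫ y, ((crossFlux p χ k).eval y (stateAt w G ws t y) (stateAt w G ws t y)
        + (massCoeff p χ).eval y (source p f g w G ws t y, 0, 0) (stateAt w G ws t y))
          ∂(mu N r) :=
  isPrimitiveOn_form hα hr0 hr hf hg sol (hχ.crossCoeff hr) (hχ.crossFlux hr) (hχ.massCoeff hr)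
    (fun _ _ hs hh => cross_increment hα hr0 hr hp hf hg sol hχ hs (by linarith)) ha hab

end Solution

end

/-! ### Joint integrability, and absolute continuity of `w` at almost every point. -/

section

section Product

variable {α F F' : Type*} [MeasurableSpace α] {μ : Measure α}
  [NormedAddCommGroup F] [NormedAddCommGroup F']

lemma integral_norm_mul_norm_le (u : Lp F 2 μ) (z : Lp F' 2 μ) :
    ∫ y, ‖u y‖ * ‖z y‖ ∂μ ≤ ‖u‖ * ‖z‖ := by
  have hu := (Lp.memLp u).norm
  have hz := (Lp.memLp z).norm
  have e1 : ‖hu.toLp _‖ = ‖u‖ := by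
    rw [Lp.norm_toLp, eLpNorm_norm, Lp.norm_def]
  have e2 : ‖hz.toLp _‖ = ‖z‖ := by
    rw [Lp.norm_toLp, eLpNorm_norm, Lp.norm_def]
  rw [← e1, ← e2]
  refine le_trans (le_of_eq ?_) (real_inner_le_norm _ _)
  rw [L2.inner_def]
  refine integral_congr_ae ?_
  filter_upwards [hu.coeFn_toLp, hz.coeFn_toLp] with y h3 h4
  rw [h3, h4]; simp [mul_comm]

/-- Joint integrability of a product of two paths in `L²`. -/
lemma integrable_prod_mul [SFinite μ] [MeasurableSpace F] [BorelSpace F]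
    [SecondCountableTopology F] [MeasurableSpace F'] [BorelSpace F'] [SecondCountableTopology F']
    {σ : Measure ℝ} [SFinite σ] {A : ℝ → Lp F 2 μ} {X : ℝ → Lp F' 2 μ} {A' : ℝ × α → F}
    {X' : ℝ × α → F'} (mA : Measurable A') (mX : Measurable X')
    (hA : ∀ᵐ t ∂σ, A t =ᵐ[μ] fun y => A' (t, y)) (hX : ∀ᵐ t ∂σ, X t =ᵐ[μ] fun y => X' (t, y))
    (hint : Integrable (fun t => ‖A t‖ * ‖X t‖) σ) :
    Integrable (fun q => ‖A' q‖ * ‖X' q‖) (σ.prod μ) := by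
  have hm : AEStronglyMeasurable (fun q => ‖A' q‖ * ‖X' q‖) (σ.prod μ) :=
    (mA.norm.mul mX.norm).aestronglyMeasurable
  have hi : ∀ u : Lp F 2 μ, ∀ z : Lp F' 2 μ, Integrable (fun y => ‖u y‖ * ‖z y‖) μ := fun u z =>
    (Lp.memLp u).norm.integrable_mul (Lp.memLp z).norm
  refine (integrable_prod_iff hm).2 ⟨?_, hint.mono' hm.norm.integral_prod_right' ?_⟩
  · filter_upwards [hA, hX] with t h1 h2
    refine (hi (A t) (X t)).congr ?_
    filter_upwards [h1, h2] with y h3 h4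
    rw [h3, h4]
  · filter_upwards [hA, hX] with t h1 h2
    rw [Real.norm_of_nonneg (integral_nonneg fun y => norm_nonneg _)]
    refine le_trans (le_of_eq ?_) (integral_norm_mul_norm_le (A t) (X t))
    refine integral_congr_ae ?_
    filter_upwards [h1, h2] with y h3 h4
    rw [h3, h4, Real.norm_of_nonneg (by positivity)]

lemma integrable_restrict_prod [SFinite μ] {a b t : ℝ} (ht : t ≤ b) {h : ℝ × α → ℝ}
    (hh : Integrable h ((volume.restrict (Ioc a b)).prod μ)) :
    Integrable h ((volume.restrict (Ioc a t)).prod μ) :=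
  hh.mono_measure (Measure.prod_mono (Measure.restrict_mono (Ioc_subset_Ioc_right ht) le_rfl)
    le_rfl)

/-- Differentiation under the integral sign in integrated form. -/
theorem isPrimitiveOn_integral [SFinite μ] {a b : ℝ} (hab : a ≤ b) {Θ h : ℝ × α → ℝ}
    (hh : Integrable h ((volume.restrict (Ioc a b)).prod μ))
    (h0 : Integrable (fun y => Θ (a, y)) μ)
    (hΘ : ∀ᵐ y ∂μ, ∀ t ∈ Icc a b, Θ (t, y) = Θ (a, y) + ∫ τ in a..t, h (τ, y)) :
    IsPrimitiveOn a b (fun t => ∫ y, Θ (t, y) ∂μ) fun t => ∫ y, h (t, y) ∂μ where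
  integrable := (intervalIntegrable_iff_integrableOn_Ioc_of_le hab).2 hh.integral_prod_left
  eq t ht := by
    have h1 := integrable_restrict_prod ht.2 hh
    have h2 : Integrable (fun y => ∫ τ in a..t, h (τ, y)) μ := by
      simp_rw [intervalIntegral.integral_of_le ht.1]
      exact h1.integral_prod_right
    rw [intervalIntegral.integral_of_le ht.1, integral_integral_swap (f := fun τ y => h (τ, y)) h1]
    simp_rw [← intervalIntegral.integral_of_le ht.1]
    rw [← integral_add h0 h2]
    refine integral_congr_ae ?_
    filter_upwards [hΘ] with y hy
    exact hy t ht

end Product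

variable {N : ℕ} {p r s₀ : ℝ}

section Solution

variable {f g : ℝ → ℝ} {w : ℝ → Space N → ℝ} {G : ℝ → Space N → Space N}
  {ws : ℝ → Space N → ℝ} {χ k : Space N → ℝ}

lemma ae_norm_le_one (hr : r ≤ 1) : ∀ᵐ y ∂(mu N r), ‖y‖ ≤ 1 := by
  filter_upwards [ae_restrict_mem Metric.isOpen_ball.measurableSet] with y hy
  exact (mem_ball_zero_iff.1 hy).le.trans hr

lemma integrable_norm_sq_joint (hα : 0 < alpha N p) (hr0 : 0 < r) (hr : r < 1)
    (h : ContinuousInH N p s₀ w G ws) {a b : ℝ} (ha : s₀ ≤ a) {W : ℝ × Space N → State N}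
    (mW : Measurable W) (hW : ∀ t ∈ Icc a b, (fun y => W (t, y)) =ᵐ[mu N r] stateAt w G ws t) :
    Integrable (fun q => ‖W q‖ * ‖W q‖) ((volume.restrict (Ioc a b)).prod (mu N r)) := by
  have hX := continuous_path hα hr0 hr h
  have hae : ∀ᵐ t ∂(volume.restrict (Ioc a b)),
      path hα hr0 hr h t =ᵐ[mu N r] fun y => W (t, y) := by
    filter_upwards [ae_restrict_mem measurableSet_Ioc] with t ht
    exact (path_ae_eq hα hr0 hr h (ha.trans ht.1.le)).trans (hW t (Ioc_subset_Icc_self ht)).symm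
  exact integrable_prod_mul mW mW hae hae
    ((hX.norm.mul hX.norm).integrableOn_Ioc)

/-- The source is integrable in time with values in `L²`, and the state is bounded in `L²` on
compact time intervals. This is where the space-time integrability of the power nonlinearity comes
from. -/
lemma integrable_source_mul_norm_joint (hα : 0 < alpha N p) (hr0 : 0 < r) (hr : r < 1)
    (hf : Continuous f) (hg : Continuous g)
    (sol : IsSolution N p f g s₀ w G ws) {a b : ℝ} (ha : s₀ ≤ a) (hab : a ≤ b)
    {W : ℝ × Space N → State N}
    (mW : Measurable W) (hW : ∀ t ∈ Icc a b, (fun y => W (t, y)) =ᵐ[mu N r] stateAt w G ws t) :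
    Integrable (fun q => |sourceFun p f g q.1 q.2 (W q)| * ‖W q‖)
      ((volume.restrict (Ioc a b)).prod (mu N r)) := by
  have hX := continuous_path hα hr0 hr sol.continuousInH
  have hS := intervalIntegrable_sourcePath hα hr0 hr hf hg sol a b
  have hae : ∀ᵐ t ∂(volume.restrict (Ioc a b)),
      path hα hr0 hr sol.continuousInH t =ᵐ[mu N r] fun y => W (t, y) := by
    filter_upwards [ae_restrict_mem measurableSet_Ioc] with t ht
    exact (path_ae_eq hα hr0 hr _ (ha.trans ht.1.le)).trans (hW t (Ioc_subset_Icc_self ht)).symm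
  have hm : Measurable fun q : ℝ × Space N =>
      ((sourceFun p f g q.1 q.2 (W q), 0, 0) : State N) :=
    ((measurable_sourceFun hf hg).comp
      (measurable_fst.prodMk (measurable_snd.prodMk mW))).prodMk measurable_const
  have haS : ∀ᵐ t ∂(volume.restrict (Ioc a b)), sourcePath p r s₀ f g w G ws t
      =ᵐ[mu N r] fun y => ((sourceFun p f g t y (W (t, y)), 0, 0) : State N) := by
    have h1 := ae_restrict_of_ae_restrict_of_subset
      (Ioc_subset_Icc_self.trans (Icc_subset_Icc_left ha) : Ioc a b ⊆ Icc s₀ b)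
      (ae_memLp_source hα hr0 hr hf hg sol b)
    filter_upwards [h1, ae_restrict_mem measurableSet_Ioc] with t hm ht
    filter_upwards [sourcePath_ae_eq (ha.trans ht.1.le) hm, hW t (Ioc_subset_Icc_self ht)]
      with y h2 h3
    rw [h2, source_eq, h3]
  have hi : Integrable (fun t => ‖sourcePath p r s₀ f g w G ws t‖ *
      ‖path hα hr0 hr sol.continuousInH t‖) (volume.restrict (Ioc a b)) :=
    (intervalIntegrable_iff_integrableOn_Ioc_of_le hab).1
      (hS.norm.mul_continuousOn hX.norm.continuousOn)
  refine (integrable_prod_mul hm mW haS hae hi).congr (ae_of_all _ fun q => ?_)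
  simp [Prod.norm_def]

/-- A joint representative of `w` that is absolutely continuous in time. -/
theorem exists_joint_primitive (hα : 0 < alpha N p) (hr0 : 0 < r) (hr : r < 1)
    (sol : IsSolution N p f g s₀ w G ws) {a b : ℝ} (ha : s₀ ≤ a) (hab : a ≤ b)
    {W : ℝ × Space N → State N}
    (mW : Measurable W) (hW : ∀ t ∈ Icc a b, (fun y => W (t, y)) =ᵐ[mu N r] stateAt w G ws t) :
    ∃ Y : ℝ × Space N → ℝ, Measurable Y ∧ (∀ t ∈ Icc a b, (fun y => Y (t, y)) =ᵐ[mu N r] w t) ∧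
      ∀ᵐ y ∂(mu N r), IsPrimitiveOn a b (fun t => Y (t, y)) fun t => (W (t, y)).2.1 := by
  set V : ℝ × Space N → ℝ := fun q => (W q).2.1 with hV
  have mV : Measurable V := by fun_prop
  have iV : Integrable V ((volume.restrict (Ioc a b)).prod (mu N r)) := by
    refine ((integrable_norm_sq_joint hα hr0 hr sol.continuousInH ha mW hW).add
      (integrable_const (1 : ℝ))).mono' mV.aestronglyMeasurable (ae_of_all _ fun q => ?_)
    have h1 : ‖V q‖ ≤ ‖W q‖ := (norm_fst_le (W q).2).trans (norm_snd_le (W q))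
    simp only [Pi.add_apply]
    nlinarith [norm_nonneg (W q), sq_nonneg (‖W q‖ - 1)]
  -- The given functions `w t` may be altered on null sets that depend on `t`, so time regularity at
  -- a fixed point is meaningless for them. Integrating the joint representative of `w_s` from time
  -- `a` yields a version with that regularity; agreement with `w t` is checked by duality with test
  -- functions.
  set Y : ℝ × Space N → ℝ := fun q => (W (a, q.2)).1
    + ∫ τ, (Ioc a q.1).indicator (fun τ => V (τ, q.2)) τ with hY
  have eY : ∀ t y, a ≤ t → Y (t, y) = (W (a, y)).1 + ∫ τ in a..t, V (τ, y) := fun t y hat => by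
    simp only [hY]
    rw [integral_indicator measurableSet_Ioc, intervalIntegral.integral_of_le hat]
  refine ⟨Y, ?_, fun t ht => ?_, ?_⟩
  · have m1 : Measurable fun q : ℝ × Space N => (W (a, q.2)).1 :=
      (mW.comp (measurable_const.prodMk measurable_snd)).fst
    have m2 : Measurable fun q : (ℝ × Space N) × ℝ =>
        (Ioc a q.1.1).indicator (fun τ => V (τ, q.1.2)) q.2 := by
      have e : (fun q : (ℝ × Space N) × ℝ => (Ioc a q.1.1).indicator (fun τ => V (τ, q.1.2)) q.2)
          = {q : (ℝ × Space N) × ℝ | a < q.2 ∧ q.2 ≤ q.1.1}.indicator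
            fun q => V (q.2, q.1.2) := by
        funext q
        simp only [indicator, mem_Ioc, mem_ofPred_eq]
      rw [e]
      refine Measurable.indicator (mV.comp (measurable_snd.prodMk measurable_fst.snd)) ?_
      exact (measurableSet_lt measurable_const measurable_snd).inter
        (measurableSet_le measurable_snd measurable_fst.fst)
    exact m1.add (m2.stronglyMeasurable.integral_prod_right'
      (f := fun q : (ℝ × Space N) × ℝ =>
        (Ioc a q.1.1).indicator (fun τ => V (τ, q.1.2)) q.2)).measurable
  · have hat : s₀ ≤ t := ha.trans ht.1
    have hwa := (memLp_stateAt hα hr0 hr sol.continuousInH ha).fst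
    have hwt := (memLp_stateAt hα hr0 hr sol.continuousInH hat).fst
    have i1 := integrable_restrict_prod ht.2 iV
    have i2 : Integrable (fun y => ∫ τ in a..t, V (τ, y)) (mu N r) := by
      simp_rw [intervalIntegral.integral_of_le ht.1]
      exact i1.integral_prod_right
    have key : (fun y => w t y - w a y) =ᵐ[mu N r] fun y => ∫ τ in a..t, V (τ, y) := by
      refine ae_eq_of_forall_test ((hwt.sub hwa).integrable (by norm_num)) i2 fun φ hφ => ?_
      have h1 := sol.timeDeriv φ (hφ.isTest hr.le) a t ha ht.1
      rw [integral_unitBall_eq hr.le fun y hy => by simp [hφ.eq_zero hy]] at h1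
      obtain ⟨C, hC⟩ := hφ.compact.exists_bound_of_continuous hφ.smooth.continuous
      have i3 : Integrable (fun q : ℝ × Space N => φ q.2 * V q)
          ((volume.restrict (Ioc a t)).prod (mu N r)) :=
        i1.bdd_mul (hφ.smooth.continuous.comp continuous_snd).aestronglyMeasurable
          (ae_of_all _ fun q => hC q.2)
      calc ∫ y, φ y * (w t y - w a y) ∂(mu N r)
          = ∫ y, (w t y - w a y) * φ y ∂(mu N r) := by simp_rw [mul_comm]
        _ = ∫ τ in a..t, ∫ y in unitBall N, ws τ y * φ y := h1
        _ = ∫ τ in a..t, ∫ y, φ y * V (τ, y) ∂(mu N r) := by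
            refine intervalIntegral.integral_congr fun τ hτ => ?_
            rw [uIcc_of_le ht.1] at hτ
            rw [integral_unitBall_eq hr.le fun y hy => by simp [hφ.eq_zero hy]]
            refine integral_congr_ae ?_
            filter_upwards [hW τ ⟨hτ.1, hτ.2.trans ht.2⟩] with y hy
            simp only [hV, hy]; ring
        _ = ∫ y, (∫ τ in Ioc a t, φ y * V (τ, y)) ∂(mu N r) := by
            rw [intervalIntegral.integral_of_le ht.1,
              integral_integral_swap (f := fun τ y => φ y * V (τ, y)) i3]
        _ = ∫ y, φ y * (∫ τ in a..t, V (τ, y)) ∂(mu N r) := by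
            simp_rw [integral_const_mul, intervalIntegral.integral_of_le ht.1]
    filter_upwards [key, hW a ⟨le_rfl, hab⟩] with y h1 h2
    rw [eY t y ht.1, ← h1, h2]; ring
  · filter_upwards [iV.prod_left_ae] with y hy
    refine ⟨(intervalIntegrable_iff_integrableOn_Ioc_of_le hab).2 hy, fun t ht => ?_⟩
    rw [eY t y ht.1, eY a y le_rfl, intervalIntegral.integral_same, add_zero]

end Solution

end

/-! ### Growth bounds and the chain rule for the nonlinear terms. -/

section

section Bounds

variable {p q M : ℝ}

lemma gam_pos (hp : 1 < p) (hqp : q < p) : 0 < gam p q :=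
  lt_min (by norm_num) (div_pos (by linarith) (by linarith))

lemma gam_le_half : gam p q ≤ 1 / 2 := min_le_left _ _

lemma gam_le : gam p q ≤ (p - q) / (p - 1) := min_le_right _ _

/-- The part of the source that does not involve derivatives. -/
def mainSource (p : ℝ) (f : ℝ → ℝ) (t x : ℝ) : ℝ :=
  |x| ^ (p - 1) * x + Real.exp (-(2 * p * t / (p - 1))) * f (Real.exp (2 * t / (p - 1)) * x)

/-- The potential of `mainSource`. -/
def potential (p : ℝ) (f : ℝ → ℝ) (t x : ℝ) : ℝ :=
  1 / (p + 1) * |x| ^ (p + 1)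
    + Real.exp (-(2 * (p + 1) * t / (p - 1))) * primitive f (Real.exp (2 / (p - 1) * t) * x)

/-- The partial derivative of `potential` in time. -/
def potentialDt (p : ℝ) (f : ℝ → ℝ) (t x : ℝ) : ℝ :=
  -(2 * (p + 1) / (p - 1)) * (Real.exp (-(2 * (p + 1) * t / (p - 1)))
      * primitive f (Real.exp (2 / (p - 1) * t) * x))
    + 2 / (p - 1) * (Real.exp (-(2 * p * t / (p - 1))) * f (Real.exp (2 * t / (p - 1)) * x) * x)

lemma exp_le_exp_gam_sq {c t : ℝ} (ht : 0 ≤ t) (hc : 2 * gam p q ≤ c) :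
    Real.exp (-(c * t)) ≤ Real.exp (-(gam p q * t)) ^ 2 := by
  rw [← Real.exp_nat_mul]
  refine Real.exp_le_exp.2 ?_
  push_cast
  nlinarith

lemma exp_decay_fst (hp : 1 < p) {t : ℝ} (ht : 0 ≤ t) :
    Real.exp (-(2 * p * t / (p - 1))) ≤ Real.exp (-(gam p q * t)) ^ 2 := by
  have h1 : 1 ≤ 2 * p / (p - 1) := by rw [le_div_iff₀ (by linarith)]; linarith
  have := exp_le_exp_gam_sq (p := p) (q := q) ht
    (c := 2 * p / (p - 1)) (by linarith [gam_le_half (p := p) (q := q)])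
  rwa [div_mul_eq_mul_div] at this

/-- The combined exponent is exactly `-2 t (p-q)/(p-1)`; this is the second entry of the minimum
that defines `γ`. -/
lemma exp_decay_snd (hp : 1 < p) {t : ℝ} (ht : 0 ≤ t) :
    Real.exp (-(2 * p * t / (p - 1))) * Real.exp (2 * t / (p - 1)) ^ q
      ≤ Real.exp (-(gam p q * t)) ^ 2 := by
  have h1 : 2 * gam p q ≤ 2 * ((p - q) / (p - 1)) := by linarith [gam_le (p := p) (q := q)]
  refine le_trans (le_of_eq ?_) (exp_le_exp_gam_sq ht h1)
  rw [← Real.exp_mul, ← Real.exp_add]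
  congr 1
  have : p - 1 ≠ 0 := by linarith
  field_simp
  ring

lemma abs_source_term_le (hp : 1 < p) (hM : 0 < M) {f : ℝ → ℝ}
    (hfM : ∀ x, |f x| ≤ M * (1 + |x| ^ q)) {t : ℝ} (ht : 0 ≤ t) (x : ℝ) :
    |Real.exp (-(2 * p * t / (p - 1))) * f (Real.exp (2 * t / (p - 1)) * x)|
      ≤ M * Real.exp (-(gam p q * t)) ^ 2 * (1 + |x| ^ q) := by
  rw [abs_mul, Real.abs_exp]
  have h1 := hfM (Real.exp (2 * t / (p - 1)) * x)
  rw [abs_mul, Real.abs_exp, Real.mul_rpow (Real.exp_pos _).le (abs_nonneg _)] at h1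
  have h2 := exp_decay_fst (q := q) hp ht
  have h3 := exp_decay_snd (q := q) hp ht
  have hx : 0 ≤ |x| ^ q := Real.rpow_nonneg (abs_nonneg _) _
  calc _ ≤ Real.exp (-(2 * p * t / (p - 1))) * (M * (1 + Real.exp (2 * t / (p - 1)) ^ q * |x| ^ q)) := by
        gcongr
    _ = M * (Real.exp (-(2 * p * t / (p - 1))) + Real.exp (-(2 * p * t / (p - 1)))
        * Real.exp (2 * t / (p - 1)) ^ q * |x| ^ q) := by ring
    _ ≤ M * (Real.exp (-(gam p q * t)) ^ 2 + Real.exp (-(gam p q * t)) ^ 2 * |x| ^ q) := by gcongr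
    _ = _ := by ring

lemma abs_primitive_le (hq : 0 ≤ q) {f : ℝ → ℝ}
    (hfM : ∀ x, |f x| ≤ M * (1 + |x| ^ q)) (hM : 0 < M) (u : ℝ) :
    |primitive f u| ≤ M * (1 + |u| ^ q) * |u| := by
  have := intervalIntegral.norm_integral_le_of_norm_le_const (a := 0) (b := u) (f := f)
    (C := M * (1 + |u| ^ q)) fun x hx => by
      refine (hfM x).trans ?_
      have h1 : |x| ≤ |u| := by
        rcases le_total 0 u with h | h
        · rw [uIoc_of_le h] at hx
          rw [abs_of_nonneg hx.1.le, abs_of_nonneg h]; exact hx.2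
        · rw [uIoc_of_ge h] at hx
          rw [abs_of_nonpos hx.2, abs_of_nonpos h]; linarith [hx.1]
      gcongr
  simpa [primitive] using this

/-- The additional factor `|u|` in the bound of the primitive costs `e^{2t/(p-1)}`, which turns the
prefactor of `I` into that of the source `f`. -/
lemma abs_primitive_term_le (hp : 1 < p) (hq : 0 ≤ q) (hM : 0 < M) {f : ℝ → ℝ}
    (hfM : ∀ x, |f x| ≤ M * (1 + |x| ^ q)) {t : ℝ} (ht : 0 ≤ t) (x : ℝ) :
    |Real.exp (-(2 * (p + 1) * t / (p - 1))) * primitive f (Real.exp (2 / (p - 1) * t) * x)|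
      ≤ M * Real.exp (-(gam p q * t)) ^ 2 * ((1 + |x| ^ q) * |x|) := by
  rw [abs_mul, Real.abs_exp]
  have h1 := abs_primitive_le hq hfM hM (Real.exp (2 / (p - 1) * t) * x)
  have e0 : 2 / (p - 1) * t = 2 * t / (p - 1) := by ring
  rw [e0] at h1 ⊢
  rw [abs_mul, Real.abs_exp, Real.mul_rpow (Real.exp_pos _).le (abs_nonneg _)] at h1
  have e1 : Real.exp (-(2 * (p + 1) * t / (p - 1))) * Real.exp (2 * t / (p - 1))
      = Real.exp (-(2 * p * t / (p - 1))) := by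
    rw [← Real.exp_add]; congr 1; ring
  have h2 := exp_decay_fst (q := q) hp ht
  have h3 := exp_decay_snd (q := q) hp ht
  have hx : 0 ≤ |x| ^ q := Real.rpow_nonneg (abs_nonneg _) _
  calc _ ≤ Real.exp (-(2 * (p + 1) * t / (p - 1))) * (M * (1 + Real.exp (2 * t / (p - 1)) ^ q * |x| ^ q)
        * (Real.exp (2 * t / (p - 1)) * |x|)) := by gcongr
    _ = M * ((Real.exp (-(2 * (p + 1) * t / (p - 1))) * Real.exp (2 * t / (p - 1)))
        + (Real.exp (-(2 * (p + 1) * t / (p - 1))) * Real.exp (2 * t / (p - 1)))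
        * Real.exp (2 * t / (p - 1)) ^ q * |x| ^ q) * |x| := by ring
    _ ≤ M * (Real.exp (-(gam p q * t)) ^ 2 + Real.exp (-(gam p q * t)) ^ 2 * |x| ^ q) * |x| := by
        rw [e1]; gcongr
    _ = _ := by ring

/-- The exponents satisfy `2p/(p-1) - (p+1)/(p-1) = 1`, so the linear part of `g` decays like
`e^{-t}`; this is the reason for the entry `1/2` in `γ`. -/
lemma abs_damping_term_le (hp : 1 < p) (hM : 0 < M) {g : ℝ → ℝ}
    (hgM : ∀ x, |g x| ≤ M * (1 + |x|)) {t : ℝ} (ht : 0 ≤ t) (z : ℝ) :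
    |Real.exp (-(2 * p * t / (p - 1))) * g (Real.exp ((p + 1) * t / (p - 1)) * z)|
      ≤ M * Real.exp (-(gam p q * t)) ^ 2 * (1 + |z|) := by
  rw [abs_mul, Real.abs_exp]
  have h1 := hgM (Real.exp ((p + 1) * t / (p - 1)) * z)
  rw [abs_mul, Real.abs_exp] at h1
  have h2 := exp_decay_fst (q := q) hp ht
  have h3 : Real.exp (-(2 * p * t / (p - 1))) * Real.exp ((p + 1) * t / (p - 1))
      ≤ Real.exp (-(gam p q * t)) ^ 2 := by
    refine le_trans (le_of_eq ?_) (exp_le_exp_gam_sq (c := 1) ht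
      (by linarith [gam_le_half (p := p) (q := q)]))
    rw [← Real.exp_add]
    congr 1
    have : p - 1 ≠ 0 := by linarith
    field_simp
    ring
  calc _ ≤ Real.exp (-(2 * p * t / (p - 1))) * (M * (1 + Real.exp ((p + 1) * t / (p - 1)) * |z|)) := by
        gcongr
    _ = M * (Real.exp (-(2 * p * t / (p - 1))) + Real.exp (-(2 * p * t / (p - 1)))
        * Real.exp ((p + 1) * t / (p - 1)) * |z|) := by ring
    _ ≤ M * (Real.exp (-(gam p q * t)) ^ 2 + Real.exp (-(gam p q * t)) ^ 2 * |z|) := by gcongr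
    _ = _ := by ring

lemma rpow_le_one_add_rpow {a s s' : ℝ} (ha : 0 ≤ a) (hs : 0 ≤ s) (hss : s ≤ s') :
    a ^ s ≤ 1 + a ^ s' := by
  have h0 : 0 ≤ a ^ s' := Real.rpow_nonneg ha _
  rcases le_total a 1 with h | h
  · linarith [Real.rpow_le_one ha h hs]
  · linarith [Real.rpow_le_rpow_of_exponent_le h hss]

lemma one_add_rpow_mul_le (hq : 0 ≤ q) (hqp : q ≤ p) (x : ℝ) :
    (1 + |x| ^ q) * |x| ≤ 2 * (1 + |x| ^ (p + 1)) := by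
  have h1 := rpow_le_one_add_rpow (abs_nonneg x) zero_le_one (by linarith : 1 ≤ p + 1)
  have h2 := rpow_le_one_add_rpow (abs_nonneg x) (by linarith : 0 ≤ q + 1)
    (by linarith : q + 1 ≤ p + 1)
  rw [Real.rpow_one] at h1
  rw [Real.rpow_add_one' (abs_nonneg x) (by linarith)] at h2
  linarith

lemma exp_gam_sq_le_one (hp : 1 < p) (hqp : q < p) {t : ℝ} (ht : 0 ≤ t) :
    Real.exp (-(gam p q * t)) ^ 2 ≤ 1 := by
  have h1 : Real.exp (-(gam p q * t)) ≤ 1 :=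
    Real.exp_le_one_iff.2 (by nlinarith [gam_pos hp hqp])
  exact pow_le_one₀ (Real.exp_pos _).le h1

lemma abs_potentialDt_le (hp : 1 < p) (hq : 0 ≤ q) (hqp : q < p) (hM : 0 < M) {f : ℝ → ℝ}
    (hfM : ∀ x, |f x| ≤ M * (1 + |x| ^ q)) {t : ℝ} (ht : 0 ≤ t) (x : ℝ) :
    |potentialDt p f t x| ≤ (2 * (p + 1) / (p - 1) + 2 / (p - 1)) * (2 * M)
      * Real.exp (-(gam p q * t)) ^ 2 * (1 + |x| ^ (p + 1)) := by
  have h1 := abs_primitive_term_le hp hq hM hfM ht x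
  have h2 := abs_source_term_le hp hM hfM ht x
  have h3 := one_add_rpow_mul_le hq hqp.le x
  have hp1 : 0 < p - 1 := by linarith
  have h4 : |Real.exp (-(2 * p * t / (p - 1))) * f (Real.exp (2 * t / (p - 1)) * x) * x|
      ≤ M * Real.exp (-(gam p q * t)) ^ 2 * ((1 + |x| ^ q) * |x|) := by
    rw [abs_mul, ← mul_assoc]; gcongr
  have h5 : M * Real.exp (-(gam p q * t)) ^ 2 * ((1 + |x| ^ q) * |x|)
      ≤ M * Real.exp (-(gam p q * t)) ^ 2 * (2 * (1 + |x| ^ (p + 1))) := by gcongr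
  rw [potentialDt]
  refine (abs_add_le _ _).trans ?_
  rw [abs_mul, abs_mul (2 / (p - 1)), abs_neg, abs_of_pos (by positivity : 0 < 2 * (p + 1) / (p - 1)),
    abs_of_pos (by positivity : 0 < 2 / (p - 1))]
  have h6 := mul_le_mul_of_nonneg_left (h1.trans h5) (by positivity : 0 ≤ 2 * (p + 1) / (p - 1))
  have h7 := mul_le_mul_of_nonneg_left (h4.trans h5) (by positivity : 0 ≤ 2 / (p - 1))
  refine (add_le_add h6 h7).trans (le_of_eq ?_)
  ring

lemma abs_rpow_mul_self (hp : 1 < p) (x : ℝ) : |(|x| ^ (p - 1) * x)| = |x| ^ p := by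
  rw [abs_mul, abs_of_nonneg (Real.rpow_nonneg (abs_nonneg x) _)]
  rw [← Real.rpow_add_one' (abs_nonneg x) (by linarith)]
  congr 1; ring

lemma abs_mainSource_le (hp : 1 < p) (hq : 0 ≤ q) (hqp : q < p) (hM : 0 < M) {f : ℝ → ℝ}
    (hfM : ∀ x, |f x| ≤ M * (1 + |x| ^ q)) {t : ℝ} (ht : 0 ≤ t) (x : ℝ) :
    |mainSource p f t x| ≤ (2 * M + 1) * (1 + |x| ^ p) := by
  have h1 := abs_source_term_le hp hM hfM ht x
  have h2 := exp_gam_sq_le_one hp hqp ht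
  have h3 := rpow_le_one_add_rpow (abs_nonneg x) hq hqp.le
  have h4 : 0 ≤ |x| ^ p := Real.rpow_nonneg (abs_nonneg x) _
  have h5 : 0 ≤ |x| ^ q := Real.rpow_nonneg (abs_nonneg x) _
  refine (abs_add_le _ _).trans ?_
  rw [abs_rpow_mul_self hp]
  have h6 : M * Real.exp (-(gam p q * t)) ^ 2 * (1 + |x| ^ q) ≤ M * 1 * (1 + (1 + |x| ^ p)) := by
    gcongr
  nlinarith

/-- Split at the level `A` with `A^(p-q) = 2M`: below it `a^q` is bounded, above it half of `a^p`
dominates. -/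
lemma exists_young_rpow (hqp : q < p) (hq : 0 ≤ q) (hM : 0 < M) :
    ∃ C, 0 ≤ C ∧ ∀ a : ℝ, 0 ≤ a → M * a ^ q ≤ 1 / 2 * a ^ p + C := by
  set A := (2 * M) ^ (1 / (p - q)) with hA
  have hA0 : 0 < A := Real.rpow_pos_of_pos (by linarith) _
  refine ⟨M * A ^ q, by positivity, fun a ha => ?_⟩
  have h0 : 0 ≤ a ^ p := Real.rpow_nonneg ha _
  have h0' : 0 ≤ a ^ q := Real.rpow_nonneg ha _
  rcases le_total a A with h | h
  · have : a ^ q ≤ A ^ q := Real.rpow_le_rpow ha h hq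
    nlinarith
  · have hapos : 0 < a := hA0.trans_le h
    have h1 : 2 * M ≤ a ^ (p - q) := by
      have h2 := Real.rpow_le_rpow hA0.le h (by linarith : 0 ≤ p - q)
      rwa [hA, ← Real.rpow_mul (by linarith), one_div, inv_mul_cancel₀ (by linarith),
        Real.rpow_one] at h2
    have h3 : a ^ p = a ^ (p - q) * a ^ q := by
      rw [← Real.rpow_add hapos]; congr 1; ring
    have h4 : 0 ≤ M * A ^ q := by positivity
    rw [h3]; nlinarith

/-- The perturbation `f` is of lower order than `|w|^p` and `g` is linear in the state, so half of
`|w|^p` absorbs the former. The integrability of the source thereby passes to `|w|^p`. -/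
lemma exists_rpow_le_source {N : ℕ} (hp : 1 < p) (hq : 0 ≤ q) (hqp : q < p) (hM : 0 < M) :
    ∃ C, 0 ≤ C ∧ ∀ f g : ℝ → ℝ, (∀ x, |f x| ≤ M * (1 + |x| ^ q)) → (∀ x, |g x| ≤ M * (1 + |x|)) →
      ∀ t, 0 ≤ t → ∀ y : Space N, ‖y‖ ≤ 1 → ∀ x : State N,
        |x.1| ^ p ≤ 2 * |sourceFun p f g t y x| + C * (1 + ‖x‖) := by
  obtain ⟨C, hC0, hC⟩ := exists_young_rpow hqp hq hM
  have hp1 : 0 < p - 1 := by linarith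
  refine ⟨2 * (2 * M + C + M * (2 + 2 / (p - 1))), by positivity, fun f g hfM hgM t ht y hy x => ?_⟩
  have h1 := abs_source_term_le hp hM hfM ht x.1
  have h2 := abs_damping_term_le (q := q) hp hM hgM ht (x.2.1 + ⟪y, x.2.2⟫ + 2 / (p - 1) * x.1)
  have h3 := exp_gam_sq_le_one hp hqp ht
  have h4 := hC |x.1| (abs_nonneg _)
  have x1 : |x.1| ≤ ‖x‖ := norm_fst_le x
  have x2 : |x.2.1| ≤ ‖x‖ := (norm_fst_le x.2).trans (norm_snd_le x)
  have x3 : |⟪y, x.2.2⟫| ≤ ‖x‖ := (abs_real_inner_le_norm _ _).trans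
    ((mul_le_of_le_one_left (norm_nonneg _) hy).trans ((norm_snd_le x.2).trans (norm_snd_le x)))
  have h5 : |x.2.1 + ⟪y, x.2.2⟫ + 2 / (p - 1) * x.1| ≤ (2 + 2 / (p - 1)) * ‖x‖ := by
    have h6 : |2 / (p - 1) * x.1| ≤ 2 / (p - 1) * ‖x‖ := by
      rw [abs_mul, abs_of_pos (by positivity : 0 < 2 / (p - 1))]; gcongr
    have := abs_add_three x.2.1 ⟪y, x.2.2⟫ (2 / (p - 1) * x.1)
    linarith
  have h7 : M * Real.exp (-(gam p q * t)) ^ 2 * (1 + |x.1| ^ q) ≤ M * 1 * (1 + |x.1| ^ q) := by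
    have := Real.rpow_nonneg (abs_nonneg x.1) q
    gcongr
  have h8 : M * Real.exp (-(gam p q * t)) ^ 2 * (1 + |x.2.1 + ⟪y, x.2.2⟫ + 2 / (p - 1) * x.1|)
      ≤ M * 1 * (1 + (2 + 2 / (p - 1)) * ‖x‖) := by gcongr
  have h9 : |x.1| ^ p ≤ |sourceFun p f g t y x|
      + |Real.exp (-(2 * p * t / (p - 1))) * f (Real.exp (2 * t / (p - 1)) * x.1)|
      + |Real.exp (-(2 * p * t / (p - 1))) * g (Real.exp ((p + 1) * t / (p - 1))
        * (x.2.1 + ⟪y, x.2.2⟫ + 2 / (p - 1) * x.1))| := by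
    rw [← abs_rpow_mul_self hp]
    have e : |x.1| ^ (p - 1) * x.1 = sourceFun p f g t y x
        - Real.exp (-(2 * p * t / (p - 1))) * f (Real.exp (2 * t / (p - 1)) * x.1)
        - Real.exp (-(2 * p * t / (p - 1))) * g (Real.exp ((p + 1) * t / (p - 1))
        * (x.2.1 + ⟪y, x.2.2⟫ + 2 / (p - 1) * x.1)) := by
      simp only [sourceFun]; ring
    rw [e]
    exact (abs_sub _ _).trans (add_le_add_left (abs_sub _ _) _)
  have hx0 := norm_nonneg x
  have e10 : 0 ≤ M * ‖x‖ := by positivity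
  have e11 : 0 ≤ C * ‖x‖ := by positivity
  have e12 : 0 ≤ M * (2 / (p - 1)) := by positivity
  nlinarith

lemma hasDerivAt_primitive {f : ℝ → ℝ} (hf : Continuous f) (u : ℝ) :
    HasDerivAt (primitive f) (f u) u := (hf.integral_hasStrictDerivAt 0 u).hasDerivAt

lemma contDiff_primitive {f : ℝ → ℝ} (hf : Continuous f) : ContDiff ℝ 1 (primitive f) := by
  have hd : deriv (primitive f) = f := funext fun u => (hasDerivAt_primitive hf u).deriv
  exact contDiff_one_iff_deriv.2 ⟨fun u => (hasDerivAt_primitive hf u).differentiableAt, by rwa [hd]⟩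

/-- The chain rule for the potential along an absolutely continuous function. -/
lemma IsPrimitiveOn.potential (hp : 1 < p) {f : ℝ → ℝ} (hf : Continuous f) {a b : ℝ} {Z z : ℝ → ℝ}
    (h : IsPrimitiveOn a b Z z) (hab : a ≤ b) :
    IsPrimitiveOn a b (fun t => potential p f t (Z t))
      fun t => potentialDt p f t (Z t) + mainSource p f t (Z t) * z t := by
  have hp1 : p - 1 ≠ 0 := by linarith
  have hψ : ContDiff ℝ 1 fun x : ℝ => |x| ^ (p + 1) :=
    contDiff_norm_rpow (E := ℝ) (by linarith : 1 < p + 1)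
  have p1 := (h.comp hab hψ).const_mul (1 / (p + 1))
  have d1 : ∀ t, HasDerivAt (fun t => Real.exp (2 / (p - 1) * t))
      (2 / (p - 1) * Real.exp (2 / (p - 1) * t)) t := fun t => by
    exact ((hasDerivAt_id' t).const_mul (2 / (p - 1))).exp.congr_deriv (by ring)
  have d2 : ∀ t, HasDerivAt (fun t => Real.exp (-(2 * (p + 1) * t / (p - 1))))
      (-(2 * (p + 1) / (p - 1)) * Real.exp (-(2 * (p + 1) * t / (p - 1)))) t := fun t => by
    exact (((hasDerivAt_id' t).const_mul (2 * (p + 1))).div_const (p - 1)).neg.exp.congr_deriv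
      (by simp only [Pi.neg_apply]; ring)
  have p2 := ((h.smooth_mul hab d1 (by fun_prop)).comp hab (contDiff_primitive hf)).smooth_mul hab
    d2 (by fun_prop)
  refine (p1.add p2).congr hab (fun t _ => rfl) (ae_of_all _ fun t => ?_)
  have e1 := (hasDerivAt_abs_rpow (Z t) (by linarith : 1 < p + 1)).deriv
  have e2 := (hasDerivAt_primitive hf (Real.exp (2 / (p - 1) * t) * Z t)).deriv
  have e3 : Real.exp (-(2 * p * t / (p - 1))) = Real.exp (-(2 * (p + 1) * t / (p - 1)))
      * Real.exp (2 / (p - 1) * t) := by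
    rw [← Real.exp_add]; congr 1; field_simp; ring
  have e4 : 2 * t / (p - 1) = 2 / (p - 1) * t := by ring
  have e5 : p + 1 - 2 = p - 1 := by ring
  rw [e1, e2]
  simp only [potentialDt, mainSource, e3, e4, e5]
  have : p + 1 ≠ 0 := by linarith
  field_simp
  ring

lemma measurable_potential {f : ℝ → ℝ} (hf : Continuous f) :
    Measurable fun q : ℝ × ℝ => potential p f q.1 q.2 := by
  have h1 := (contDiff_primitive hf).continuous
  have m0 : Measurable fun q : ℝ × ℝ => |q.2| ^ (p + 1) :=
    (continuous_abs.measurable.comp measurable_snd).pow_const _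
  have h2 : Continuous fun q : ℝ × ℝ => Real.exp (-(2 * (p + 1) * q.1 / (p - 1)))
    * primitive f (Real.exp (2 / (p - 1) * q.1) * q.2) := by fun_prop
  exact (m0.const_mul _).add h2.measurable

lemma measurable_potentialDt {f : ℝ → ℝ} (hf : Continuous f) :
    Measurable fun q : ℝ × ℝ => potentialDt p f q.1 q.2 := by
  have h1 := (contDiff_primitive hf).continuous
  have h2 : Continuous fun q : ℝ × ℝ => potentialDt p f q.1 q.2 := by
    unfold potentialDt; fun_prop
  exact h2.measurable

lemma measurable_mainSource {f : ℝ → ℝ} (hf : Continuous f) :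
    Measurable fun q : ℝ × ℝ => mainSource p f q.1 q.2 := by
  have m0 : Measurable fun q : ℝ × ℝ => |q.2| ^ (p - 1) :=
    (continuous_abs.measurable.comp measurable_snd).pow_const _
  have h2 : Continuous fun q : ℝ × ℝ => Real.exp (-(2 * p * q.1 / (p - 1)))
    * f (Real.exp (2 * q.1 / (p - 1)) * q.2) := by fun_prop
  exact (m0.mul measurable_snd).add h2.measurable

end Bounds

end

/-! ### Absolute continuity of the localized potential energy. -/

section

variable {N : ℕ} {p r s₀ q M : ℝ}

lemma abs_potential_le (hp : 1 < p) (hq : 0 ≤ q) (hqp : q < p) (hM : 0 < M) {f : ℝ → ℝ}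
    (hfM : ∀ x, |f x| ≤ M * (1 + |x| ^ q)) {t : ℝ} (ht : 0 ≤ t) (x : ℝ) :
    |potential p f t x| ≤ (2 * M + 1) * (1 + |x| ^ (p + 1)) := by
  have h1 := abs_primitive_term_le hp hq hM hfM ht x
  have h2 := exp_gam_sq_le_one hp hqp ht
  have h3 := one_add_rpow_mul_le hq hqp.le x
  have h4 : 0 ≤ |x| ^ (p + 1) := Real.rpow_nonneg (abs_nonneg x) _
  have h5 : M * Real.exp (-(gam p q * t)) ^ 2 * ((1 + |x| ^ q) * |x|)
      ≤ M * 1 * (2 * (1 + |x| ^ (p + 1))) := by gcongr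
  have h6 : |1 / (p + 1) * |x| ^ (p + 1)| ≤ |x| ^ (p + 1) := by
    rw [abs_of_nonneg (by positivity)]
    refine mul_le_of_le_one_left h4 ?_
    rw [div_le_one (by linarith)]; linarith
  refine (abs_add_le _ _).trans ?_
  nlinarith

section Solution

variable {f g : ℝ → ℝ} {w : ℝ → Space N → ℝ} {G : ℝ → Space N → Space N}
  {ws : ℝ → Space N → ℝ} {χ k : Space N → ℝ}

/-- The localized potential energy is absolutely continuous in time. -/
theorem isPrimitiveOn_potential (hα : 0 < alpha N p) (hr0 : 0 < r) (hr : r < 1)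
    (hp : 1 < p) (hq : 0 ≤ q) (hqp : q < p) (hM : 0 < M) (hf : Continuous f) (hg : Continuous g)
    (hfM : ∀ x, |f x| ≤ M * (1 + |x| ^ q)) (hgM : ∀ x, |g x| ≤ M * (1 + |x|))
    (sol : IsSolution N p f g s₀ w G ws) (hχ : IsCutoff N r χ k)
    {a b : ℝ} (ha : s₀ ≤ a) (ha0 : 0 ≤ a) (hab : a ≤ b)
    (h0 : Integrable (fun y => |w a y| ^ (p + 1)) (mu N r)) :
    IsPrimitiveOn a b (fun t => ∫ y, χ y * rho N p y * potential p f t (w t y) ∂(mu N r))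
      (fun t => ∫ y, χ y * rho N p y * (potentialDt p f t (w t y)
        + mainSource p f t (w t y) * ws t y) ∂(mu N r)) ∧
    ∀ᵐ t ∂(volume.restrict (Ioc a b)), Integrable (fun y => |w t y| ^ (p + 1)) (mu N r) ∧
      Integrable (fun y => |w t y| ^ p * |ws t y|) (mu N r) := by
  obtain ⟨W, mW, hW'⟩ := exists_joint_state hα hr0 hr sol.continuousInH b (ha.trans hab)
  have hW : ∀ t ∈ Icc a b, (fun y => W (t, y)) =ᵐ[mu N r] stateAt w G ws t :=
    fun t ht => hW' t ⟨ha.trans ht.1, ht.2⟩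
  obtain ⟨Y, mY, hY, hprim⟩ := exists_joint_primitive hα hr0 hr sol ha hab mW hW
  set P : Measure (ℝ × Space N) := (volume.restrict (Ioc a b)).prod (mu N r) with hP
  obtain ⟨C, hC0, hC⟩ := exists_rpow_le_source (N := N) hp hq hqp hM
  have i1 := integrable_norm_sq_joint hα hr0 hr sol.continuousInH ha mW hW
  have i2 := integrable_source_mul_norm_joint hα hr0 hr hf hg sol ha hab mW hW
  have mp : Measurable fun z : ℝ × Space N => |(W z).1| ^ p :=
    (continuous_abs.measurable.comp mW.fst).pow_const _
  have mYp : ∀ s : ℝ, Measurable fun z : ℝ × Space N => |Y z| ^ s := fun s =>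
    (continuous_abs.measurable.comp mY).pow_const _
  have hP1 : ∀ᵐ z ∂P, z.1 ∈ Ioc a b :=
    Measure.quasiMeasurePreserving_fst.ae (ae_restrict_mem measurableSet_Ioc)
  have hP2 : ∀ᵐ z ∂P, ‖z.2‖ ≤ 1 :=
    Measure.quasiMeasurePreserving_snd.ae (ae_norm_le_one hr.le)
  -- Coercivity bounds `|w|^p` by the source plus a multiple of `1 + ‖W‖`; multiplied by `‖W‖`, both
  -- contributions are integrable. The space-time bounds on `|w|^{p+1}` and `|w|^p |w_s|` follow,
  -- with no restriction on `p` from Sobolev embedding.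
  have i3 : Integrable (fun z => |(W z).1| ^ p * ‖W z‖) P := by
    refine ((i2.const_mul 2).add (((integrable_const (1 : ℝ)).add i1).const_mul (2 * C))).mono'
      (mp.mul mW.norm).aestronglyMeasurable ?_
    filter_upwards [hP1, hP2] with z h1 h2
    have h3 := hC f g hfM hgM z.1 (ha0.trans h1.1.le) z.2 h2 (W z)
    have hn := norm_nonneg (W z)
    rw [Real.norm_of_nonneg (by positivity)]
    simp only [Pi.add_apply]
    have h4 := mul_le_mul_of_nonneg_right h3 hn
    nlinarith [mul_nonneg hC0 (sq_nonneg (‖W z‖ - 1)), mul_nonneg hC0 (sq_nonneg ‖W z‖)]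
  have hYW : ∀ᵐ z ∂P, Y z = (W z).1 := by
    rw [hP, Measure.ae_prod_iff_ae_ae (measurableSet_eq_fun mY mW.fst)]
    filter_upwards [ae_restrict_mem measurableSet_Ioc] with t ht
    filter_upwards [hY t (Ioc_subset_Icc_self ht), hW t (Ioc_subset_Icc_self ht)] with y h1 h2
    rw [h1, h2]
  have hle1 : ∀ z, |(W z).1| ≤ ‖W z‖ := fun z => norm_fst_le (W z)
  have hle2 : ∀ z, |(W z).2.1| ≤ ‖W z‖ := fun z =>
    (norm_fst_le (W z).2).trans (norm_snd_le (W z))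
  have i4 : Integrable (fun z => |Y z| ^ (p + 1)) P := by
    refine i3.mono' (mYp _).aestronglyMeasurable ?_
    filter_upwards [hYW] with z hz
    rw [Real.norm_of_nonneg (by positivity), hz, Real.rpow_add_one' (abs_nonneg _) (by linarith)]
    have := hle1 z
    gcongr
  have i5 : Integrable (fun z => |Y z| ^ p * |(W z).2.1|) P := by
    refine i3.mono' ((mYp _).mul (continuous_abs.measurable.comp
      mW.snd.fst)).aestronglyMeasurable ?_
    filter_upwards [hYW] with z hz
    rw [Real.norm_of_nonneg (by positivity), hz]
    have := hle2 z
    gcongr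
  have i6 : Integrable (fun z => |(W z).2.1|) P := by
    refine ((integrable_const (1 : ℝ)).add i1).mono'
      (continuous_abs.measurable.comp mW.snd.fst).aestronglyMeasurable (ae_of_all _ fun z => ?_)
    have := hle2 z
    simp only [Pi.add_apply, Real.norm_eq_abs, abs_abs]
    nlinarith [sq_nonneg (‖W z‖ - 1)]
  have mχ : Measurable fun y : Space N => χ y * rho N p y :=
    hχ.test.smooth.continuous.measurable.mul measurable_rho
  have bχ : ∀ᵐ y ∂(mu N r), |χ y * rho N p y| ≤ 1 := by
    filter_upwards [ae_restrict_mem Metric.isOpen_ball.measurableSet] with y hy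
    have hy' := ball_subset_unitBall hr.le hy
    have h1 := rho_pos (p := p) hy'
    have h2 := rho_le_one hα.le hy'
    have h3 := hχ.nonneg y
    have h4 := hχ.le_one y
    rw [abs_of_nonneg (by positivity)]
    nlinarith
  have bχP : ∀ᵐ z ∂P, |χ z.2 * rho N p z.2| ≤ 1 := Measure.quasiMeasurePreserving_snd.ae bχ
  set K := (2 * (p + 1) / (p - 1) + 2 / (p - 1)) * (2 * M) with hK
  have hp1 : 0 < p - 1 := by linarith
  have hK0 : 0 ≤ K := by positivity
  have i7 : Integrable (fun z : ℝ × Space N => χ z.2 * rho N p z.2 * (potentialDt p f z.1 (Y z)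
      + mainSource p f z.1 (Y z) * (W z).2.1)) P := by
    have m7 : Measurable fun z : ℝ × Space N => χ z.2 * rho N p z.2 *
        (potentialDt p f z.1 (Y z) + mainSource p f z.1 (Y z) * (W z).2.1) :=
      (mχ.comp measurable_snd).mul (((measurable_potentialDt hf).comp
        (measurable_fst.prodMk mY)).add (((measurable_mainSource hf).comp
        (measurable_fst.prodMk mY)).mul mW.snd.fst))
    refine ((((integrable_const (1 : ℝ)).add i4).const_mul K).add
      ((i6.add i5).const_mul (2 * M + 1))).mono' m7.aestronglyMeasurable ?_
    filter_upwards [hP1, bχP] with z h1 h2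
    have ht := ha0.trans h1.1.le
    have h3 := abs_potentialDt_le hp hq hqp hM hfM ht (Y z)
    have h4 := abs_mainSource_le hp hq hqp hM hfM ht (Y z)
    have h5 := exp_gam_sq_le_one hp hqp ht
    have h6 : K * Real.exp (-(gam p q * z.1)) ^ 2 * (1 + |Y z| ^ (p + 1))
        ≤ K * 1 * (1 + |Y z| ^ (p + 1)) := by gcongr
    simp only [Pi.add_apply, Real.norm_eq_abs]
    rw [abs_mul]
    refine (mul_le_of_le_one_left (abs_nonneg _) h2).trans ((abs_add_le _ _).trans ?_)
    rw [abs_mul]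
    have h7 := mul_le_mul_of_nonneg_right h4 (abs_nonneg (W z).2.1)
    linarith
  -- Space-time integrability says nothing about a particular time; at the initial time the
  -- assumption on `|w a|^{p+1}` is needed.
  have i8 : Integrable (fun y => χ y * rho N p y * potential p f a (Y (a, y))) (mu N r) := by
    have m8 : Measurable fun y : Space N => χ y * rho N p y * potential p f a (Y (a, y)) :=
      mχ.mul ((measurable_potential hf).comp (measurable_const.prodMk
        (mY.comp measurable_prodMk_left)))
    refine (((integrable_const (1 : ℝ)).add h0).const_mul (2 * M + 1)).mono'
      m8.aestronglyMeasurable ?_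
    filter_upwards [bχ, hY a ⟨le_rfl, hab⟩] with y h1 h2
    rw [Real.norm_eq_abs, abs_mul, h2]
    exact (mul_le_of_le_one_left (abs_nonneg _) h1).trans (abs_potential_le hp hq hqp hM hfM ha0 _)
  refine ⟨?_, ?_⟩
  · have key := isPrimitiveOn_integral hab
      (Θ := fun z => χ z.2 * rho N p z.2 * potential p f z.1 (Y z)) i7 i8 (by
        filter_upwards [hprim] with y hy t ht
        have h1 := (hy.potential hp hf hab).eq t ht
        simp only [intervalIntegral.integral_const_mul]
        rw [h1]; ring)
    refine key.congr hab (fun t ht => ?_) ?_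
    · refine integral_congr_ae ?_
      filter_upwards [hY t ht] with y hy
      simp only [hy]
    · filter_upwards [ae_restrict_mem measurableSet_Ioc] with t ht
      refine integral_congr_ae ?_
      filter_upwards [hY t (Ioc_subset_Icc_self ht), hW t (Ioc_subset_Icc_self ht)] with y h1 h2
      simp only [h1, h2]
  · filter_upwards [ae_restrict_mem measurableSet_Ioc, i4.prod_right_ae, i5.prod_right_ae]
      with t ht h4 h5
    refine ⟨h4.congr ?_, h5.congr ?_⟩
    · filter_upwards [hY t (Ioc_subset_Icc_self ht)] with y h1
      simp only [h1]
    · filter_upwards [hY t (Ioc_subset_Icc_self ht), hW t (Ioc_subset_Icc_self ht)] with y h1 h2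
      simp only [h1, h2]

end Solution

end

/-! ### Pointwise inequalities for the energy densities. -/

section

section Pointwise

lemma two_mul_le_add_of_sq_le {X P Q : ℝ} (hP : 0 ≤ P) (hQ : 0 ≤ Q) (h : X ^ 2 ≤ P * Q) :
    2 * |X| ≤ P + Q := by
  refine abs_le_of_sq_le_sq' ?_ (by positivity) |>.2
  rw [mul_pow, sq_abs]
  nlinarith [sq_nonneg (P - Q)]

/-- Here `y2` stands for `|y|²`, `d` for `1-|y|²`, `R` for `y·∇w` and `g` for `|∇w|²`. The outward
flux `-y2 v²` is spent in two halves, on `d v R` and on the term in `w v`; hence no `v²` remains on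
the right, and the gradient carries the factor `d²`. -/
lemma boundary_density_le {k d y2 v w R g ε : ℝ} (hk : 0 ≤ k) (hy2 : 0 ≤ y2) (hy1 : y2 ≤ 1)
    (hg : 0 ≤ g) (hR : R ^ 2 ≤ y2 * g) (hε0 : 0 ≤ ε) (hε1 : ε ≤ 1) :
    k * (-(y2 * v ^ 2) + d * (v * R) + 2 * ε * (y2 * (w * v)) - ε * (d * (w * R)))
      ≤ k * (d ^ 2 * g + 3 * w ^ 2) := by
  refine mul_le_mul_of_nonneg_left ?_ hk
  have h1 : 2 * |d * (v * R)| ≤ y2 * v ^ 2 + d ^ 2 * g := by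
    refine two_mul_le_add_of_sq_le (by positivity) (by positivity) ?_
    have : (d * (v * R)) ^ 2 = d ^ 2 * v ^ 2 * R ^ 2 := by ring
    nlinarith [mul_le_mul_of_nonneg_left hR (by positivity : 0 ≤ d ^ 2 * v ^ 2)]
  have h2 : 2 * |d * (w * R)| ≤ w ^ 2 + d ^ 2 * g := by
    refine two_mul_le_add_of_sq_le (by positivity) (by positivity) ?_
    have h3 : R ^ 2 ≤ g := hR.trans (mul_le_of_le_one_left hg hy1)
    nlinarith [mul_le_mul_of_nonneg_left h3 (by positivity : 0 ≤ d ^ 2 * w ^ 2)]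
  have h3 : 2 * |ε * (w * v)| ≤ 2 * w ^ 2 + 1 / 2 * v ^ 2 := by
    refine two_mul_le_add_of_sq_le (by positivity) (by positivity) ?_
    have : ε ^ 2 ≤ 1 := pow_le_one₀ hε0 hε1
    nlinarith [mul_le_mul_of_nonneg_right this (by positivity : 0 ≤ w ^ 2 * v ^ 2)]
  have h4 : ε * (w * v) ≤ w ^ 2 + 1 / 4 * v ^ 2 := by linarith [le_abs_self (ε * (w * v))]
  have h5 := mul_le_mul_of_nonneg_left h4 hy2
  have h6 : y2 * w ^ 2 ≤ w ^ 2 := mul_le_of_le_one_left (sq_nonneg w) hy1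
  have h7 : -(ε * (d * (w * R))) ≤ |d * (w * R)| := by
    have : |ε * (d * (w * R))| ≤ |d * (w * R)| := by
      rw [abs_mul, abs_of_nonneg hε0]
      exact mul_le_of_le_one_left (abs_nonneg _) hε1
    exact (neg_le_abs _).trans this
  have h8 := le_abs_self (d * (v * R))
  nlinarith

/-- The weighted absorption estimate behind the monotonicity formula: `d` stands for `1-|y|²`,
`e` for its inverse, `g` for `|∇w|²`, `A` for `|w|^{p+1}` and `σ` for the damping source. -/
lemma interior_density_le {p α M : ℝ} (hp : 1 < p) (hα : 0 < α) (hM : 0 < M) (κ : ℝ)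
    (hκ : 0 ≤ κ) (K : ℝ) (hK : 0 ≤ K) :
    ∃ C ε₁ : ℝ, 0 < C ∧ 0 < ε₁ ∧ ∀ ε γ d e v w R g A φ τ F σ : ℝ,
      0 < ε → ε ≤ 1 → ε ≤ ε₁ → 0 ≤ γ → γ ≤ 1 / 2 → 0 < d → d ≤ 1 → d * e = 1 → 0 ≤ g →
      R ^ 2 ≤ (1 - d) * g → 0 ≤ A →
      |φ| ≤ 2 * M * ε ^ 2 * (1 + A) → |τ| ≤ K * ε ^ 2 * (1 + A) → |F| ≤ 2 * M * ε ^ 2 * (1 + A) →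
      |σ| ≤ M * ε ^ 2 * (1 + (|v| + |R| + 2 / (p - 1) * |w|)) →
      -((p + 3) / 2 * ε) * (1 / 2 * (v ^ 2 + g - R ^ 2 + (2 * p + 2) / (p - 1) ^ 2 * w ^ 2)
          - (1 / (p + 1) * A + φ) - ε * (w * v))
        - 2 * α * e * v ^ 2 + σ * v - τ + γ * ε * (w * v)
        - ε * (v ^ 2 - (2 * p + 2) / (p - 1) ^ 2 * w ^ 2 + (κ - 4 * α * e) * (w * v)
          + 2 * (v * R) - g + R ^ 2 + (A + F) + σ * w)
        + C * ε ^ 2 / α * (2 * (w * R) + (κ - 2 * α * e) * w ^ 2)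
        ≤ -(α * e * v ^ 2) + C * ε ^ 2 := by
  have hp1 : 0 < p - 1 := by linarith
  set b := 2 / (p - 1) with hb
  have hb0 : 0 < b := by positivity
  -- Total weight of the cross terms in `w v`: the integrating factor acting on `J`, the bound `1/2`
  -- for `γ`, and the two parts of the cross flux.
  set L := (p + 3) / 2 + 1 / 2 + κ + 4 * α with hL
  have hL0 : 0 < L := by positivity
  -- Large enough to exceed the coefficient of every error of order `ε²`, whether constant or
  -- carried by `A`, `v²/d`, `w²/d` or `d g`.
  set C := (p + 3) * M + K + 2 * M + L ^ 2 / α + 4 / α + M * (4 + 2 * b) with hC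
  have hC0 : 0 < C := by positivity
  -- Four smallness conditions, which make the `C ε²` errors in `v²/d`, `d g`, `w²` and `A` smaller
  -- than the available negative terms, in this order.
  set ε₁ := min (min (α / 2 / C) ((p - 1) / 4 / (C * (1 + 1 / α ^ 2))))
    (min ((p + 1) / (2 * (p - 1)) / (C * (κ / α) + 1)) ((p - 1) / (2 * (p + 1)) / C)) with hε₁
  refine ⟨C, ε₁, hC0, by positivity, ?_⟩
  intro ε γ d e v w R g A φ τ F σ hε0 hε1 hεs hγ0 hγ hd0 hd1 hde hg hR hA hφ hτ hF hσ
  have s1 : C * ε ≤ α / 2 := by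
    have := hεs.trans ((min_le_left _ _).trans (min_le_left _ _))
    rw [le_div_iff₀ hC0] at this; linarith
  have s2 : C * ε * (1 + 1 / α ^ 2) ≤ (p - 1) / 4 := by
    have := hεs.trans ((min_le_left _ _).trans (min_le_right _ _))
    rw [le_div_iff₀ (by positivity)] at this; linarith
  have s3 : C * ε * (κ / α) ≤ (p + 1) / (2 * (p - 1)) := by
    have := hεs.trans ((min_le_right _ _).trans (min_le_left _ _))
    rw [le_div_iff₀ (by positivity)] at this; linarith
  have s4 : C * ε ≤ (p - 1) / (2 * (p + 1)) := by
    have := hεs.trans ((min_le_right _ _).trans (min_le_right _ _))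
    rw [le_div_iff₀ hC0] at this; linarith
  have he : e = d⁻¹ := eq_inv_of_mul_eq_one_right hde
  have he1 : 1 ≤ e := by rw [he]; exact (one_le_inv₀ hd0).2 hd1
  have he0 : 0 < e := one_pos.trans_le he1
  have hv : v ^ 2 ≤ e * v ^ 2 := le_mul_of_one_le_left (sq_nonneg v) he1
  have hw : w ^ 2 ≤ e * w ^ 2 := le_mul_of_one_le_left (sq_nonneg w) he1
  have hRg : R ^ 2 ≤ g := hR.trans (mul_le_of_le_one_left hg (by linarith only [hd0]))
  have hRd : d * g ≤ g - R ^ 2 := by linarith only [hR]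
  -- The three natural weighted densities. The weights `e` and `d` multiply to one, so `v R` and `w
  -- R` are controlled by `vd gd` and `wd gd` without loss at the boundary.
  set vd := e * v ^ 2 with hvd
  set wd := e * w ^ 2 with hwd
  set gd := d * g with hgd
  have hvd0 : 0 ≤ vd := by positivity
  have hwd0 : 0 ≤ wd := by positivity
  have hgd0 : 0 ≤ gd := by positivity
  have pVG : (v * R) ^ 2 ≤ vd * gd := by
    have : vd * gd = (d * e) * (v ^ 2 * g) := by rw [hvd, hgd]; ring
    rw [this, hde, one_mul, mul_pow]; gcongr
  have pWG : (w * R) ^ 2 ≤ wd * gd := by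
    have : wd * gd = (d * e) * (w ^ 2 * g) := by rw [hwd, hgd]; ring
    rw [this, hde, one_mul, mul_pow]; gcongr
  have pVW : (e * (w * v)) ^ 2 ≤ vd * wd := by
    rw [hvd, hwd]; exact le_of_eq (by ring)
  have aWV : |w * v| ≤ |e * (w * v)| := by
    rw [abs_mul e, abs_of_pos he0]; exact le_mul_of_one_le_left (abs_nonneg _) he1
  have q1 : 2 * |v * R| ≤ vd + gd := two_mul_le_add_of_sq_le hvd0 hgd0 pVG
  have q2 : 2 * |w * R| ≤ wd + gd := two_mul_le_add_of_sq_le hwd0 hgd0 pWG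
  have q3 : 2 * |e * (w * v)| ≤ vd + wd := two_mul_le_add_of_sq_le hvd0 hwd0 pVW
  -- Of the dissipation `2α vd`, half is kept. The other half is spent as `α/4` here, `α/4` on the
  -- cross term in `w v`, and `α/2` on the errors of order `ε²`.
  have q4 : 2 * |ε * (v * R)| ≤ α / 4 * vd + 4 / α * ε ^ 2 * gd := by
    refine two_mul_le_add_of_sq_le (by positivity) (by positivity) ?_
    have : α / 4 * vd * (4 / α * ε ^ 2 * gd) = ε ^ 2 * (vd * gd) := by field_simp
    rw [this, mul_pow]; gcongr
  have q5 : 2 * |(L / 2) * ε * (e * (w * v))| ≤ α / 4 * vd + L ^ 2 / α * ε ^ 2 * wd := by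
    refine two_mul_le_add_of_sq_le (by positivity) (by positivity) ?_
    have : α / 4 * vd * (L ^ 2 / α * ε ^ 2 * wd) = (L / 2 * ε) ^ 2 * (vd * wd) := by
      field_simp; ring
    rw [this, mul_pow]; gcongr
  have q6 : 2 * |w * R| ≤ α * wd + 1 / α * gd := by
    refine two_mul_le_add_of_sq_le (by positivity) (by positivity) ?_
    have : α * wd * (1 / α * gd) = wd * gd := by field_simp
    rw [this]; exact pWG
  have hLε : 0 ≤ L / 2 * ε := by positivity
  rw [abs_mul _ (e * (w * v)), abs_of_nonneg hLε] at q5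
  rw [abs_mul, abs_of_pos hε0] at q4
  -- the cross terms in `w * v`
  have c1 : (p + 3) / 2 * ε * (ε * (w * v)) + γ * ε * (w * v) - ε * ((κ - 4 * α * e) * (w * v))
      ≤ L * ε * |e * (w * v)| := by
    have b1 : ε * (w * v) ≤ |e * (w * v)| := by
      have : |ε * (w * v)| ≤ |w * v| := by
        rw [abs_mul, abs_of_pos hε0]; exact mul_le_of_le_one_left (abs_nonneg _) hε1
      exact (le_abs_self _).trans (this.trans aWV)
    have b2 : γ * (w * v) ≤ 1 / 2 * |e * (w * v)| := by
      have : |γ * (w * v)| ≤ 1 / 2 * |w * v| := by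
        rw [abs_mul, abs_of_nonneg hγ0]; gcongr
      have := (le_abs_self _).trans this
      linarith only [this, aWV]
    have b3 : -(κ * (w * v)) ≤ κ * |e * (w * v)| := by
      have : -(w * v) ≤ |e * (w * v)| := (neg_le_abs _).trans aWV
      have := mul_le_mul_of_nonneg_left this hκ
      linarith only [this]
    have b4 : e * (w * v) ≤ |e * (w * v)| := le_abs_self _
    have b1' := mul_le_mul_of_nonneg_left b1 (by positivity : 0 ≤ (p + 3) / 2 * ε)
    have b2' := mul_le_mul_of_nonneg_left b2 hε0.le
    have b3' := mul_le_mul_of_nonneg_left b3 hε0.le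
    have b4' := mul_le_mul_of_nonneg_left b4 (by positivity : 0 ≤ ε * (4 * α))
    rw [hL]; linarith only [b1', b2', b3', b4']
  -- the damping source
  have hε2 : 0 ≤ M * ε ^ 2 := by positivity
  have v1 : 2 * |v| ≤ 1 + vd := by nlinarith only [sq_nonneg (|v| - 1), sq_abs v, hv]
  have w1 : 2 * |w| ≤ 1 + wd := by nlinarith only [sq_nonneg (|w| - 1), sq_abs w, hw]
  have aVW : 2 * (|v| * |w|) ≤ vd + wd := by
    rw [← abs_mul, mul_comm v w]; linarith only [aWV, q3]
  have aVR : 2 * (|R| * |v|) ≤ vd + gd := by rw [← abs_mul, mul_comm R v]; exact q1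
  have aWR : 2 * (|R| * |w|) ≤ wd + gd := by rw [← abs_mul, mul_comm R w]; exact q2
  have c2 : σ * v ≤ M * ε ^ 2 * (1 + 2 * vd + gd + b * (vd + wd)) := by
    have b1 : σ * v ≤ M * ε ^ 2 * (1 + (|v| + |R| + b * |w|)) * |v| := by
      refine (le_abs_self _).trans ?_
      rw [abs_mul]; gcongr
    refine b1.trans ?_
    rw [mul_assoc]
    refine mul_le_mul_of_nonneg_left ?_ hε2
    have b3 : |v| * |v| = v ^ 2 := by rw [← sq, sq_abs]
    have b2 := mul_le_mul_of_nonneg_left aVW hb0.le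
    have b4 : (1 + (|v| + |R| + b * |w|)) * |v|
        = |v| + |v| * |v| + |R| * |v| + b * (|v| * |w|) := by ring
    rw [b4]
    have b5 : 0 ≤ b * (vd + wd) := by positivity
    linarith only [b2, b3, v1, aVR, hv, hvd0, hgd0, b5]
  have c3 : -(ε * (σ * w)) ≤ M * ε ^ 2 * (1 + 2 * wd + vd + gd + b * wd) := by
    have b1 : -(ε * (σ * w)) ≤ M * ε ^ 2 * (1 + (|v| + |R| + b * |w|)) * |w| := by
      refine (neg_le_abs _).trans ?_
      rw [abs_mul, abs_of_pos hε0]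
      refine (mul_le_of_le_one_left (abs_nonneg _) hε1).trans ?_
      rw [abs_mul]; gcongr
    refine b1.trans ?_
    rw [mul_assoc]
    refine mul_le_mul_of_nonneg_left ?_ hε2
    have b3 : |w| * |w| = w ^ 2 := by rw [← sq, sq_abs]
    have b2 : b * |w| * |w| ≤ b * wd := by
      rw [mul_assoc, b3]; gcongr
    have b4 : (1 + (|v| + |R| + b * |w|)) * |w|
        = |w| + |v| * |w| + |R| * |w| + b * |w| * |w| := by ring
    rw [b4]
    linarith only [b2, w1, aVW, aWR, hvd0, hwd0, hgd0]
  -- the lower order potential terms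
  have c4 : (p + 3) / 2 * ε * φ ≤ (p + 3) * M * ε ^ 2 * (1 + A) := by
    have b1 : ε * φ ≤ 2 * M * ε ^ 2 * (1 + A) := by
      refine (le_abs_self _).trans ?_
      rw [abs_mul, abs_of_pos hε0]
      exact (mul_le_of_le_one_left (abs_nonneg _) hε1).trans hφ
    have := mul_le_mul_of_nonneg_left b1 (by positivity : 0 ≤ (p + 3) / 2)
    linarith only [this]
  have c5 : -(ε * F) ≤ 2 * M * ε ^ 2 * (1 + A) := by
    refine (neg_le_abs _).trans ?_
    rw [abs_mul, abs_of_pos hε0]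
    exact (mul_le_of_le_one_left (abs_nonneg _) hε1).trans hF
  have c6 : -τ ≤ K * ε ^ 2 * (1 + A) := (neg_le_abs _).trans hτ
  have c7 : -(2 * (ε * (v * R))) ≤ α / 4 * vd + 4 / α * ε ^ 2 * gd := by
    have := mul_le_mul_of_nonneg_left (neg_le_abs (v * R)) hε0.le
    linarith only [this, q4]
  -- The added Hardy integrand. One half of `2α wd` absorbs the mixed term `2 w R`; the other half,
  -- after multiplication by `C ε²/α`, is exactly `-C ε² wd` and absorbs all errors in `w²/d`.
  have c8 : C * ε ^ 2 / α * (2 * (w * R) + (κ - 2 * α * e) * w ^ 2)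
      ≤ C * ε ^ 2 * (1 / α ^ 2 * gd + κ / α * w ^ 2 - wd) := by
    have b1 : 2 * (w * R) + (κ - 2 * α * e) * w ^ 2 ≤ 1 / α * gd + κ * w ^ 2 - α * wd := by
      have := le_abs_self (w * R)
      have e1 : (κ - 2 * α * e) * w ^ 2 = κ * w ^ 2 - 2 * (α * wd) := by rw [hwd]; ring
      rw [e1]; linarith only [this, q6]
    refine (mul_le_mul_of_nonneg_left b1 (by positivity)).trans (le_of_eq ?_)
    field_simp
  -- absorption
  have t1 := mul_le_mul_of_nonneg_right s1 (by positivity : 0 ≤ ε * vd)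
  have t1' : ε * vd ≤ vd := mul_le_of_le_one_left hvd0 hε1
  have t1'' := mul_le_mul_of_nonneg_left t1' (by positivity : 0 ≤ α / 2)
  have t2 := mul_le_mul_of_nonneg_right s2 (by positivity : 0 ≤ ε * gd)
  have t3 := mul_le_mul_of_nonneg_right s3 (by positivity : 0 ≤ ε * w ^ 2)
  have t4 := mul_le_mul_of_nonneg_right s4 (by positivity : 0 ≤ ε * A)
  have t5 := mul_le_mul_of_nonneg_left hRd (by positivity : 0 ≤ (p - 1) / 4 * ε)
  have t6 : 0 ≤ ε * v ^ 2 := by positivity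
  have t6' := mul_nonneg (by positivity : 0 ≤ 1 + (p + 3) / 4) t6
  -- The number `(p+3)/2` is the midpoint of `2` and `p + 1`. Being below `p + 1` makes the
  -- coefficient of `A` negative; being above `2` makes those of `w²` and of the gradient negative.
  have eA : (p + 3) / 2 * (1 / (p + 1)) - 1 = -((p - 1) / (2 * (p + 1))) := by
    field_simp; ring
  have ew : (2 * p + 2) / (p - 1) ^ 2 - (p + 3) / 4 * ((2 * p + 2) / (p - 1) ^ 2)
      = -((p + 1) / (2 * (p - 1))) := by field_simp; ring
  have eA' := congrArg (fun z => z * (ε * A)) eA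
  have ew' := congrArg (fun z => z * (ε * w ^ 2)) ew
  have eCA : ((p + 3) * M + K + 2 * M) * (ε ^ 2 * (1 + A)) ≤ C * (ε ^ 2 * (1 + A))
      - (L ^ 2 / α + 4 / α + M * (4 + 2 * b)) * ε ^ 2 := by
    have : 0 ≤ (L ^ 2 / α + 4 / α + M * (4 + 2 * b)) * (ε ^ 2 * A) := by positivity
    rw [hC]; linarith only [this]
  have eCv : M * (3 + b) * (ε ^ 2 * vd) ≤ C * (ε ^ 2 * vd) := by
    refine mul_le_mul_of_nonneg_right ?_ (by positivity)
    have : 0 ≤ (p + 3) * M + K + 2 * M + L ^ 2 / α + 4 / α + M * (1 + b) := by positivity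
    rw [hC]; linarith only [this]
  have eCw : (L ^ 2 / α + M * (2 + 2 * b)) * (ε ^ 2 * wd) ≤ C * (ε ^ 2 * wd) := by
    refine mul_le_mul_of_nonneg_right ?_ (by positivity)
    have : 0 ≤ (p + 3) * M + K + 2 * M + 4 / α + M * 2 := by positivity
    rw [hC]; linarith only [this]
  have eCg : (4 / α + M * 2) * (ε ^ 2 * gd) ≤ C * (ε ^ 2 * gd) := by
    refine mul_le_mul_of_nonneg_right ?_ (by positivity)
    have : 0 ≤ (p + 3) * M + K + 2 * M + L ^ 2 / α + M * (2 + 2 * b) := by positivity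
    rw [hC]; linarith only [this]
  have eC1 : 2 * (M * ε ^ 2) ≤ (L ^ 2 / α + 4 / α + M * (4 + 2 * b)) * ε ^ 2 := by
    have : 0 ≤ (L ^ 2 / α + 4 / α + M * (2 + 2 * b)) * ε ^ 2 := by positivity
    linarith only [this]
  have evd : α * e * v ^ 2 = α * vd := by rw [hvd]; ring
  have evd2 : 2 * α * e * v ^ 2 = 2 * (α * vd) := by rw [hvd]; ring
  rw [evd, evd2]
  linarith only [c1, c2, c3, c4, c5, c6, c7, c8, q5, t1, t1'', t2, t3, t4, t5, t6', eA', ew', eCA,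
    eCv, eCw, eCg, eC1]

end Pointwise

end

/-! ### The derivative of the localized functional. -/

section

/-- `f` is integrable with integral `I`. -/
structure HasLebesgueIntegral {α : Type*} [MeasurableSpace α] (μ : Measure α) (f : α → ℝ) (I : ℝ) :
    Prop where
  integrable : Integrable f μ
  eq : ∫ y, f y ∂μ = I

namespace HasLebesgueIntegral

variable {α : Type*} [MeasurableSpace α] {μ : Measure α} {f g : α → ℝ} {I J : ℝ}

lemma of_integrable (hf : Integrable f μ) : HasLebesgueIntegral μ f (∫ y, f y ∂μ) := ⟨hf, rfl⟩

lemma add (hf : HasLebesgueIntegral μ f I) (hg : HasLebesgueIntegral μ g J) :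
    HasLebesgueIntegral μ (fun y => f y + g y) (I + J) :=
  ⟨hf.1.add hg.1, by rw [integral_add hf.1 hg.1, hf.2, hg.2]⟩

lemma sub (hf : HasLebesgueIntegral μ f I) (hg : HasLebesgueIntegral μ g J) :
    HasLebesgueIntegral μ (fun y => f y - g y) (I - J) :=
  ⟨hf.1.sub hg.1, by rw [integral_sub hf.1 hg.1, hf.2, hg.2]⟩

lemma const_mul (hf : HasLebesgueIntegral μ f I) (c : ℝ) :
    HasLebesgueIntegral μ (fun y => c * f y) (c * I) :=
  ⟨hf.1.const_mul c, by rw [integral_const_mul, hf.2]⟩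

lemma le (hf : HasLebesgueIntegral μ f I) (hg : HasLebesgueIntegral μ g J)
    (h : ∀ᵐ y ∂μ, f y ≤ g y) : I ≤ J := by
  rw [← hf.2, ← hg.2]
  exact integral_mono_ae hf.1 hg.1 h

end HasLebesgueIntegral

variable {N : ℕ} {p r s₀ q M : ℝ}

/-- The localized dissipation. -/
def dissipationCoeff (p : ℝ) (χ : Space N → ℝ) : Coeff N where
  ww _ := 0
  wv _ := 0
  vv y := χ y * rho N p y * (1 - ‖y‖ ^ 2)⁻¹
  GG _ := 0
  RR _ := 0
  wR _ := 0
  vR _ := 0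

/-- The error caused by the cutoff. -/
def layerCoeff (p : ℝ) (k : Space N → ℝ) : Coeff N where
  ww y := 3 * (rho N p y * k y)
  wv _ := 0
  vv _ := 0
  GG y := rho N p y * k y * (1 - ‖y‖ ^ 2) ^ 2
  RR _ := 0
  wR _ := 0
  vR _ := 0

lemma IsCutoff.dissipationCoeff {χ k : Space N → ℝ} (h : IsCutoff N r χ k) (hr : r < 1) :
    (dissipationCoeff p χ).Admissible r :=
  ⟨continuousOn_const, continuousOn_const,
    (h.continuousOn_mul_rho hr).mul (continuousOn_inv_one_sub_normSq hr), continuousOn_const,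
    continuousOn_const, continuousOn_const, continuousOn_const⟩

lemma IsCutoff.layerCoeff {χ k : Space N → ℝ} (h : IsCutoff N r χ k) (hr : r < 1) :
    (layerCoeff p k).Admissible r := by
  have c := (continuousOn_rho (p := p) hr).mul (h.cont.continuousOn (s := Metric.closedBall 0 r))
  exact ⟨c.const_mul _, continuousOn_const, continuousOn_const,
    c.mul (continuous_one_sub_normSq.pow 2).continuousOn, continuousOn_const, continuousOn_const,
    continuousOn_const⟩

/-- The derivative of the localized functional is controlled by the dissipation, up to a
lower order term and to the error caused by the cutoff. -/
theorem exists_instantaneous_le (hα : 0 < alpha N p) (hp : 1 < p) (hq : 0 ≤ q) (hqp : q < p)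
    (hM : 0 < M) :
    ∃ C ε₁ : ℝ, 0 < C ∧ 0 < ε₁ ∧ ∀ f g : ℝ → ℝ, Continuous f →
      (∀ x, |f x| ≤ M * (1 + |x| ^ q)) → (∀ x, |g x| ≤ M * (1 + |x|)) →
      ∀ r : ℝ, r < 1 → ∀ χ k : Space N → ℝ, IsCutoff N r χ k → ∀ x : Space N → State N,
      MemLp x 2 (mu N r) → HasGradOn r (fun y => (x y).1) (fun y => (x y).2.2) →
      ∀ t : ℝ, 0 ≤ t → ∀ ε : ℝ, ε = Real.exp (-(gam p q * t)) → ε ≤ ε₁ →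
      MemLp (fun y => sourceFun p f g t y (x y)) 2 (mu N r) →
      Integrable (fun y => |(x y).1| ^ (p + 1)) (mu N r) →
      Integrable (fun y => |(x y).1| ^ p * |(x y).2.1|) (mu N r) →
      -((p + 3) / 2 * ε) * ((∫ y, (energyCoeff p χ).eval y (x y) (x y) ∂(mu N r))
          - (∫ y, χ y * rho N p y * potential p f t (x y).1 ∂(mu N r))
          - ε * ∫ y, (crossCoeff p χ).eval y (x y) (x y) ∂(mu N r))
        + ((∫ y, ((energyFlux p χ k).eval y (x y) (x y)
            + (crossCoeff p χ).eval y (sourceFun p f g t y (x y), 0, 0) (x y)) ∂(mu N r))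
          - (∫ y, χ y * rho N p y * (potentialDt p f t (x y).1
              + mainSource p f t (x y).1 * (x y).2.1) ∂(mu N r))
          - (-(gam p q) * ε * (∫ y, (crossCoeff p χ).eval y (x y) (x y) ∂(mu N r))
            + ε * ∫ y, ((crossFlux p χ k).eval y (x y) (x y)
              + (massCoeff p χ).eval y (sourceFun p f g t y (x y), 0, 0) (x y)) ∂(mu N r)))
        ≤ -alpha N p * (∫ y, (dissipationCoeff p χ).eval y (x y) (x y) ∂(mu N r))
          + C * ε ^ 2 * (∫ y, χ y * rho N p y ∂(mu N r))
          + ∫ y, (layerCoeff p k).eval y (x y) (x y) ∂(mu N r) := by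
  have hp1 : 0 < p - 1 := by linarith
  -- The parameter `κ` is the damping coefficient, which is also the constant in the radial
  -- identity; `K` is the constant in `abs_potentialDt_le`.
  obtain ⟨C, ε₁, hC, hε₁, key⟩ := interior_density_le hp hα hM ((p + 3) / (p - 1)) (by positivity)
    ((2 * (p + 1) / (p - 1) + 2 / (p - 1)) * (2 * M)) (by positivity)
  refine ⟨C, ε₁, hC, hε₁, ?_⟩
  intro f g hf hfM hgM r hr χ k hχ x hx hgrad t ht ε hε hεs hS hA hAv
  have hε0 : 0 < ε := hε ▸ Real.exp_pos _
  have hε1 : ε ≤ 1 := by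
    rw [hε]; exact Real.exp_le_one_iff.2 (by nlinarith [gam_pos hp hqp])
  have cχ := hχ.test.smooth.continuous.continuousOn (s := Metric.closedBall 0 r)
  have cχρ := hχ.continuousOn_mul_rho (p := p) hr
  have hd := continuousOn_inv_one_sub_normSq (N := N) hr
  have cn : ContinuousOn (fun y : Space N => ‖y‖ ^ 2) (Metric.closedBall 0 r) :=
    (continuous_norm.pow 2).continuousOn
  have bχ : ∀ᵐ y ∂(mu N r), |χ y * rho N p y| ≤ 1 := by
    filter_upwards [ae_restrict_mem Metric.isOpen_ball.measurableSet] with y hy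
    have hy' := ball_subset_unitBall hr.le hy
    have h1 := rho_pos (p := p) hy'
    have h2 := rho_le_one hα.le hy'
    have h3 := hχ.nonneg y
    have h4 := hχ.le_one y
    rw [abs_of_nonneg (by positivity)]
    nlinarith
  have mx1 : AEMeasurable (fun y => (x y).1) (mu N r) := hx.1.aemeasurable.fst
  have mx2 : AEMeasurable (fun y => (x y).2.1) (mu N r) := hx.1.aemeasurable.snd.fst
  have mχ : AEMeasurable (fun y => χ y * rho N p y) (mu N r) :=
    (hχ.test.smooth.continuous.measurable.mul measurable_rho).aemeasurable
  have iE := HasLebesgueIntegral.of_integrable ((hχ.energyCoeff (p := p) hr).integrable hr.le hx hx)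
  have iJ := HasLebesgueIntegral.of_integrable ((hχ.crossCoeff (p := p) hr).integrable hr.le hx hx)
  have iD := HasLebesgueIntegral.of_integrable
    ((hχ.dissipationCoeff (p := p) hr).integrable hr.le hx hx)
  have iL := HasLebesgueIntegral.of_integrable ((hχ.layerCoeff (p := p) hr).integrable hr.le hx hx)
  have izE := HasLebesgueIntegral.of_integrable
    (((hχ.energyFlux (p := p) hr).integrable hr.le hx hx).add
      ((hχ.crossCoeff (p := p) hr).integrable hr.le (memLp_inl hS) hx))
  have izJ := HasLebesgueIntegral.of_integrable
    (((hχ.crossFlux (p := p) hr).integrable hr.le hx hx).add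
      ((hχ.massCoeff (p := p) hr).integrable hr.le (memLp_inl hS) hx))
  have iX := HasLebesgueIntegral.of_integrable ((memLp_of_continuous cχρ).integrable (by norm_num))
  have iP : Integrable (fun y => χ y * rho N p y * potential p f t (x y).1) (mu N r) := by
    refine (((integrable_const (1 : ℝ)).add hA).const_mul (2 * M + 1)).mono'
      (mχ.mul (((measurable_potential hf).comp measurable_prodMk_left).comp_aemeasurable
        mx1)).aestronglyMeasurable ?_
    filter_upwards [bχ] with y h1
    rw [Real.norm_eq_abs, abs_mul]
    exact (mul_le_of_le_one_left (abs_nonneg _) h1).trans (abs_potential_le hp hq hqp hM hfM ht _)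
  have izP : Integrable (fun y => χ y * rho N p y * (potentialDt p f t (x y).1
      + mainSource p f t (x y).1 * (x y).2.1)) (mu N r) := by
    have i6 : Integrable (fun y => |(x y).2.1|) (mu N r) :=
      (hx.snd.fst.integrable (by norm_num)).abs
    refine ((((integrable_const (1 : ℝ)).add hA).const_mul ((2 * (p + 1) / (p - 1) + 2 / (p - 1))
      * (2 * M))).add ((i6.add hAv).const_mul (2 * M + 1))).mono'
      (mχ.mul ((((measurable_potentialDt hf).comp measurable_prodMk_left).comp_aemeasurable
        mx1).add ((((measurable_mainSource hf).comp measurable_prodMk_left).comp_aemeasurable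
        mx1).mul mx2))).aestronglyMeasurable ?_
    filter_upwards [bχ] with y h1
    have h3 := abs_potentialDt_le hp hq hqp hM hfM ht (x y).1
    have h4 := abs_mainSource_le hp hq hqp hM hfM ht (x y).1
    have h5 := exp_gam_sq_le_one hp hqp ht
    have h6 : (2 * (p + 1) / (p - 1) + 2 / (p - 1)) * (2 * M) * Real.exp (-(gam p q * t)) ^ 2
        * (1 + |(x y).1| ^ (p + 1))
        ≤ (2 * (p + 1) / (p - 1) + 2 / (p - 1)) * (2 * M) * 1 * (1 + |(x y).1| ^ (p + 1)) := by
      gcongr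
    simp only [Pi.add_apply, Real.norm_eq_abs]
    rw [abs_mul]
    refine (mul_le_of_le_one_left (abs_nonneg _) h1).trans ((abs_add_le _ _).trans ?_)
    rw [abs_mul]
    have h7 := mul_le_mul_of_nonneg_right h4 (abs_nonneg (x y).2.1)
    linarith
  have i7 : Integrable (fun y => χ y * rho N p y * ((x y).1 * ⟪y, (x y).2.2⟫)) (mu N r) := by
    refine ((memLp_mul_continuous cχρ hx.fst).integrable_mul
      (memLp_inner_continuous continuous_id.continuousOn hx.snd.snd)).congr
      (ae_of_all _ fun y => ?_)
    simp [mul_assoc]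
  have i8 : Integrable (fun y => rho N p y * (χ y * ((p + 3) / (p - 1)
      - 2 * alpha N p / (1 - ‖y‖ ^ 2)) - k y * ‖y‖ ^ 2) * (x y).1 ^ 2) (mu N r) := by
    have c : ContinuousOn (fun y => rho N p y * (χ y * ((p + 3) / (p - 1)
      - 2 * alpha N p * (1 - ‖y‖ ^ 2)⁻¹) - k y * ‖y‖ ^ 2)) (Metric.closedBall (0 : Space N) r) :=
      (continuousOn_rho hr).mul ((cχ.mul (continuousOn_const.sub (hd.const_mul _))).sub
        (hχ.cont.continuousOn.mul cn))
    refine ((memLp_mul_continuous c hx.fst).integrable_mul hx.fst).congr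
      (ae_of_all _ fun y => ?_)
    simp only [smul_eq_mul, Pi.mul_apply, div_eq_mul_inv]; ring
  have hardy := hχ.integral_radial hp hr hgrad hx.fst hx.snd.snd
  have iP := HasLebesgueIntegral.of_integrable iP
  have izP := HasLebesgueIntegral.of_integrable izP
  have i7 := HasLebesgueIntegral.of_integrable i7
  have i8 := HasLebesgueIntegral.of_integrable i8
  -- The integrated pointwise estimate, with `C ε²/α` times the radial identity added on the left.
  -- That addition has integral zero by `hardy`, so it is free.
  have main := (((((iE.sub iP).sub (iJ.const_mul ε)).const_mul (-((p + 3) / 2 * ε))).add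
    ((izE.sub izP).sub ((iJ.const_mul (-(gam p q) * ε)).add (izJ.const_mul ε)))).add
    (((i7.const_mul 2).add i8).const_mul (C * ε ^ 2 / alpha N p))).le
    (((iD.const_mul (-alpha N p)).add (iX.const_mul (C * ε ^ 2))).add iL) (by
      filter_upwards [ae_restrict_mem Metric.isOpen_ball.measurableSet] with y hy
      have hy' := ball_subset_unitBall hr.le hy
      have hd0 := one_sub_normSq_pos hy'
      have hρ := rho_pos (p := p) hy'
      have hχ0 := hχ.nonneg y
      have hk := hχ.k_nonneg y
      have hR : ⟪y, (x y).2.2⟫ ^ 2 ≤ ‖y‖ ^ 2 * ‖(x y).2.2‖ ^ 2 := by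
        rw [← mul_pow]
        exact sq_le_sq' (by linarith [neg_le_abs ⟪y, (x y).2.2⟫,
          abs_real_inner_le_norm y (x y).2.2]) (real_inner_le_norm _ _)
      have hfw := abs_source_term_le hp hM hfM ht (x y).1
      have hprim := abs_primitive_term_le hp hq hM hfM ht (x y).1
      have hgw := abs_damping_term_le (q := q) hp hM hgM ht
        ((x y).2.1 + ⟪y, (x y).2.2⟫ + 2 / (p - 1) * (x y).1)
      have hpow := one_add_rpow_mul_le hq hqp.le (x y).1
      have hdt := abs_potentialDt_le hp hq hqp hM hfM ht (x y).1
      rw [← hε] at hfw hprim hgw hdt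
      have hM2 : 0 ≤ M * ε ^ 2 := by positivity
      have hpow' := mul_le_mul_of_nonneg_left hpow hM2
      set φ := Real.exp (-(2 * (p + 1) * t / (p - 1))) * primitive f (Real.exp (2 / (p - 1) * t)
        * (x y).1) with hφ
      set F := Real.exp (-(2 * p * t / (p - 1))) * f (Real.exp (2 * t / (p - 1)) * (x y).1) with hF
      set σ := Real.exp (-(2 * p * t / (p - 1))) * g (Real.exp ((p + 1) * t / (p - 1)) *
        ((x y).2.1 + ⟪y, (x y).2.2⟫ + 2 / (p - 1) * (x y).1)) with hσ
      have eS : sourceFun p f g t y (x y) = mainSource p f t (x y).1 + σ := rfl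
      have eP : potential p f t (x y).1 = 1 / (p + 1) * |(x y).1| ^ (p + 1) + φ := rfl
      have eN : mainSource p f t (x y).1 * (x y).1 = |(x y).1| ^ (p + 1) + F * (x y).1 := by
        have e1 : |(x y).1| ^ (p + 1) = |(x y).1| ^ (p - 1) * ((x y).1 * (x y).1) := by
          rw [← abs_mul_abs_self, ← mul_assoc, ← Real.rpow_add_one' (abs_nonneg _) (by linarith),
            ← Real.rpow_add_one' (abs_nonneg _) (by linarith)]
          congr 1; ring
        rw [e1, mainSource]; ring
      have hint := key ε (gam p q) (1 - ‖y‖ ^ 2) (1 - ‖y‖ ^ 2)⁻¹ (x y).2.1 (x y).1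
        ⟪y, (x y).2.2⟫ (‖(x y).2.2‖ ^ 2) (|(x y).1| ^ (p + 1)) φ (potentialDt p f t (x y).1)
        (F * (x y).1) σ hε0 hε1 hεs (gam_pos hp hqp).le gam_le_half hd0
        (by linarith [sq_nonneg ‖y‖]) (mul_inv_cancel₀ hd0.ne') (sq_nonneg _)
        (by rw [sub_sub_cancel]; exact hR) (Real.rpow_nonneg (abs_nonneg _) _)
        (hprim.trans (by linarith)) hdt
        (by
          rw [abs_mul]
          refine (mul_le_mul_of_nonneg_right hfw (abs_nonneg _)).trans ?_
          linarith)
        (by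
          refine hgw.trans (mul_le_mul_of_nonneg_left ?_ hM2)
          have h1 := abs_add_three (x y).2.1 ⟪y, (x y).2.2⟫ (2 / (p - 1) * (x y).1)
          rw [abs_mul (2 / (p - 1)), abs_of_pos (by positivity : 0 < 2 / (p - 1))] at h1
          linarith)
      have hbd := boundary_density_le (k := rho N p y * k y) (d := 1 - ‖y‖ ^ 2)
        (v := (x y).2.1) (w := (x y).1) (by positivity) (sq_nonneg ‖y‖) (by linarith)
        (sq_nonneg ‖(x y).2.2‖) hR hε0.le hε1
      have hint' := mul_le_mul_of_nonneg_left hint (by positivity : 0 ≤ χ y * rho N p y)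
      -- The layer part of the added Hardy integrand enters with a negative sign and is discarded.
      have hneg : 0 ≤ C * ε ^ 2 / alpha N p * (rho N p y * (k y * ‖y‖ ^ 2) * (x y).1 ^ 2) := by
        positivity
      simp only [energyCoeff, crossCoeff, energyFlux, crossFlux, massCoeff, dissipationCoeff,
        layerCoeff, Coeff.eval, real_inner_self_eq_norm_sq, inner_zero_left, eS, eP, Pi.add_apply]
      have eN' := congrArg (fun z => ε * (χ y * rho N p y) * z) eN
      simp only [div_eq_mul_inv] at hint' hneg eN' ⊢
      linarith only [hint', hbd, hneg, eN'])
  simp only [Pi.add_apply] at main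
  have hardy' : C * ε ^ 2 / alpha N p * (2 * (∫ y, χ y * rho N p y * ((x y).1 * ⟪y, (x y).2.2⟫)
      ∂(mu N r)) + ∫ y, rho N p y * (χ y * ((p + 3) / (p - 1) - 2 * alpha N p / (1 - ‖y‖ ^ 2))
          - k y * ‖y‖ ^ 2) * (x y).1 ^ 2 ∂(mu N r)) = 0 := by
    rw [hardy, neg_add_cancel, mul_zero]
  linarith only [main, hardy']

end

/-! ### Monotonicity of the localized functional. -/

section

variable {N : ℕ} {p r s₀ q M : ℝ}

section Solution

variable {f g : ℝ → ℝ} {w : ℝ → Space N → ℝ} {G : ℝ → Space N → Space N}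
  {ws : ℝ → Space N → ℝ} {χ k : Space N → ℝ}

lemma intervalIntegrable_form (hα : 0 < alpha N p) (hr0 : 0 < r) (hr : r < 1)
    (h : ContinuousInH N p s₀ w G ws) {c : Coeff N} (hc : c.Admissible r) {a b : ℝ}
    (ha : s₀ ≤ a) (hab : a ≤ b) :
    IntervalIntegrable (fun t => ∫ y, c.eval y (stateAt w G ws t y) (stateAt w G ws t y)
      ∂(mu N r)) volume a b := by
  have hX := continuous_path hα hr0 hr h
  refine (intervalIntegrable_bilinear hX (hX.intervalIntegrable a b)
    (formCLM c hc hr.le)).congr_ae ?_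
  rw [uIoc_of_le hab]
  filter_upwards [ae_restrict_mem measurableSet_Ioc] with t ht
  exact formCLM_path hα hr0 hr h hc (ha.trans ht.1.le)

/-- The Lyapunov functional localized by the cutoff `χ`. -/
def localFunctional (p q θ r : ℝ) (f : ℝ → ℝ) (χ : Space N → ℝ) (w : ℝ → Space N → ℝ)
    (G : ℝ → Space N → Space N) (ws : ℝ → Space N → ℝ) (t : ℝ) : ℝ :=
  ((∫ y, (energyCoeff p χ).eval y (stateAt w G ws t y) (stateAt w G ws t y) ∂(mu N r))
      - (∫ y, χ y * rho N p y * potential p f t (w t y) ∂(mu N r))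
      - Real.exp (-(gam p q * t)) *
        ∫ y, (crossCoeff p χ).eval y (stateAt w G ws t y) (stateAt w G ws t y) ∂(mu N r))
    * Real.exp ((p + 3) / (2 * gam p q) * Real.exp (-(gam p q * t)))
    + θ * Real.exp (-(2 * gam p q * t))

lemma exp_two_gam (t : ℝ) :
    Real.exp (-(2 * gam p q * t)) = Real.exp (-(gam p q * t)) ^ 2 := by
  rw [← Real.exp_nat_mul]; congr 1; push_cast; ring

lemma dissipation_eval_nonneg (hr : r < 1) (hχ : IsCutoff N r χ k) (x : Space N → State N) :
    0 ≤ ∫ y, (dissipationCoeff p χ).eval y (x y) (x y) ∂(mu N r) := by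
  refine integral_nonneg_of_ae ?_
  filter_upwards [ae_restrict_mem Metric.isOpen_ball.measurableSet] with y hy
  have hy' := ball_subset_unitBall hr.le hy
  have h1 := one_sub_normSq_pos hy'
  have h2 := rho_pos (p := p) hy'
  have h3 := hχ.nonneg y
  simp only [dissipationCoeff, Coeff.eval, zero_mul, add_zero, zero_add, Pi.zero_apply]
  have h4 := mul_self_nonneg (x y).2.1
  positivity

lemma layer_eval_nonneg (hr : r < 1) (hχ : IsCutoff N r χ k) (x : Space N → State N) :
    0 ≤ ∫ y, (layerCoeff p k).eval y (x y) (x y) ∂(mu N r) := by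
  refine integral_nonneg_of_ae ?_
  filter_upwards [ae_restrict_mem Metric.isOpen_ball.measurableSet] with y hy
  have hy' := ball_subset_unitBall hr.le hy
  have h2 := rho_pos (p := p) hy'
  have h3 := hχ.k_nonneg y
  simp only [layerCoeff, Coeff.eval, zero_mul, add_zero, Pi.zero_apply]
  have h4 := mul_self_nonneg (x y).1
  have h5 := real_inner_self_nonneg (x := (x y).2.2) (F := Space N)
  positivity

lemma integral_cutoff_le (hα : 0 < alpha N p) (hr : r < 1) (hχ : IsCutoff N r χ k) :
    ∫ y, χ y * rho N p y ∂(mu N r) ≤ volume.real (unitBall N) := by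
  have h1 : ∫ y, χ y * rho N p y ∂(mu N r) ≤ ∫ _, (1 : ℝ) ∂(mu N r) := by
    refine integral_mono_ae ((memLp_of_continuous (hχ.continuousOn_mul_rho hr)).integrable
      (by norm_num)) (integrable_const _) ?_
    filter_upwards [ae_restrict_mem Metric.isOpen_ball.measurableSet] with y hy
    have hy' := ball_subset_unitBall hr.le hy
    have h1 := rho_pos (p := p) hy'
    have h2 := rho_le_one hα.le hy'
    have h3 := hχ.nonneg y
    have h4 := hχ.le_one y
    nlinarith
  refine h1.trans ?_
  rw [integral_const, smul_eq_mul, mul_one, measureReal_restrict_apply MeasurableSet.univ,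
    univ_inter]
  exact measureReal_mono (ball_subset_unitBall hr.le) Metric.isBounded_ball.measure_lt_top.ne

end Solution

/-- Monotonicity of the localized functional, up to the error caused by the cutoff. -/
theorem exists_localFunctional_sub_le (hα : 0 < alpha N p) (hp : 1 < p) (hq : 0 ≤ q) (hqp : q < p)
    (hM : 0 < M) :
    ∃ S₀ θ₀ m : ℝ, 0 ≤ S₀ ∧ 0 < m ∧ ∀ θ : ℝ, θ₀ ≤ θ → ∀ f g : ℝ → ℝ, Continuous f → Continuous g →
      (∀ x, |f x| ≤ M * (1 + |x| ^ q)) → (∀ x, |g x| ≤ M * (1 + |x|)) →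
      ∀ (s₀ : ℝ) (w : ℝ → Space N → ℝ) (G : ℝ → Space N → Space N) (ws : ℝ → Space N → ℝ),
      IsSolution N p f g s₀ w G ws →
      ∀ r : ℝ, 0 < r → r < 1 → ∀ χ k : Space N → ℝ, IsCutoff N r χ k →
      ∀ a b : ℝ, s₀ ≤ a → S₀ ≤ a → a ≤ b → Integrable (fun y => |w a y| ^ (p + 1)) (mu N r) →
      localFunctional p q θ r f χ w G ws b - localFunctional p q θ r f χ w G ws a
        ≤ ∫ t in a..b, (-alpha N p * (∫ y, (dissipationCoeff p χ).eval y (stateAt w G ws t y)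
            (stateAt w G ws t y) ∂(mu N r))
          + m * ∫ y, (layerCoeff p k).eval y (stateAt w G ws t y) (stateAt w G ws t y)
            ∂(mu N r)) := by
  obtain ⟨C, ε₁, hC, hε₁, key⟩ := exists_instantaneous_le (N := N) hα hp hq hqp hM
  have hγ := gam_pos hp hqp
  set γ := gam p q with hγdef
  set V := volume.real (unitBall N) with hV
  have hV0 : 0 ≤ V := measureReal_nonneg
  set m := Real.exp ((p + 3) / (2 * γ)) with hm
  have hm0 : 0 < m := Real.exp_pos _
  -- Past `S₀` the time is nonnegative, as the growth bounds require, and `e^{-γt} ≤ ε₁`. The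
  -- constant `m` bounds the integrating factor, and `θ₀` makes the decrease `2γθ e^{-2γt}` of the
  -- last term of `H` cover the remainder `m C V e^{-2γt}`.
  refine ⟨max 0 (-Real.log ε₁ / γ), m * C * V / (2 * γ), m, le_max_left _ _, hm0, ?_⟩
  intro θ hθ f g hf hg hfM hgM s₀ w G ws sol r hr0 hr χ k hχ a b ha hSa hab h0
  have ha0 : 0 ≤ a := (le_max_left _ _).trans hSa
  obtain ⟨hP, hPae⟩ := isPrimitiveOn_potential hα hr0 hr hp hq hqp hM hf hg hfM hgM sol hχ ha ha0
    hab h0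
  have hE := isPrimitiveOn_energy hα hr0 hr hp hf hg sol hχ ha hab
  have hJ := isPrimitiveOn_cross hα hr0 hr hp hf hg sol hχ ha hab
  have d1 : ∀ t, HasDerivAt (fun t => Real.exp (-(γ * t))) (-γ * Real.exp (-(γ * t))) t :=
    fun t => ((hasDerivAt_id' t).const_mul γ).neg.exp.congr_deriv
      (by simp only [Pi.neg_apply]; ring)
  have d2 : ∀ t, HasDerivAt (fun t => Real.exp ((p + 3) / (2 * γ) * Real.exp (-(γ * t))))
      (Real.exp ((p + 3) / (2 * γ) * Real.exp (-(γ * t))) *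
        ((p + 3) / (2 * γ) * (-γ * Real.exp (-(γ * t))))) t :=
    fun t => ((d1 t).const_mul _).exp
  have d3 : ∀ t, HasDerivAt (fun t => θ * Real.exp (-(2 * γ * t)))
      (θ * (-(2 * γ) * Real.exp (-(2 * γ * t)))) t :=
    fun t => (((hasDerivAt_id' t).const_mul (2 * γ)).neg.exp.congr_deriv
      (by simp only [Pi.neg_apply]; ring)).const_mul θ
  have hU := ((((hE.add (hP.const_mul (-1))).add
    ((hJ.smooth_mul hab d1 (by fun_prop)).const_mul (-1))).smooth_mul hab d2 (by fun_prop)).add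
    (IsPrimitiveOn.of_hasDerivAt (a := a) (b := b) d3 (by fun_prop)))
  have hsub := hU.sub_eq hab
  have e0 : ∀ t, localFunctional p q θ r f χ w G ws t
      = Real.exp ((p + 3) / (2 * γ) * Real.exp (-(γ * t))) *
        ((∫ y, (energyCoeff p χ).eval y (stateAt w G ws t y) (stateAt w G ws t y) ∂(mu N r))
          + -1 * (∫ y, χ y * rho N p y * potential p f t (w t y) ∂(mu N r))
          + -1 * (Real.exp (-(γ * t)) * ∫ y, (crossCoeff p χ).eval y (stateAt w G ws t y)
            (stateAt w G ws t y) ∂(mu N r)))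
        + θ * Real.exp (-(2 * γ * t)) := fun t => by
    rw [localFunctional]; ring
  rw [e0 b, e0 a, hsub]
  have iD := intervalIntegrable_form hα hr0 hr sol.continuousInH (hχ.dissipationCoeff (p := p) hr)
    ha hab
  have iL := intervalIntegrable_form hα hr0 hr sol.continuousInH (hχ.layerCoeff (p := p) hr)
    ha hab
  rw [intervalIntegral.integral_of_le hab, intervalIntegral.integral_of_le hab]
  refine setIntegral_mono_ae_restrict
    ((intervalIntegrable_iff_integrableOn_Ioc_of_le hab).1 hU.integrable)
    ((intervalIntegrable_iff_integrableOn_Ioc_of_le hab).1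
      ((iD.const_mul _).add (iL.const_mul m))) ?_
  have h1 := ae_restrict_of_ae_restrict_of_subset
      (Ioc_subset_Icc_self.trans (Icc_subset_Icc_left ha) : Ioc a b ⊆ Icc s₀ b)
      (ae_memLp_source hα hr0 hr hf hg sol b)
  filter_upwards [h1, hPae, ae_restrict_mem measurableSet_Ioc] with t hS hA ht
  have hst : s₀ ≤ t := ha.trans ht.1.le
  have ht0 : 0 ≤ t := ha0.trans ht.1.le
  have hu := memLp_stateAt hα hr0 hr sol.continuousInH hst
  have hgrad := (sol.continuousInH.mem t hst).weakGradient.hasGradOn hr.le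
  have hεs : Real.exp (-(γ * t)) ≤ ε₁ := by
    rw [← Real.le_log_iff_exp_le hε₁]
    have h2 : -Real.log ε₁ / γ ≤ t := ((le_max_right _ _).trans hSa).trans ht.1.le
    rw [div_le_iff₀ hγ] at h2
    linarith
  have hk := key f g hf hfM hgM r hr χ k hχ (stateAt w G ws t) hu hgrad t ht0 _ rfl hεs hS hA.1 hA.2
  have hD0 := dissipation_eval_nonneg (p := p) hr hχ (stateAt w G ws t)
  have hL0 := layer_eval_nonneg (p := p) hr hχ (stateAt w G ws t)
  have hX := integral_cutoff_le hα hr hχ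
  have hε1 : Real.exp (-(γ * t)) ≤ 1 := Real.exp_le_one_iff.2 (by nlinarith)
  have hε0 := Real.exp_pos (-(γ * t))
  have eg : Real.exp (-(2 * γ * t)) = Real.exp (-(γ * t)) ^ 2 := exp_two_gam t
  simp only [eg]
  set ε := Real.exp (-(γ * t)) with hε
  set mt := Real.exp ((p + 3) / (2 * γ) * ε) with hmt
  have hmt1 : 1 ≤ mt := Real.one_le_exp (by positivity)
  have hmtm : mt ≤ m := Real.exp_le_exp.2 (mul_le_of_le_one_right (by positivity) hε1)
  have h5 := mul_le_mul_of_nonneg_left hk (by linarith : 0 ≤ mt)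
  -- The logarithmic derivative of the integrating factor, which is the multiple of the energy for
  -- which the instantaneous estimate was set up.
  have eγ : (p + 3) / (2 * γ) * (-γ * ε) = -((p + 3) / 2 * ε) := by field_simp
  rw [eγ]
  generalize (∫ y, (dissipationCoeff p χ).eval y (stateAt w G ws t y)
    (stateAt w G ws t y) ∂(mu N r)) = D at *
  generalize (∫ y, (layerCoeff p k).eval y (stateAt w G ws t y)
    (stateAt w G ws t y) ∂(mu N r)) = L at *
  generalize (∫ y, χ y * rho N p y ∂(mu N r)) = X at *
  -- The integrating factor lies between `1` and `m`: the lower bound preserves the full constant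
  -- `α` in front of the dissipation, the upper bound serves the error terms.
  have h6 : 0 ≤ (mt - 1) * (alpha N p * D) := mul_nonneg (by linarith) (by positivity)
  have h7 : 0 ≤ (m - mt) * L := mul_nonneg (by linarith) hL0
  have h8 : mt * (C * ε ^ 2 * X) ≤ 2 * γ * θ * ε ^ 2 := by
    have h9 : mt * (C * ε ^ 2 * X) ≤ m * (C * ε ^ 2 * V) := by
      have : C * ε ^ 2 * X ≤ C * ε ^ 2 * V := by gcongr
      refine (mul_le_mul_of_nonneg_left this (by linarith)).trans ?_
      gcongr
    rw [div_le_iff₀ (by positivity)] at hθ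
    have h10 := mul_le_mul_of_nonneg_right hθ (sq_nonneg ε)
    linarith
  simp only [source_eq]
  linarith only [h5, h6, h7, h8]

end

/-! ### Cutoffs approaching the sphere, and the Hardy inequality. -/

section

variable {N : ℕ} {p r s₀ q M : ℝ}

section Cutoff

/-- A smooth radial cutoff that vanishes for `c (1 - |y|²) ≤ 1` and equals `1` for
`c (1 - |y|²) ≥ 2`. -/
def cutoff (N : ℕ) (c : ℝ) (y : Space N) : ℝ := Real.smoothTransition (c * (1 - ‖y‖ ^ 2) - 1)

/-- The slope of `cutoff`. -/
def cutoffSlope (N : ℕ) (c : ℝ) (y : Space N) : ℝ :=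
  2 * c * deriv Real.smoothTransition (c * (1 - ‖y‖ ^ 2) - 1)

/-- A radius containing the support of `cutoff`. -/
def cutoffRadius (c : ℝ) : ℝ := √(1 - 1 / (2 * c))

lemma cutoffRadius_pos {c : ℝ} (hc : 1 ≤ c) : 0 < cutoffRadius c := by
  refine Real.sqrt_pos.2 ?_
  have : 1 / (2 * c) < 1 := by rw [div_lt_one (by linarith)]; linarith
  linarith

lemma cutoffRadius_lt_one {c : ℝ} (hc : 1 ≤ c) : cutoffRadius c < 1 := by
  rw [cutoffRadius, Real.sqrt_lt' one_pos]
  have : 0 < 1 / (2 * c) := by positivity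
  linarith

lemma contDiff_smoothTransition : ContDiff ℝ ∞ Real.smoothTransition := Real.smoothTransition.contDiff

lemma continuous_deriv_smoothTransition : Continuous (deriv Real.smoothTransition) :=
  contDiff_smoothTransition.continuous_deriv (by simp)

lemma deriv_smoothTransition_nonneg (x : ℝ) : 0 ≤ deriv Real.smoothTransition x :=
  Real.smoothTransition.monotone.deriv_nonneg

lemma deriv_smoothTransition_eq_zero {x : ℝ} (hx : x < 0 ∨ 1 < x) :
    deriv Real.smoothTransition x = 0 := by
  rcases hx with h | h
  · have : Real.smoothTransition =ᶠ[𝓝 x] fun _ => 0 := by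
      filter_upwards [Iio_mem_nhds h] with z hz
      exact Real.smoothTransition.zero_of_nonpos (le_of_lt hz)
    rw [this.deriv_eq]; simp
  · have : Real.smoothTransition =ᶠ[𝓝 x] fun _ => 1 := by
      filter_upwards [Ioi_mem_nhds h] with z hz
      exact Real.smoothTransition.one_of_one_le (le_of_lt hz)
    rw [this.deriv_eq]; simp

lemma isCutoff_cutoff {c : ℝ} (hc : 1 ≤ c) :
    IsCutoff N (cutoffRadius c) (cutoff N c) (cutoffSlope N c) := by
  have hsm : ContDiff ℝ ∞ (cutoff N c) := contDiff_smoothTransition.comp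
    ((contDiff_const.mul contDiff_one_sub_normSq).sub contDiff_const)
  have hsupp : tsupport (cutoff N c) ⊆ Metric.closedBall 0 (√(1 - 1 / c)) := by
    refine closure_minimal (fun y hy => ?_) Metric.isClosed_closedBall
    rw [mem_closedBall_zero_iff]
    refine Real.le_sqrt_of_sq_le ?_
    by_contra hcon
    refine hy (Real.smoothTransition.zero_of_nonpos ?_)
    have h1 : 1 - ‖y‖ ^ 2 < 1 / c := by linarith [not_le.1 hcon]
    rw [lt_div_iff₀ (by linarith)] at h1
    linarith
  -- The closed support reaches the radius `√(1 - 1/c)`, so the radius is taken slightly larger,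
  -- with `2c` in place of `c`, to have it inside an open ball.
  have hlt : √(1 - 1 / c) < cutoffRadius c := by
    refine Real.sqrt_lt_sqrt ?_ ?_
    · have : 1 / c ≤ 1 := by rw [div_le_one (by linarith)]; exact hc
      linarith
    · have : 1 / (2 * c) < 1 / c := one_div_lt_one_div_of_lt (by linarith) (by linarith)
      linarith
  refine ⟨⟨hsm, ?_, hsupp.trans (Metric.closedBall_subset_ball hlt)⟩, ?_, fun y => ?_,
    fun y => Real.smoothTransition.nonneg _, fun y => Real.smoothTransition.le_one _, fun y => ?_⟩
  · exact (isCompact_closedBall (0 : Space N) _).of_isClosed_subset (isClosed_tsupport _) hsupp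
  · exact continuous_const.mul (continuous_deriv_smoothTransition.comp
      ((continuous_const.mul continuous_one_sub_normSq).sub continuous_const))
  · have h1 : HasDerivAt (fun z => Real.smoothTransition (c * z - 1))
        (deriv Real.smoothTransition (c * (1 - ‖y‖ ^ 2) - 1) * c) (1 - ‖y‖ ^ 2) := by
      refine ((contDiff_smoothTransition.differentiable (by simp) _).hasDerivAt).comp _ ?_
      exact (((hasDerivAt_id' (1 - ‖y‖ ^ 2)).const_mul c).sub_const 1).congr_deriv (mul_one c)
    rw [show cutoff N c = fun y => Real.smoothTransition (c * (1 - ‖y‖ ^ 2) - 1) from rfl,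
      (hasGradientAt_comp_one_sub_normSq y h1).gradient, cutoffSlope]
    congr 1; ring
  · have := deriv_smoothTransition_nonneg (c * (1 - ‖y‖ ^ 2) - 1)
    rw [cutoffSlope]
    positivity

lemma cutoffSlope_eq_zero {c : ℝ} {y : Space N}
    (h : c * (1 - ‖y‖ ^ 2) < 1 ∨ 2 < c * (1 - ‖y‖ ^ 2)) : cutoffSlope N c y = 0 := by
  rw [cutoffSlope, deriv_smoothTransition_eq_zero, mul_zero]
  rcases h with h | h
  · left; linarith
  · right; linarith

/-- The slope grows like `c` but vanishes unless `1 ≤ c(1-|y|²) ≤ 2`, so its product with `1-|y|²`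
is bounded independently of `c`. -/
lemma exists_cutoffSlope_mul_le (N : ℕ) : ∃ K : ℝ, 0 ≤ K ∧ ∀ c : ℝ, ∀ y : Space N,
    cutoffSlope N c y * (1 - ‖y‖ ^ 2) ≤ K := by
  obtain ⟨K, hK⟩ := (isCompact_Icc (a := (0 : ℝ)) (b := 1)).exists_bound_of_continuousOn
    continuous_deriv_smoothTransition.continuousOn
  have hK0 : 0 ≤ K := (norm_nonneg _).trans (hK 0 ⟨le_rfl, zero_le_one⟩)
  refine ⟨4 * K, by positivity, fun c y => ?_⟩
  by_cases h : c * (1 - ‖y‖ ^ 2) < 1 ∨ 2 < c * (1 - ‖y‖ ^ 2)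
  · rw [cutoffSlope_eq_zero h, zero_mul]; positivity
  · obtain ⟨h1, h2⟩ := not_or.1 h
    rw [not_lt] at h1 h2
    have h3 := hK (c * (1 - ‖y‖ ^ 2) - 1) ⟨by linarith, by linarith⟩
    rw [Real.norm_of_nonneg (deriv_smoothTransition_nonneg _)] at h3
    have h4 := deriv_smoothTransition_nonneg (c * (1 - ‖y‖ ^ 2) - 1)
    rw [cutoffSlope]
    nlinarith

lemma eventually_two_lt {y : Space N} (hy : y ∈ unitBall N) :
    ∀ᶠ n : ℕ in atTop, 2 < ((n : ℝ) + 1) * (1 - ‖y‖ ^ 2) := by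
  have hd := one_sub_normSq_pos hy
  exact ((tendsto_natCast_atTop_atTop.atTop_add tendsto_const_nhds).atTop_mul_const hd
    |>.eventually_gt_atTop 2)

lemma tendsto_cutoff {y : Space N} (hy : y ∈ unitBall N) :
    Tendsto (fun n : ℕ => cutoff N ((n : ℝ) + 1) y) atTop (𝓝 1) := by
  refine tendsto_const_nhds.congr' ?_
  filter_upwards [eventually_two_lt hy] with n hn
  exact (Real.smoothTransition.one_of_one_le (by linarith)).symm

lemma tendsto_cutoffSlope {y : Space N} (hy : y ∈ unitBall N) :
    Tendsto (fun n : ℕ => cutoffSlope N ((n : ℝ) + 1) y) atTop (𝓝 0) := by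
  refine tendsto_const_nhds.congr' ?_
  filter_upwards [eventually_two_lt hy] with n hn
  exact (cutoffSlope_eq_zero (Or.inr hn)).symm

lemma tendsto_integral_cutoff_mul {F : Space N → ℝ} (hF : IntegrableOn F (unitBall N)) :
    Tendsto (fun n : ℕ => ∫ y in unitBall N, cutoff N ((n : ℝ) + 1) y * F y) atTop
      (𝓝 (∫ y in unitBall N, F y)) := by
  refine tendsto_integral_of_dominated_convergence (fun y => ‖F y‖) (fun n => ?_) hF.norm
    (fun n => ae_of_all _ fun y => ?_) ?_
  · exact ((isCutoff_cutoff (N := N) (c := (n : ℝ) + 1)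
      (by linarith [(Nat.cast_nonneg n : (0 : ℝ) ≤ n)])).test.smooth.continuous.aestronglyMeasurable).mul
      hF.aestronglyMeasurable
  · rw [norm_mul]
    refine mul_le_of_le_one_left (norm_nonneg _) ?_
    rw [cutoff, Real.norm_of_nonneg (Real.smoothTransition.nonneg _)]
    exact Real.smoothTransition.le_one _
  · filter_upwards [ae_restrict_mem measurableSet_unitBall] with y hy
    simpa using (tendsto_cutoff hy).mul_const (F y)

lemma IsCutoff.slope_eq_zero {χ k : Space N → ℝ} (h : IsCutoff N r χ k) (hr0 : 0 < r)
    {y : Space N} (hy : y ∉ Metric.ball (0 : Space N) r) : k y = 0 := by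
  have h1 := h.grad y
  rw [h.test.gradient_eq_zero hy] at h1
  rcases smul_eq_zero.1 h1.symm with h2 | h2
  · linarith
  · exact absurd (h2 ▸ Metric.mem_ball_self hr0) hy

end Cutoff

section Limits

variable {α : Type*} [MeasurableSpace α] {μ : Measure α}

/-- Fatou's lemma for integrals of nonnegative functions. -/
lemma integrable_and_integral_le_of_tendsto {F : ℕ → α → ℝ} {f : α → ℝ}
    (hF : ∀ n, Integrable (F n) μ) (h0 : ∀ n, 0 ≤ᵐ[μ] F n)
    (hlim : ∀ᵐ y ∂μ, Tendsto (fun n => F n y) atTop (𝓝 (f y))) {B : ℕ → ℝ} {b : ℝ}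
    (hB : ∀ n, ∫ y, F n y ∂μ ≤ B n) (hb : Tendsto B atTop (𝓝 b)) :
    Integrable f μ ∧ ∫ y, f y ∂μ ≤ b := by
  have hm : AEStronglyMeasurable f μ := aestronglyMeasurable_of_tendsto_ae _ (fun n => (hF n).1) hlim
  have hf0 : 0 ≤ᵐ[μ] f := by
    filter_upwards [ae_all_iff.2 h0, hlim] with y h1 h2
    exact ge_of_tendsto' h2 h1
  have hb0 : 0 ≤ b := ge_of_tendsto' hb fun n => (integral_nonneg_of_ae (h0 n)).trans (hB n)
  have key : ∫⁻ y, ENNReal.ofReal (f y) ∂μ ≤ ENNReal.ofReal b := by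
    calc ∫⁻ y, ENNReal.ofReal (f y) ∂μ
        = ∫⁻ y, liminf (fun n => ENNReal.ofReal (F n y)) atTop ∂μ := by
          refine lintegral_congr_ae ?_
          filter_upwards [hlim] with y hy
          exact ((ENNReal.continuous_ofReal.tendsto _).comp hy).liminf_eq.symm
      _ ≤ liminf (fun n => ∫⁻ y, ENNReal.ofReal (F n y) ∂μ) atTop :=
          lintegral_liminf_le' fun n => (hF n).1.aemeasurable.ennreal_ofReal
      _ ≤ liminf (fun n => ENNReal.ofReal (B n)) atTop := by
          refine liminf_le_liminf (Eventually.of_forall fun n => ?_)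
          rw [← ofReal_integral_eq_lintegral_ofReal (hF n) (h0 n)]
          exact ENNReal.ofReal_le_ofReal (hB n)
      _ = ENNReal.ofReal b := ((ENNReal.continuous_ofReal.tendsto _).comp hb).liminf_eq
  have hi : Integrable f μ := by
    refine ⟨hm, ?_⟩
    rw [hasFiniteIntegral_iff_ofReal hf0]
    exact key.trans_lt ENNReal.ofReal_lt_top
  refine ⟨hi, ?_⟩
  rw [← ofReal_integral_eq_lintegral_ofReal hi hf0] at key
  exact (ENNReal.ofReal_le_ofReal_iff hb0).1 key

end Limits

section Hardy

variable {w : Space N → ℝ} {G : Space N → Space N} {v : Space N → ℝ}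

/-- The density that controls the error caused by the cutoff. -/
def layerDensity (N : ℕ) (p : ℝ) (w : Space N → ℝ) (G : Space N → Space N) (y : Space N) : ℝ :=
  ((1 - ‖y‖ ^ 2) * ‖G y‖ ^ 2 + 3 * (w y ^ 2 / (1 - ‖y‖ ^ 2))) * rho N p y

/-- A localized Hardy inequality. -/
lemma IsCutoff.hardy {χ k : Space N → ℝ} (hα : 0 < alpha N p) (hp : 1 < p) (hr0 : 0 < r)
    (hr : r < 1) (hχ : IsCutoff N r χ k) (h : MemH N p w G v) :
    IntegrableOn (fun y => χ y * (w y ^ 2 / (1 - ‖y‖ ^ 2) * rho N p y)) (unitBall N) ∧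
    alpha N p * ∫ y in unitBall N, χ y * (w y ^ 2 / (1 - ‖y‖ ^ 2) * rho N p y)
      ≤ (1 / alpha N p + (p + 3) / (p - 1)) * ∫ y in unitBall N, normDensity N p w G v y := by
  have hx := h.memLp hα hr0 hr
  have hgrad := h.weakGradient.hasGradOn hr.le
  have cχ := hχ.test.smooth.continuous.continuousOn (s := Metric.closedBall 0 r)
  have cχρ := hχ.continuousOn_mul_rho (p := p) hr
  have hd := continuousOn_inv_one_sub_normSq (N := N) hr
  have cn : ContinuousOn (fun y : Space N => ‖y‖ ^ 2) (Metric.closedBall 0 r) :=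
    (continuous_norm.pow 2).continuousOn
  have hp1 : 0 < p - 1 := by linarith
  have i1 : Integrable (fun y => χ y * (w y ^ 2 / (1 - ‖y‖ ^ 2) * rho N p y)) (mu N r) := by
    refine ((memLp_mul_continuous (cχρ.mul hd) hx.fst).integrable_mul hx.fst).congr
      (ae_of_all _ fun y => ?_)
    simp only [smul_eq_mul, Pi.mul_apply, div_eq_mul_inv]; ring
  have hz : ∀ y ∉ Metric.ball (0 : Space N) r,
      χ y * (w y ^ 2 / (1 - ‖y‖ ^ 2) * rho N p y) = 0 := fun y hy => by
    rw [hχ.test.eq_zero hy, zero_mul]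
  refine ⟨?_, ?_⟩
  · have hB : MeasurableSet (Metric.ball (0 : Space N) r) := Metric.isOpen_ball.measurableSet
    exact (IntegrableOn.integrable_of_forall_notMem_eq_zero (s := Metric.ball (0 : Space N) r) i1
      hz).integrableOn
  rw [integral_unitBall_eq hr.le hz]
  have i7 : Integrable (fun y => χ y * rho N p y * (w y * ⟪y, G y⟫)) (mu N r) := by
    refine ((memLp_mul_continuous cχρ hx.fst).integrable_mul
      (memLp_inner_continuous continuous_id.continuousOn hx.snd.snd)).congr
      (ae_of_all _ fun y => ?_)
    simp [mul_assoc]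
  have i8 : Integrable (fun y => rho N p y * (χ y * ((p + 3) / (p - 1)
      - 2 * alpha N p / (1 - ‖y‖ ^ 2)) - k y * ‖y‖ ^ 2) * w y ^ 2) (mu N r) := by
    have c : ContinuousOn (fun y => rho N p y * (χ y * ((p + 3) / (p - 1)
      - 2 * alpha N p * (1 - ‖y‖ ^ 2)⁻¹) - k y * ‖y‖ ^ 2)) (Metric.closedBall (0 : Space N) r) :=
      (continuousOn_rho hr).mul ((cχ.mul (continuousOn_const.sub (hd.const_mul _))).sub
        (hχ.cont.continuousOn.mul cn))
    refine ((memLp_mul_continuous c hx.fst).integrable_mul hx.fst).congr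
      (ae_of_all _ fun y => ?_)
    simp only [smul_eq_mul, Pi.mul_apply, div_eq_mul_inv]; ring
  have hardy := hχ.integral_radial hp hr hgrad hx.fst hx.snd.snd
  have i9 : Integrable (normDensity N p w G v) (mu N r) :=
    h.finite.mono_set (ball_subset_unitBall hr.le)
  -- In the radial identity, half of the term `2α w²/(1-|y|²)` absorbs `2 w y·∇w` at the cost of
  -- `(1-|y|²)|∇w|²/α`; the layer term has a favourable sign.
  have main := ((HasLebesgueIntegral.of_integrable i1).const_mul (alpha N p)).le
    (((HasLebesgueIntegral.of_integrable i9).const_mul (1 / alpha N p + (p + 3) / (p - 1))).sub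
      (((HasLebesgueIntegral.of_integrable i7).const_mul 2).add
        (HasLebesgueIntegral.of_integrable i8))) (by
      filter_upwards [ae_restrict_mem Metric.isOpen_ball.measurableSet] with y hy
      have hy' := ball_subset_unitBall hr.le hy
      have hd0 := one_sub_normSq_pos hy'
      have hρ := rho_pos (p := p) hy'
      have hχ0 := hχ.nonneg y
      have hk := hχ.k_nonneg y
      have hRg : ⟪y, G y⟫ ^ 2 ≤ ‖G y‖ ^ 2 := by
        rw [← sq_abs]
        have h1 := abs_real_inner_le_norm y (G y)
        have h2 : ‖y‖ ≤ 1 := (mem_ball_zero_iff.1 hy').le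
        exact pow_le_pow_left₀ (abs_nonneg _)
          (h1.trans (mul_le_of_le_one_left (norm_nonneg _) h2)) 2
      set d := 1 - ‖y‖ ^ 2 with hdd
      have q6 : 2 * |w y * ⟪y, G y⟫| ≤ alpha N p * (w y ^ 2 / d)
          + 1 / alpha N p * (‖G y‖ ^ 2 * d) := by
        refine two_mul_le_add_of_sq_le (by positivity) (by positivity) ?_
        have : alpha N p * (w y ^ 2 / d) * (1 / alpha N p * (‖G y‖ ^ 2 * d))
            = w y ^ 2 * ‖G y‖ ^ 2 := by field_simp
        rw [this, mul_pow]; gcongr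
      have q7 := le_abs_self (w y * ⟪y, G y⟫)
      have q8 : 0 ≤ alpha N p * (w y ^ 2 / d) + 1 / alpha N p * (‖G y‖ ^ 2 * d)
          - 2 * (w y * ⟪y, G y⟫) := by linarith
      have q9 := mul_nonneg (by positivity : 0 ≤ χ y * rho N p y) q8
      have q10 : 0 ≤ rho N p y * (k y * ‖y‖ ^ 2) * w y ^ 2 := by positivity
      have q11 : 0 ≤ (1 - χ y) * (rho N p y * ((1 / alpha N p) * (‖G y‖ ^ 2 * d)
          + (p + 3) / (p - 1) * w y ^ 2)) :=
        mul_nonneg (by linarith [hχ.le_one y]) (by positivity)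
      have q12 : 0 ≤ rho N p y * ((p + 3) / (p - 1) * (v y ^ 2 + ‖G y‖ ^ 2 * d)
          + 1 / alpha N p * (v y ^ 2 + w y ^ 2)) := by positivity
      simp only [normDensity, ← hdd]
      simp only [div_eq_mul_inv] at q9 q11 q12 ⊢
      linarith only [q9, q10, q11, q12])
  have hle : ∫ y, normDensity N p w G v y ∂(mu N r) ≤ ∫ y in unitBall N, normDensity N p w G v y := by
    refine setIntegral_mono_set h.finite ?_ (ball_subset_unitBall hr.le).eventuallyLE
    filter_upwards [ae_restrict_mem measurableSet_unitBall] with y hy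
    exact normDensity_nonneg hy
  have hle' := mul_le_mul_of_nonneg_left hle
    (by positivity : 0 ≤ 1 / alpha N p + (p + 3) / (p - 1))
  linarith

/-- The bound in `IsCutoff.hardy` does not depend on the cutoff, so Fatou's lemma extends it to the
whole ball. The gradient part is already contained in the norm of `ℋ`. -/
theorem MemH.integrableOn_layerDensity (hα : 0 < alpha N p) (hp : 1 < p) (h : MemH N p w G v) :
    IntegrableOn (layerDensity N p w G) (unitBall N) ∧
    ∫ y in unitBall N, layerDensity N p w G y
      ≤ (1 + 3 * ((1 / alpha N p + (p + 3) / (p - 1)) / alpha N p))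
        * ∫ y in unitBall N, normDensity N p w G v y := by
  have hp1 : 0 < p - 1 := by linarith
  have hn : ∀ n : ℕ, (1 : ℝ) ≤ (n : ℝ) + 1 := fun n => by
    linarith [(Nat.cast_nonneg n : (0 : ℝ) ≤ n)]
  have hH := fun n : ℕ => (isCutoff_cutoff (N := N) (hn n)).hardy hα hp (cutoffRadius_pos (hn n))
    (cutoffRadius_lt_one (hn n)) h
  obtain ⟨i1, b1⟩ := integrable_and_integral_le_of_tendsto
    (μ := volume.restrict (unitBall N)) (fun n => (hH n).1)
    (fun n => by
      filter_upwards [ae_restrict_mem measurableSet_unitBall] with y hy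
      have h1 := one_sub_normSq_pos hy
      have h2 := rho_pos (p := p) hy
      have h3 := (isCutoff_cutoff (N := N) (hn n)).nonneg y
      exact mul_nonneg h3 (by positivity))
    (f := fun y => w y ^ 2 / (1 - ‖y‖ ^ 2) * rho N p y)
    (by
      filter_upwards [ae_restrict_mem measurableSet_unitBall] with y hy
      simpa using (tendsto_cutoff hy).mul_const (w y ^ 2 / (1 - ‖y‖ ^ 2) * rho N p y))
    (fun n => (le_div_iff₀' hα).2 (hH n).2) tendsto_const_nhds
  have hm := h.aestronglyMeasurable
  have i2 : IntegrableOn (fun y => (1 - ‖y‖ ^ 2) * ‖G y‖ ^ 2 * rho N p y) (unitBall N) := by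
    refine h.finite.mono' ((continuous_one_sub_normSq.aestronglyMeasurable.mul
      (hm.snd.snd.norm.pow 2)).mul measurable_rho.aestronglyMeasurable) ?_
    filter_upwards [ae_restrict_mem measurableSet_unitBall] with y hy
    have h1 := one_sub_normSq_pos hy
    have h2 := rho_pos (p := p) hy
    rw [Real.norm_of_nonneg (by positivity), normDensity]
    refine mul_le_mul_of_nonneg_right ?_ h2.le
    nlinarith [sq_nonneg (v y), sq_nonneg (w y)]
  have b2 : ∫ y in unitBall N, (1 - ‖y‖ ^ 2) * ‖G y‖ ^ 2 * rho N p y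
      ≤ ∫ y in unitBall N, normDensity N p w G v y := by
    refine integral_mono_ae i2 h.finite ?_
    filter_upwards [ae_restrict_mem measurableSet_unitBall] with y hy
    have h2 := rho_pos (p := p) hy
    rw [normDensity]
    refine mul_le_mul_of_nonneg_right ?_ h2.le
    nlinarith [sq_nonneg (v y), sq_nonneg (w y)]
  have e := (HasLebesgueIntegral.of_integrable i2).add
    ((HasLebesgueIntegral.of_integrable i1).const_mul 3)
  have ef : layerDensity N p w G = fun y => (1 - ‖y‖ ^ 2) * ‖G y‖ ^ 2 * rho N p y
      + 3 * (w y ^ 2 / (1 - ‖y‖ ^ 2) * rho N p y) := funext fun y => by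
    rw [layerDensity]; ring
  rw [ef]
  refine ⟨e.integrable, e.eq.le.trans ?_⟩
  have e2 : (1 / alpha N p + (p + 3) / (p - 1)) * (∫ y in unitBall N, normDensity N p w G v y)
      / alpha N p = (1 / alpha N p + (p + 3) / (p - 1)) / alpha N p
      * ∫ y in unitBall N, normDensity N p w G v y := by ring
  rw [e2] at b1
  linarith

end Hardy

lemma normDensity_neg {w₁ w₂ : Space N → ℝ} {G : Space N → Space N} :
    normDensity N p (-w₁) (-G) (-w₂) = normDensity N p w₁ G w₂ := by
  funext y; simp [normDensity]

/-- The norm in `ℋ` is bounded on compact time intervals. -/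
lemma ContinuousInH.exists_bound {w : ℝ → Space N → ℝ} {G : ℝ → Space N → Space N}
    {ws : ℝ → Space N → ℝ} (h : ContinuousInH N p s₀ w G ws) {a b : ℝ} (ha : s₀ ≤ a) :
    ∃ B : ℝ, ∀ t ∈ Icc a b, ∫ y in unitBall N, normDensity N p (w t) (G t) (ws t) y ≤ B := by
  -- Continuity is available as convergence of squared distances only, so boundedness is proved
  -- locally, from the triangle inequality around each time, and then spread by compactness.
  refine (isCompact_Icc (a := a) (b := b)).induction_on
    (p := fun s => ∃ B : ℝ, ∀ t ∈ s, ∫ y in unitBall N, normDensity N p (w t) (G t) (ws t) y ≤ B)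
    ⟨0, by simp⟩ (fun s t hst ⟨B, hB⟩ => ⟨B, fun x hx => hB x (hst hx)⟩)
    (fun s t ⟨B, hB⟩ ⟨B', hB'⟩ => ⟨max B B', fun x hx => ?_⟩) (fun s hs => ?_)
  · rcases hx with hx | hx
    · exact (hB x hx).trans (le_max_left _ _)
    · exact (hB' x hx).trans (le_max_right _ _)
  have hs0 : s₀ ≤ s := ha.trans hs.1
  have hsub : Icc a b ⊆ Ici s₀ := fun t ht => ha.trans ht.1
  have h1 : ∀ᶠ t in 𝓝[Icc a b] s, ∫ y in unitBall N,
      normDensity N p (w t - w s) (G t - G s) (ws t - ws s) y < 1 :=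
    ((h.cont s hs0).mono_left (nhdsWithin_mono _ hsub)).eventually_lt_const one_pos
  refine ⟨{t | t ∈ Icc a b ∧ ∫ y in unitBall N,
      normDensity N p (w t - w s) (G t - G s) (ws t - ws s) y < 1},
    (eventually_mem_nhdsWithin.and h1 : _), 2 * 1 + 2 * ∫ y in unitBall N,
      normDensity N p (w s) (G s) (ws s) y, fun t ht => ?_⟩
  have hmt := h.mem t (hsub ht.1)
  have hms := h.mem s hs0
  have i1 := hmt.integrableOn_sub hms
  have h2 : ∫ y in unitBall N, normDensity N p (w t) (G t) (ws t) y
      ≤ ∫ y in unitBall N, (2 * normDensity N p (w t - w s) (G t - G s) (ws t - ws s) y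
        + 2 * normDensity N p (w s) (G s) (ws s) y) := by
    refine integral_mono_ae hmt.finite ((i1.const_mul 2).add (hms.finite.const_mul 2)) ?_
    filter_upwards [ae_restrict_mem measurableSet_unitBall] with y hy
    have h3 := normDensity_sub_le (p := p) (w₁ := w t - w s) (w₁' := -w s) (G := G t - G s)
      (G' := -G s) (w₂ := ws t - ws s) (w₂' := -ws s) hy
    rwa [normDensity_neg, sub_neg_eq_add, sub_neg_eq_add, sub_neg_eq_add, sub_add_cancel,
      sub_add_cancel, sub_add_cancel] at h3
  rw [integral_add (i1.const_mul 2) (hms.finite.const_mul 2), integral_const_mul,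
    integral_const_mul] at h2
  linarith [ht.2]

end

/-! ### Removal of the cutoff. -/

section

variable {N : ℕ} {p r s₀ q M : ℝ}

lemma one_le_natCast_add_one (n : ℕ) : (1 : ℝ) ≤ (n : ℝ) + 1 := by
  linarith [(Nat.cast_nonneg n : (0 : ℝ) ≤ n)]

section Limits

variable {α : Type*} [MeasurableSpace α] {μ : Measure α}

/-- A double application of Fatou's lemma. -/
lemma ae_liminf_lt_top {D : ℕ → α → ℝ} (hD : ∀ n, Integrable (D n) μ) (h0 : ∀ n, 0 ≤ᵐ[μ] D n)
    {B : ℕ → ℝ} {b : ℝ} (hB : ∀ n, ∫ t, D n t ∂μ ≤ B n) (hb : Tendsto B atTop (𝓝 b)) :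
    ∀ᵐ t ∂μ, liminf (fun n => ENNReal.ofReal (D n t)) atTop < ⊤ := by
  have hm : ∀ n, AEMeasurable (fun t => ENNReal.ofReal (D n t)) μ := fun n =>
    (hD n).1.aemeasurable.ennreal_ofReal
  have hae : (fun t => liminf (fun n => ENNReal.ofReal (D n t)) atTop)
      =ᵐ[μ] fun t => liminf (fun n => (hm n).mk _ t) atTop := by
    filter_upwards [ae_all_iff.2 fun n => (hm n).ae_eq_mk] with t ht
    simp only [ht]
  refine ae_lt_top' ⟨_, Measurable.liminf fun n => (hm n).measurable_mk, hae⟩ ?_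
  refine (lt_of_le_of_lt ?_ (ENNReal.ofReal_lt_top (r := b))).ne
  calc _ ≤ liminf (fun n => ∫⁻ t, ENNReal.ofReal (D n t) ∂μ) atTop := lintegral_liminf_le' hm
    _ ≤ liminf (fun n => ENNReal.ofReal (B n)) atTop := by
        refine liminf_le_liminf (Eventually.of_forall fun n => ?_)
        rw [← ofReal_integral_eq_lintegral_ofReal (hD n) (h0 n)]
        exact ENNReal.ofReal_le_ofReal (hB n)
    _ = ENNReal.ofReal b := ((ENNReal.continuous_ofReal.tendsto _).comp hb).liminf_eq

lemma integrable_of_liminf_lt_top {F : ℕ → α → ℝ} {f : α → ℝ}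
    (hF : ∀ n, Integrable (F n) μ) (h0 : ∀ n, 0 ≤ᵐ[μ] F n)
    (hlim : ∀ᵐ y ∂μ, Tendsto (fun n => F n y) atTop (𝓝 (f y)))
    (h : liminf (fun n => ENNReal.ofReal (∫ y, F n y ∂μ)) atTop < ⊤) : Integrable f μ := by
  have hm : AEStronglyMeasurable f μ := aestronglyMeasurable_of_tendsto_ae _ (fun n => (hF n).1) hlim
  have hf0 : 0 ≤ᵐ[μ] f := by
    filter_upwards [ae_all_iff.2 h0, hlim] with y h1 h2
    exact ge_of_tendsto' h2 h1
  refine ⟨hm, ?_⟩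
  rw [hasFiniteIntegral_iff_ofReal hf0]
  refine lt_of_le_of_lt ?_ h
  calc ∫⁻ y, ENNReal.ofReal (f y) ∂μ
      = ∫⁻ y, liminf (fun n => ENNReal.ofReal (F n y)) atTop ∂μ := by
        refine lintegral_congr_ae ?_
        filter_upwards [hlim] with y hy
        exact ((ENNReal.continuous_ofReal.tendsto _).comp hy).liminf_eq.symm
    _ ≤ liminf (fun n => ∫⁻ y, ENNReal.ofReal (F n y) ∂μ) atTop :=
        lintegral_liminf_le' fun n => (hF n).1.aemeasurable.ennreal_ofReal
    _ = _ := by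
        simp only [fun n => ofReal_integral_eq_lintegral_ofReal (hF n) (h0 n)]

end Limits

section Solution

variable {f g : ℝ → ℝ} {w : ℝ → Space N → ℝ} {G : ℝ → Space N → Space N}
  {ws : ℝ → Space N → ℝ} {χ k : Space N → ℝ}

lemma MemH.integrableOn_mul {w v : Space N → ℝ} {G : Space N → Space N} (h : MemH N p w G v) :
    IntegrableOn (fun y => w y * v y * rho N p y) (unitBall N) := by
  have hm := h.aestronglyMeasurable
  refine h.finite.mono' ((hm.fst.mul hm.snd.fst).mul measurable_rho.aestronglyMeasurable) ?_
  filter_upwards [ae_restrict_mem measurableSet_unitBall] with y hy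
  have h1 := one_sub_normSq_pos hy
  have h2 := rho_pos (p := p) hy
  rw [Real.norm_eq_abs, abs_mul, abs_of_pos h2, normDensity]
  refine mul_le_mul_of_nonneg_right ?_ h2.le
  rw [abs_le]
  have h3 : 0 ≤ ‖G y‖ ^ 2 * (1 - ‖y‖ ^ 2) := by positivity
  constructor <;> nlinarith [sq_nonneg (w y + v y), sq_nonneg (w y - v y)]

/-- On a smaller ball the quadratic part of the energy density is integrable and the weight is
bounded below, so absolute convergence of `E₀` forces that of the power term. This provides the
initial condition for the potential energy. -/
lemma WellDefinedAt.integrable_rpow (hα : 0 < alpha N p) (hp : 1 < p) (hr0 : 0 < r) (hr : r < 1)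
    {t : ℝ} (hH : MemH N p (w t) (G t) (ws t)) (h : WellDefinedAt N p f w G ws t) :
    Integrable (fun y => |w t y| ^ (p + 1)) (mu N r) := by
  have cρ : ContinuousOn (fun y : Space N => (1 : ℝ) * rho N p y) (Metric.closedBall 0 r) :=
    continuousOn_const.mul (continuousOn_rho hr)
  have hadm : (energyCoeff (N := N) p fun _ => 1).Admissible r :=
    ⟨cρ.const_mul _, continuousOn_const, cρ.const_mul _, cρ.const_mul _, cρ.const_mul _,
      continuousOn_const, continuousOn_const⟩
  have hx : MemLp (stateAt w G ws t) 2 (mu N r) := hH.memLp hα hr0 hr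
  have i1 := (hadm.integrable hr.le hx hx).sub (h.1.mono_set (ball_subset_unitBall hr.le))
  have cρi : ContinuousOn (fun y : Space N => (p + 1) * (rho N p y)⁻¹) (Metric.closedBall 0 r) :=
    ((continuousOn_rho hr).inv₀ fun y hy =>
      (rho_pos (closedBall_subset_unitBall hr hy)).ne').const_mul _
  obtain ⟨C, hC⟩ := (isCompact_closedBall (0 : Space N) r).exists_bound_of_continuousOn cρi
  refine (i1.bdd_mul (c := C) (aestronglyMeasurable_of_continuousOn_closedBall cρi) ?_).congr ?_
  · filter_upwards [ae_restrict_mem Metric.isOpen_ball.measurableSet] with y hy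
    exact hC y (Metric.ball_subset_closedBall hy)
  · filter_upwards [ae_restrict_mem Metric.isOpen_ball.measurableSet] with y hy
    have h2 := (rho_pos (p := p) (ball_subset_unitBall hr.le hy)).ne'
    have h3 : p + 1 ≠ 0 := by linarith
    have h4 : p - 1 ≠ 0 := by linarith
    simp only [Pi.sub_apply, Coeff.eval, energyCoeff, energyDensity, real_inner_self_eq_norm_sq]
    field_simp
    ring

/-- The combined density of `E₀` and `I`. -/
def totalDensity (N : ℕ) (p : ℝ) (f : ℝ → ℝ) (w : ℝ → Space N → ℝ) (G : ℝ → Space N → Space N)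
    (ws : ℝ → Space N → ℝ) (t : ℝ) (y : Space N) : ℝ :=
  energyDensity N p w G ws t y
    - Real.exp (-(2 * (p + 1) * t / (p - 1))) * potentialDensity N p f w t y

lemma WellDefinedAt.integrableOn_totalDensity {t : ℝ} (h : WellDefinedAt N p f w G ws t) :
    IntegrableOn (totalDensity N p f w G ws t) (unitBall N) :=
  h.1.sub (h.2.const_mul _)

lemma WellDefinedAt.H_eq {θ t : ℝ} (h : WellDefinedAt N p f w G ws t) :
    H N p q θ f w G ws t = ((∫ y in unitBall N, totalDensity N p f w G ws t y)
      - Real.exp (-(gam p q * t)) * ∫ y in unitBall N, w t y * ws t y * rho N p y)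
      * Real.exp ((p + 3) / (2 * gam p q) * Real.exp (-(gam p q * t)))
      + θ * Real.exp (-(2 * gam p q * t)) := by
  simp only [H, E, E₀, I, J, totalDensity]
  rw [integral_sub h.1 (h.2.const_mul _), integral_const_mul]
  ring

lemma WellDefinedAt.localFunctional_eq (hα : 0 < alpha N p) (hp : 1 < p) (hr0 : 0 < r)
    (hr : r < 1) (hχ : IsCutoff N r χ k) {θ t : ℝ} (hH : MemH N p (w t) (G t) (ws t))
    (h : WellDefinedAt N p f w G ws t) :
    localFunctional p q θ r f χ w G ws t
      = ((∫ y in unitBall N, χ y * totalDensity N p f w G ws t y)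
      - Real.exp (-(gam p q * t)) * ∫ y in unitBall N, χ y * (w t y * ws t y * rho N p y))
      * Real.exp ((p + 3) / (2 * gam p q) * Real.exp (-(gam p q * t)))
      + θ * Real.exp (-(2 * gam p q * t)) := by
  have hx : MemLp (stateAt w G ws t) 2 (mu N r) := hH.memLp hα hr0 hr
  have i1 := (hχ.energyCoeff (p := p) hr).integrable hr.le hx hx
  have i2 : Integrable (fun y => χ y * totalDensity N p f w G ws t y) (mu N r) :=
    (h.integrableOn_totalDensity.mono_set (ball_subset_unitBall hr.le)).bdd_mul (c := 1)
      hχ.test.smooth.continuous.aestronglyMeasurable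
      (ae_of_all _ fun y => by
        rw [Real.norm_of_nonneg (hχ.nonneg y)]; exact hχ.le_one y)
  have e1 : ∀ y, (energyCoeff p χ).eval y (stateAt w G ws t y) (stateAt w G ws t y)
      - χ y * totalDensity N p f w G ws t y = χ y * rho N p y * potential p f t (w t y) := fun y => by
    have h3 : p + 1 ≠ 0 := by linarith
    have h4 : p - 1 ≠ 0 := by linarith
    simp only [Coeff.eval, energyCoeff, energyDensity, totalDensity, potentialDensity, potential,
      real_inner_self_eq_norm_sq]
    field_simp
    ring
  have e2 : ∀ y, (crossCoeff p χ).eval y (stateAt w G ws t y) (stateAt w G ws t y)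
      = χ y * (w t y * ws t y * rho N p y) := fun y => by
    simp only [Coeff.eval, crossCoeff]; ring
  rw [localFunctional, integral_unitBall_eq hr.le fun y hy => by rw [hχ.test.eq_zero hy, zero_mul],
    integral_unitBall_eq hr.le fun y hy => by rw [hχ.test.eq_zero hy, zero_mul]]
  simp only [← e1, e2]
  rw [integral_sub i1 i2, sub_sub_cancel]

/-- Dominated convergence, using absolute convergence of the integrals in `H` at the time
considered. It is needed at the two end times only. -/
lemma WellDefinedAt.tendsto_localFunctional (hα : 0 < alpha N p) (hp : 1 < p) {θ t : ℝ}
    (hH : MemH N p (w t) (G t) (ws t)) (h : WellDefinedAt N p f w G ws t) :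
    Tendsto (fun n : ℕ => localFunctional p q θ (cutoffRadius ((n : ℝ) + 1)) f
      (cutoff N ((n : ℝ) + 1)) w G ws t) atTop (𝓝 (H N p q θ f w G ws t)) := by
  rw [h.H_eq]
  have e := fun n : ℕ => h.localFunctional_eq (q := q) (θ := θ) hα hp
    (cutoffRadius_pos (one_le_natCast_add_one n)) (cutoffRadius_lt_one (one_le_natCast_add_one n))
    (isCutoff_cutoff (one_le_natCast_add_one n)) hH
  simp only [e]
  exact (((tendsto_integral_cutoff_mul h.integrableOn_totalDensity).sub
    ((tendsto_integral_cutoff_mul hH.integrableOn_mul).const_mul _)).mul_const _).add_const _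

lemma integral_dissipationCoeff_eq (hr : r < 1) (hχ : IsCutoff N r χ k) {t : ℝ} :
    ∫ y, (dissipationCoeff p χ).eval y (stateAt w G ws t y) (stateAt w G ws t y) ∂(mu N r)
      = ∫ y in unitBall N, χ y * dissipation N p ws t y := by
  rw [integral_unitBall_eq hr.le fun y hy => by rw [hχ.test.eq_zero hy, zero_mul]]
  congr with y
  simp only [Coeff.eval, dissipationCoeff, dissipation, div_eq_mul_inv]
  ring

lemma integrableOn_cutoff_mul_dissipation (hα : 0 < alpha N p) (hr0 : 0 < r) (hr : r < 1)
    (hχ : IsCutoff N r χ k) {t : ℝ} (hH : MemH N p (w t) (G t) (ws t)) :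
    IntegrableOn (fun y => χ y * dissipation N p ws t y) (unitBall N) := by
  have hx : MemLp (stateAt w G ws t) 2 (mu N r) := hH.memLp hα hr0 hr
  have i1 := (hχ.dissipationCoeff (p := p) hr).integrable hr.le hx hx
  have i2 : IntegrableOn (fun y => χ y * dissipation N p ws t y) (Metric.ball 0 r) := by
    refine i1.congr (ae_of_all _ fun y => ?_)
    simp only [Coeff.eval, dissipationCoeff, dissipation, div_eq_mul_inv]
    ring
  exact (i2.integrable_of_forall_notMem_eq_zero fun y hy => by
    rw [hχ.test.eq_zero hy, zero_mul]).integrableOn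

/-- One factor `1-|y|²` is moved to the slope, where their product is uniformly bounded; the
remaining density is the one that the Hardy inequality makes integrable. -/
lemma integral_layerCoeff_eq (hr0 : 0 < r) (hr : r < 1) (hχ : IsCutoff N r χ k) {t : ℝ} :
    ∫ y, (layerCoeff p k).eval y (stateAt w G ws t y) (stateAt w G ws t y) ∂(mu N r)
      = ∫ y in unitBall N, k y * (1 - ‖y‖ ^ 2) * layerDensity N p (w t) (G t) y := by
  rw [integral_unitBall_eq hr.le fun y hy => by
    rw [hχ.slope_eq_zero hr0 hy, zero_mul, zero_mul]]
  refine integral_congr_ae ?_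
  filter_upwards [ae_restrict_mem Metric.isOpen_ball.measurableSet] with y hy
  have h1 := (one_sub_normSq_pos (ball_subset_unitBall hr.le hy)).ne'
  simp only [Coeff.eval, layerCoeff, layerDensity, real_inner_self_eq_norm_sq]
  field_simp
  ring

lemma layerDensity_nonneg {w : Space N → ℝ} {G : Space N → Space N} {y : Space N}
    (hy : y ∈ unitBall N) : 0 ≤ layerDensity N p w G y := by
  have h1 := one_sub_normSq_pos hy
  have h2 := rho_pos (p := p) hy
  rw [layerDensity]; positivity

/-- The error caused by the cutoffs tends to zero. -/
lemma ContinuousInH.tendsto_integral_layer (hα : 0 < alpha N p) (hp : 1 < p)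
    (h : ContinuousInH N p s₀ w G ws) {a b : ℝ} (ha : s₀ ≤ a) (hab : a ≤ b) :
    Tendsto (fun n : ℕ => ∫ t in a..b, ∫ y, (layerCoeff p (cutoffSlope N ((n : ℝ) + 1))).eval y
      (stateAt w G ws t y) (stateAt w G ws t y) ∂(mu N (cutoffRadius ((n : ℝ) + 1)))) atTop
      (𝓝 0) := by
  obtain ⟨K, hK0, hK⟩ := exists_cutoffSlope_mul_le N
  obtain ⟨B, hB⟩ := h.exists_bound (b := b) ha
  have hχ := fun n : ℕ => isCutoff_cutoff (N := N) (one_le_natCast_add_one n)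
  have hr0 := fun n : ℕ => cutoffRadius_pos (one_le_natCast_add_one n)
  have hr1 := fun n : ℕ => cutoffRadius_lt_one (one_le_natCast_add_one n)
  have hp1 : 0 < p - 1 := by linarith
  set C := 1 + 3 * ((1 / alpha N p + (p + 3) / (p - 1)) / alpha N p) with hC
  have hC0 : 0 ≤ C := by positivity
  have hbound : ∀ n : ℕ, ∀ y ∈ unitBall N, ∀ t, ‖cutoffSlope N ((n : ℝ) + 1) y * (1 - ‖y‖ ^ 2)
      * layerDensity N p (w t) (G t) y‖ ≤ K * layerDensity N p (w t) (G t) y := fun n y hy t => by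
    have h1 := one_sub_normSq_pos hy
    have h2 := layerDensity_nonneg (p := p) (w := w t) (G := G t) hy
    have h3 := (hχ n).k_nonneg y
    rw [Real.norm_of_nonneg (by positivity)]
    exact mul_le_mul_of_nonneg_right (hK _ y) h2
  have h0 : ∫ _ in a..b, (0 : ℝ) = 0 := intervalIntegral.integral_zero
  rw [← h0]
  -- Dominated convergence twice: in time with a constant majorant from the bound in `ℋ`, and in
  -- space with a multiple of the layer density. A fixed point lies outside the layer once the
  -- cutoff is close enough to the sphere.
  refine intervalIntegral.tendsto_integral_filter_of_dominated_convergence (fun _ => K * (C * B))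
    (Eventually.of_forall fun n => ?_) (Eventually.of_forall fun n => ae_of_all _ fun t ht => ?_)
    intervalIntegrable_const (ae_of_all _ fun t ht => ?_)
  · rw [uIoc_of_le hab]
    exact ((intervalIntegrable_iff_integrableOn_Ioc_of_le hab).1 (intervalIntegrable_form hα
      (hr0 n) (hr1 n) h ((hχ n).layerCoeff (p := p) (hr1 n)) ha hab)).1
  · rw [uIoc_of_le hab] at ht
    have hi := (h.mem t (ha.trans ht.1.le)).integrableOn_layerDensity hα hp
    rw [integral_layerCoeff_eq (hr0 n) (hr1 n) (hχ n)]
    refine (norm_integral_le_of_norm_le (hi.1.const_mul K) ?_).trans ?_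
    · filter_upwards [ae_restrict_mem measurableSet_unitBall] with y hy
      exact hbound n y hy t
    · rw [integral_const_mul]
      exact mul_le_mul_of_nonneg_left
        (hi.2.trans (mul_le_mul_of_nonneg_left (hB t ⟨ht.1.le, ht.2⟩) hC0)) hK0
  · rw [uIoc_of_le hab] at ht
    have hi := (h.mem t (ha.trans ht.1.le)).integrableOn_layerDensity hα hp
    simp only [fun n => integral_layerCoeff_eq (p := p) (w := w) (G := G) (ws := ws) (t := t)
      (hr0 n) (hr1 n) (hχ n)]
    have h1 : ∫ _ in unitBall N, (0 : ℝ) = 0 := integral_zero _ _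
    rw [← h1]
    refine tendsto_integral_of_dominated_convergence
      (fun y => K * layerDensity N p (w t) (G t) y) (fun n => ?_) (hi.1.const_mul K) (fun n => ?_) ?_
    · exact (((hχ n).cont.mul continuous_one_sub_normSq).aestronglyMeasurable).mul
        hi.1.aestronglyMeasurable
    · filter_upwards [ae_restrict_mem measurableSet_unitBall] with y hy
      exact hbound n y hy t
    · filter_upwards [ae_restrict_mem measurableSet_unitBall] with y hy
      simpa using ((tendsto_cutoffSlope hy).mul_const (1 - ‖y‖ ^ 2)).mul_const
        (layerDensity N p (w t) (G t) y)

/-- The monotonicity formula is inherited from its localized versions. -/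
theorem IsSolution.dissipation_le (hα : 0 < alpha N p) (hp : 1 < p) (sol : IsSolution N p f g s₀ w G ws)
    {θ m s₁ s₂ : ℝ} (h₁ : s₀ ≤ s₁) (h₁₂ : s₁ ≤ s₂) (wd₁ : WellDefinedAt N p f w G ws s₁)
    (wd₂ : WellDefinedAt N p f w G ws s₂)
    (hloc : ∀ r : ℝ, 0 < r → r < 1 → ∀ χ k : Space N → ℝ, IsCutoff N r χ k →
      localFunctional p q θ r f χ w G ws s₂ - localFunctional p q θ r f χ w G ws s₁
        ≤ ∫ t in s₁..s₂, (-alpha N p * (∫ y, (dissipationCoeff p χ).eval y (stateAt w G ws t y)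
            (stateAt w G ws t y) ∂(mu N r))
          + m * ∫ y, (layerCoeff p k).eval y (stateAt w G ws t y) (stateAt w G ws t y)
            ∂(mu N r))) :
    (∀ᵐ s ∂(volume.restrict (Icc s₁ s₂)), IntegrableOn (dissipation N p ws s) (unitBall N)) ∧
    IntervalIntegrable (fun s => ∫ y in unitBall N, dissipation N p ws s y) volume s₁ s₂ ∧
    H N p q θ f w G ws s₂ - H N p q θ f w G ws s₁ ≤
      -alpha N p * ∫ s in s₁..s₂, ∫ y in unitBall N, dissipation N p ws s y := by
  have h := sol.continuousInH
  have hχ := fun n : ℕ => isCutoff_cutoff (N := N) (one_le_natCast_add_one n)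
  have hr0 := fun n : ℕ => cutoffRadius_pos (one_le_natCast_add_one n)
  have hr1 := fun n : ℕ => cutoffRadius_lt_one (one_le_natCast_add_one n)
  set D : ℕ → ℝ → ℝ := fun n t =>
    ∫ y in unitBall N, cutoff N ((n : ℝ) + 1) y * dissipation N p ws t y with hDdef
  set L : ℕ → ℝ → ℝ := fun n t => ∫ y, (layerCoeff p (cutoffSlope N ((n : ℝ) + 1))).eval y
      (stateAt w G ws t y) (stateAt w G ws t y) ∂(mu N (cutoffRadius ((n : ℝ) + 1))) with hLdef
  set U : ℕ → ℝ → ℝ := fun n => localFunctional p q θ (cutoffRadius ((n : ℝ) + 1)) f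
      (cutoff N ((n : ℝ) + 1)) w G ws with hUdef
  have eD : ∀ (n : ℕ) (t : ℝ), ∫ y, (dissipationCoeff p (cutoff N ((n : ℝ) + 1))).eval y (stateAt w G ws t y)
      (stateAt w G ws t y) ∂(mu N (cutoffRadius ((n : ℝ) + 1))) = D n t := fun n t =>
    integral_dissipationCoeff_eq (hr1 n) (hχ n)
  have iD : ∀ n, IntervalIntegrable (D n) volume s₁ s₂ := fun n => by
    have := intervalIntegrable_form hα (hr0 n) (hr1 n) h ((hχ n).dissipationCoeff (p := p) (hr1 n))
      h₁ h₁₂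
    simpa only [eD] using this
  have iL : ∀ n, IntervalIntegrable (L n) volume s₁ s₂ := fun n =>
    intervalIntegrable_form hα (hr0 n) (hr1 n) h ((hχ n).layerCoeff (p := p) (hr1 n)) h₁ h₁₂
  have key : ∀ n, ∫ t in s₁..s₂, D n t
      ≤ (U n s₁ - U n s₂ + m * ∫ t in s₁..s₂, L n t) / alpha N p := fun n => by
    have h1 := hloc _ (hr0 n) (hr1 n) _ _ (hχ n)
    simp only [eD] at h1
    rw [intervalIntegral.integral_add ((iD n).const_mul _) ((iL n).const_mul m),
      intervalIntegral.integral_const_mul, intervalIntegral.integral_const_mul] at h1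
    rw [le_div_iff₀ hα]
    simp only [hUdef, hLdef]
    linarith
  have hlim : Tendsto (fun n => (U n s₁ - U n s₂ + m * ∫ t in s₁..s₂, L n t) / alpha N p) atTop
      (𝓝 ((H N p q θ f w G ws s₁ - H N p q θ f w G ws s₂ + m * 0) / alpha N p)) :=
    (((wd₁.tendsto_localFunctional hα hp (h.mem _ h₁)).sub
      (wd₂.tendsto_localFunctional hα hp (h.mem _ (h₁.trans h₁₂)))).add
      ((h.tendsto_integral_layer hα hp h₁ h₁₂).const_mul m)).div_const _
  have iD' := fun n => (intervalIntegrable_iff_integrableOn_Ioc_of_le h₁₂).1 (iD n)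
  simp only [intervalIntegral.integral_of_le h₁₂] at key hlim ⊢
  have hd0 : ∀ t, ∀ y ∈ unitBall N, 0 ≤ dissipation N p ws t y := fun t y hy => by
    have h1 := one_sub_normSq_pos hy
    have h2 := rho_pos (p := p) hy
    rw [dissipation]; positivity
  have hF0 : ∀ (n : ℕ) (t : ℝ), 0 ≤ᵐ[volume.restrict (unitBall N)]
      fun y => cutoff N ((n : ℝ) + 1) y * dissipation N p ws t y := fun n t => by
    filter_upwards [ae_restrict_mem measurableSet_unitBall] with y hy
    exact mul_nonneg ((hχ n).nonneg y) (hd0 t y hy)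
  have hD0 : ∀ n, 0 ≤ᵐ[volume.restrict (Ioc s₁ s₂)] D n := fun n =>
    ae_of_all _ fun t => integral_nonneg_of_ae (hF0 n t)
  -- A Bochner integral of a non-integrable function is zero by convention, so spatial integrability
  -- at almost every time must come before the limit. Fatou in time makes the lower limit of the
  -- truncated integrals finite almost everywhere; Fatou in space concludes.
  have hfin : ∀ᵐ t ∂(volume.restrict (Ioc s₁ s₂)),
      IntegrableOn (dissipation N p ws t) (unitBall N) := by
    filter_upwards [ae_liminf_lt_top iD' hD0 key hlim, ae_restrict_mem measurableSet_Ioc] with t h1 ht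
    refine integrable_of_liminf_lt_top (fun n => integrableOn_cutoff_mul_dissipation hα (hr0 n)
      (hr1 n) (hχ n) (h.mem t (h₁.trans ht.1.le))) (fun n => hF0 n t) ?_ h1
    filter_upwards [ae_restrict_mem measurableSet_unitBall] with y hy
    simpa using (tendsto_cutoff hy).mul_const (dissipation N p ws t y)
  -- Now the truncated spatial integrals converge to the full ones at almost every time, and Fatou
  -- in time gives both the integrability and the inequality.
  obtain ⟨i, hle⟩ := integrable_and_integral_le_of_tendsto iD' hD0
    (f := fun t => ∫ y in unitBall N, dissipation N p ws t y)
    (by filter_upwards [hfin] with t ht using tendsto_integral_cutoff_mul ht) key hlim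
  refine ⟨?_, (intervalIntegrable_iff_integrableOn_Ioc_of_le h₁₂).2 i, ?_⟩
  · rwa [← restrict_Ioc_eq_restrict_Icc]
  · rw [le_div_iff₀ hα] at hle
    linarith

end Solution

end

end PerturbedWave

end

theorem theorem1p1 (N : ℕ) (hN : 1 ≤ N) (p q M : ℝ) (hp : 1 < p)
    (hpc : ((N : ℝ) - 1) * (p - 1) < 4) (hq : 0 ≤ q) (hqp : q < p) (hM : 0 < M) :
    ∃ S₀ θ₀ : ℝ, ∀ θ : ℝ, θ₀ ≤ θ →
      ∀ f g : ℝ → ℝ, LocallyLipschitz f → LocallyLipschitz g →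
        (∀ x, |f x| ≤ M * (1 + |x| ^ q)) → (∀ x, |g x| ≤ M * (1 + |x|)) →
      ∀ (s₀ : ℝ) (w : ℝ → PerturbedWave.Space N → ℝ)
        (G : ℝ → PerturbedWave.Space N → PerturbedWave.Space N)
        (ws : ℝ → PerturbedWave.Space N → ℝ),
        PerturbedWave.IsSolution N p f g s₀ w G ws →
      ∀ s₁ s₂ : ℝ, max s₀ S₀ ≤ s₁ → s₁ < s₂ →
        PerturbedWave.WellDefinedAt N p f w G ws s₁ →
        PerturbedWave.WellDefinedAt N p f w G ws s₂ →
        (∀ᵐ s ∂(volume.restrict (Set.Icc s₁ s₂)),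
          IntegrableOn (PerturbedWave.dissipation N p ws s) (PerturbedWave.unitBall N)) ∧
        IntervalIntegrable
          (fun s => ∫ y in PerturbedWave.unitBall N, PerturbedWave.dissipation N p ws s y)
          volume s₁ s₂ ∧
        PerturbedWave.H N p q θ f w G ws s₂ - PerturbedWave.H N p q θ f w G ws s₁ ≤
          -PerturbedWave.alpha N p *
            ∫ s in s₁..s₂, ∫ y in PerturbedWave.unitBall N,
              PerturbedWave.dissipation N p ws s y := by
  have hα := PerturbedWave.alpha_pos hp hpc
  obtain ⟨S₀, θ₀, m, -, -, key⟩ := PerturbedWave.exists_localFunctional_sub_le hα hp hq hqp hM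
  refine ⟨S₀, θ₀, fun θ hθ f g hf hg hfM hgM s₀ w G ws sol s₁ s₂ hs h₁₂ wd₁ wd₂ => ?_⟩
  have h₁ : s₀ ≤ s₁ := (le_max_left _ _).trans hs
  exact sol.dissipation_le hα hp h₁ h₁₂.le wd₁ wd₂ fun r hr0 hr χ k hχ =>
    key θ hθ f g hf.continuous hg.continuous hfM hgM s₀ w G ws sol r hr0 hr χ k hχ s₁ s₂ h₁
      ((le_max_right _ _).trans hs) h₁₂.le
      (wd₁.integrable_rpow hα hp hr0 hr (sol.continuousInH.mem _ h₁))
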